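/- **Theorem 1.4.** There are an absolute constant $C$ and a single randomized single-pass streaming program $P$ such that the following holds for all $n\ge 1$ and every simple graph $G$ with vertex set $\{0,\dots,n-1\}$ and $m\ge 3n$ edges. *Model.* $P$ is a fixed program for a random-access machine whose memory cells hold natural numbers. Initially two cells contain $n$ and $m$, and all others contain $0$. The program has assignments (with arithmetic $+,-,\cdot,\div$ on natural numbers and indirect addressing), conditionals and while-loops, can flip fair independent coins, and can read the next edge of the stream, given by the labels of its two endpoints; edges that have been read cannot be read again (single pass). The number of bits of memory in use at a given time is the total length of the binary expansions of the contents of all cells up to the last nonzero one, plus one bit for each of these cells. *Claim.* Let $\mathrm{MM}(G)$ be the maximum size of a matching in $G$, and let $X$ be the natural number that $P$ outputs when it is run on the edges of $G$. 1. For every order of the edges and all outcomes of the coin flips, $P$ terminates, and at every time at most $C\log^2 n$ bits of memory are in use. 2. If the edges of $G$ arrive in a uniformly random order, then with probability at least $3/4$ (over the order and the independent coin flips), $X$ is an $O(\log^2 n)$-factor approximation to $\mathrm{MM}(G)$: $$X\;\le\;\mathrm{MM}(G)\;\le\; C\log^2 n\cdot X .$$ -/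

import Mathlib

namespace StreamRAM

/-- Arithmetic expressions over a random-access memory whose cells hold natural numbers.
`get e` is the content of the cell whose address is the value of `e`; `sub` is truncated
subtraction and `div` is integer division (with value `0` if the divisor is `0`). -/
inductive Expr : Type
  | lit (k : ℕ) : Expr
  | get (e : Expr) : Expr
  | add (e₁ e₂ : Expr) : Expr
  | sub (e₁ e₂ : Expr) : Expr
  | mul (e₁ e₂ : Expr) : Expr
  | div (e₁ e₂ : Expr) : Expr

/-- The memory: cell `a` holds `mem a`. -/
abbrev Mem : Type := ℕ → ℕ

/-- The value of an expression. -/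
def Expr.eval (mem : Mem) : Expr → ℕ
  | .lit k => k
  | .get e => mem (e.eval mem)
  | .add e₁ e₂ => e₁.eval mem + e₂.eval mem
  | .sub e₁ e₂ => e₁.eval mem - e₂.eval mem
  | .mul e₁ e₂ => e₁.eval mem * e₂.eval mem
  | .div e₁ e₂ => e₁.eval mem / e₂.eval mem

/-- Programs of a probabilistic random-access machine with a one-way edge stream.
* `set a e` stores the value of `e` in the cell with address the value of `a`;
* `flip a` stores the outcome of a fair coin flip, `0` or `1`, in cell `a`;
* `next u v f` reads the next edge of the stream: its endpoints go to the cells `u` and `v`, and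
  the flag `1` to the cell `f`; if the stream is exhausted, the only effect is that `f` becomes `0`;
* `ite` and `loop` are conditional and while-loop, where a nonzero value means true. -/
inductive Prog : Type
  | skip : Prog
  | set (a e : Expr) : Prog
  | flip (a : ℕ) : Prog
  | next (u v f : ℕ) : Prog
  | seq (p q : Prog) : Prog
  | ite (e : Expr) (p q : Prog) : Prog
  | loop (e : Expr) (p : Prog) : Prog

/-- A configuration: the code that is still to be executed, the memory, and the part of the stream
that has not been read. The code reachable from a fixed program ranges over a finite set that
depends only on the program (it plays the role of a program counter). -/
structure Config : Type where
  code : List Prog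
  mem : Mem
  stream : List (ℕ × ℕ)

/-- One step of the machine. Each step is supplied with its own coin, which is looked at only
by `flip`. -/
def step (c : Config) (coin : Bool) : Config :=
  match c with
  | ⟨[], mem, s⟩ => ⟨[], mem, s⟩
  | ⟨.skip :: k, mem, s⟩ => ⟨k, mem, s⟩
  | ⟨.set a e :: k, mem, s⟩ => ⟨k, Function.update mem (a.eval mem) (e.eval mem), s⟩
  | ⟨.flip a :: k, mem, s⟩ => ⟨k, Function.update mem a (if coin then 1 else 0), s⟩
  | ⟨.next _ _ f :: k, mem, []⟩ => ⟨k, Function.update mem f 0, []⟩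
  | ⟨.next u v f :: k, mem, (x, y) :: s⟩ =>
      ⟨k, Function.update (Function.update (Function.update mem u x) v y) f 1, s⟩
  | ⟨.seq p q :: k, mem, s⟩ => ⟨p :: q :: k, mem, s⟩
  | ⟨.ite e p q :: k, mem, s⟩ => ⟨(if e.eval mem = 0 then q else p) :: k, mem, s⟩
  | ⟨.loop e p :: k, mem, s⟩ =>
      ⟨if e.eval mem = 0 then k else p :: .loop e p :: k, mem, s⟩

/-- The initial configuration on parameters `n`, `m` and a stream: `n` is in cell `0`, `m` is in
cell `1`, and all other cells hold `0`. -/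
def init (P : Prog) (n m : ℕ) (s : List (ℕ × ℕ)) : Config :=
  ⟨[P], Function.update (Function.update (fun _ => 0) 0 n) 1 m, s⟩

/-- The configuration reached after `coins.length` steps with the given coins. -/
def run (P : Prog) (n m : ℕ) (s : List (ℕ × ℕ)) (coins : List Bool) : Config :=
  coins.foldl step (init P n m s)

/-- The program has terminated. -/
def Config.Halted (c : Config) : Prop := c.code = []

/-- The output of a terminated computation: the content of cell `0`. -/
def Config.output (c : Config) : ℕ := c.mem 0

/-- The memory content occupies at most `b` bits: for some `K` all cells from address `K` on are
`0`, and the cells below `K` occupy `b` bits together. A cell that holds `x` is charged the length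
of the binary expansion of `x` and one more bit, and cells that hold `0` below the last nonzero one
are charged as well. -/
def MemFits (mem : Mem) (b : ℝ) : Prop :=
  ∃ K : ℕ, (∀ a, K ≤ a → mem a = 0) ∧
    ((∑ a ∈ Finset.range K, (Nat.size (mem a) + 1) : ℕ) : ℝ) ≤ b

end StreamRAM

namespace SimpleGraph

/-- The size of a maximum matching. -/
noncomputable def maxMatchingSize {V : Type*} [Finite V] (G : SimpleGraph V) : ℕ :=
  sSup {k : ℕ | ∃ M : G.Subgraph, M.IsMatching ∧ M.edgeSet.ncard = k}

/-- The orders in which the edges of a graph can arrive. -/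
abbrev EdgeOrder {n : ℕ} (G : SimpleGraph (Fin n)) [DecidableRel G.Adj] : Type :=
  Fin G.edgeFinset.card ≃ G.edgeSet

instance {n : ℕ} (G : SimpleGraph (Fin n)) [DecidableRel G.Adj] : Nonempty G.EdgeOrder :=
  ⟨(Fintype.equivFinOfCardEq (by rw [SimpleGraph.edgeFinset_card])).symm⟩

/-- The edge stream that belongs to an order of the edges. The edge `{u, v}` with `u < v` is
presented as the pair `(u, v)`. -/
def EdgeOrder.stream {n : ℕ} {G : SimpleGraph (Fin n)} [DecidableRel G.Adj] (σ : G.EdgeOrder) :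
    List (ℕ × ℕ) :=
  List.ofFn fun i => (((σ i : Sym2 (Fin n)).inf : ℕ), ((σ i : Sym2 (Fin n)).sup : ℕ))

end SimpleGraph

/-! The program is deterministic; the random order of the edges is the only randomness. Vertices are
tested in stages. In stage `j` a vertex `v` makes `4 ^ j` trials, each reading one edge. If that
edge leads from `v` to `w`, then `w` is tested recursively through `j` stages, and `v` fails if `w`
survives all of them or if the charges for failed tests exceed a budget `4 ^ j`. An edge test sends
both endpoints of the next edge through the stages and earns credit `4 ^ j` for each level `j` that
is reached, up to a level `J` with `4 ^ J` of the order of the number `m` of edges.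

The expected credit `κ` of one edge test determines the maximum matching size `μ` up to factors of
order `J`.

Upper bound on `κ`: a vertex that survives `4 ^ j` trials rarely meets a fatal edge in one further
trial, because `K * (F ^ K * S) ≤ 1` whenever `F + S ≤ 1` (`survive_succ_mul_hits_le`). Summing over
a vertex cover of at most `2 * μ` vertices gives `κ ≤ 1 + 8 * J * μ` (`credit_le`).

Lower bound on `κ`: a failing vertex has edges on which both endpoints survive, and these carry
credit, so the expected number of failing vertices is `O(J) * κ` (`sum_failBefore_le`). For an edge
of a maximum matching, either both endpoints survive, which earns at least `4 ^ J`, or an endpoint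
fails. Since the endpoints are distinct, this yields `μ = O(J) * κ`, even conditionally on a likely
event about earlier reads (`card_matching_mul_le`).

Edges are tested until the total credit reaches `4 ^ J`. The number `N` of tests is then of the
order of `4 ^ J / κ`: it is rarely small by Markov's inequality (`countTests_words_le`) and rarely
large by Wald's identity (`sum_creditAfter_mul_credit_le`). Hence `4 ^ J / N` gives `μ` up to a
factor of order `J ^ 2`.

Reading a stream is sampling without replacement, so the tests are not independent. However, the
probability that a random order starts with a given word depends only on the multiset of its
letters. Sets of outcomes can therefore be encoded by polynomials in commuting edge variables, with
composition of procedures turned into multiplication. The preorder that compares expectations for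
every edge set is compatible with this multiplication, so inequalities can be proved as if
successive reads were independent. The budgets keep the number of reads below `21 * 4 ^ J ≤ m`, so
the stream is never exhausted.

On the machine the recursion becomes a stack of at most `J` frames of four cells. Thus `4 * J + 19`
cells with `O(log n)` bits each suffice. -/

/-! ### The ordered semiring of words. -/

/-- Formal sums, with multiplicities, of words of edges up to reordering. A set of outcomes of a
procedure that reads edges one by one is recorded as the sum of the words it reads. -/
def Words : Type := MvPolynomial (ℕ × ℕ) ℕ

namespace Words

noncomputable instance : CommSemiring Words := inferInstanceAs (CommSemiring (MvPolynomial _ ℕ))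

/-- The word that consists of a single edge. -/
noncomputable def X (e : ℕ × ℕ) : Words := (MvPolynomial.X e : MvPolynomial (ℕ × ℕ) ℕ)

/-- The word with a given multiset of letters. -/
noncomputable def mono (u : ℕ × ℕ →₀ ℕ) : Words :=
  (MvPolynomial.monomial u 1 : MvPolynomial (ℕ × ℕ) ℕ)

open Classical in
/-- The probability that a uniformly random order of `R` starts with a given word whose multiset of
letters is `a`. -/
noncomputable def weight (R : Finset (ℕ × ℕ)) (a : ℕ × ℕ →₀ ℕ) : ℝ :=
  if (∀ i, a i ≤ 1) ∧ a.support ⊆ R then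
    ((R.card - a.support.card).factorial : ℝ) / R.card.factorial else 0

/-- The expected number of words of `p` with which a uniformly random order of `R` starts. -/
noncomputable def pr (R : Finset (ℕ × ℕ)) : Words →+ ℝ :=
  ((MvPolynomial.basisMonomials (ℕ × ℕ) ℕ).constr ℕ (weight R)).toAddMonoidHom

theorem induct {P : Words → Prop}
    (mon : ∀ u, P (mono u))
    (add : ∀ p q, P p → P q → P (p + q)) (zero : P 0) (p : Words) : P p := by
  refine MvPolynomial.induction_on' (P := fun p : MvPolynomial (ℕ × ℕ) ℕ => P p) p
    (fun u a => ?_) add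
  induction a with
  | zero => rw [map_zero]; exact zero
  | succ k ih => rw [map_add]; exact add _ _ ih (mon u)

theorem pr_monomial (R : Finset (ℕ × ℕ)) (u : ℕ × ℕ →₀ ℕ) :
    pr R (mono u) = weight R u := by
  have := (MvPolynomial.basisMonomials (ℕ × ℕ) ℕ).constr_basis ℕ (weight R) u
  rw [MvPolynomial.coe_basisMonomials] at this
  exact this

theorem weight_nonneg (R : Finset (ℕ × ℕ)) (a : ℕ × ℕ →₀ ℕ) : 0 ≤ weight R a := by
  unfold weight; split_ifs <;> positivity

theorem pr_nonneg (R : Finset (ℕ × ℕ)) (p : Words) : 0 ≤ pr R p := by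
  induction p using induct with
  | mon u => rw [pr_monomial]; exact weight_nonneg _ _
  | add p q hp hq => rw [map_add]; exact add_nonneg hp hq
  | zero => simp

theorem one_eq : (1 : Words) = mono 0 := rfl

theorem pr_one (R : Finset (ℕ × ℕ)) : pr R 1 = 1 := by
  rw [one_eq, pr_monomial]
  simp [weight, Nat.factorial_ne_zero]

/-- Condition on the first edge: it is `e` with probability `1 / R.card`, and the rest is then a
uniformly random order of `R.erase e`. If `e` occurs again in `a`, both sides vanish. -/
theorem weight_single_add (R : Finset (ℕ × ℕ)) (e : ℕ × ℕ) (a : ℕ × ℕ →₀ ℕ) :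
    weight R (Finsupp.single e 1 + a) =
      if e ∈ R then (R.card : ℝ)⁻¹ * weight (R.erase e) a else 0 := by
  classical
  have hv : ∀ i, (Finsupp.single e 1 + a : ℕ × ℕ →₀ ℕ) i =
    (if e = i then 1 else 0) + a i := fun i => by
    simp [Finsupp.single_apply]
  have hmem : e ∈ (Finsupp.single e 1 + a).support := by simp
  split_ifs with he
  · by_cases h : (∀ i, a i ≤ 1) ∧ a.support ⊆ R.erase e
    · have hae : a e = 0 := by
        by_contra h0
        exact absurd (h.2 (Finsupp.mem_support_iff.2 h0)) (by simp)
      have hs : (Finsupp.single e 1 + a).support = insert e a.support := by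
        ext i
        by_cases hi : e = i
        · subst hi; simp
        · simp [Ne.symm hi]
      have h1 : (∀ i, (Finsupp.single e 1 + a : ℕ × ℕ →₀ ℕ) i ≤ 1) ∧
          (Finsupp.single e 1 + a).support ⊆ R := by
        refine ⟨fun i => ?_, ?_⟩
        · rw [hv]
          split_ifs with hi
          · subst hi; omega
          · have := h.1 i; omega
        · rw [hs]
          exact Finset.insert_subset he (h.2.trans (Finset.erase_subset _ _))
      have hc : (insert e a.support).card = a.support.card + 1 :=
        Finset.card_insert_of_notMem (by simpa using hae)
      have hR : 0 < R.card := Finset.card_pos.2 ⟨e, he⟩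
      rw [weight, weight, if_pos h1, if_pos h, hs, hc, Finset.card_erase_of_mem he]
      obtain ⟨r, hr⟩ : ∃ r, R.card = r + 1 := ⟨R.card - 1, by omega⟩
      rw [hr, Nat.factorial_succ, show r + 1 - (a.support.card + 1) = r - a.support.card by omega,
        Nat.add_sub_cancel]
      push_cast
      field_simp
    · have h1 : ¬ ((∀ i, (Finsupp.single e 1 + a : ℕ × ℕ →₀ ℕ) i ≤ 1) ∧
          (Finsupp.single e 1 + a).support ⊆ R) := by
        rintro ⟨h2, h3⟩
        refine h ⟨fun i => le_trans (by rw [hv]; omega) (h2 i), fun i hi => ?_⟩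
        have hi' : a i ≠ 0 := Finsupp.mem_support_iff.1 hi
        refine Finset.mem_erase.2 ⟨?_, h3 (Finsupp.mem_support_iff.2 (by rw [hv]; omega))⟩
        rintro rfl
        have := h2 i
        rw [hv, if_pos rfl] at this
        omega
      rw [weight, weight, if_neg h1, if_neg h, mul_zero]
  · rw [weight, if_neg]
    exact fun h => he (h.2 hmem)

theorem X_mul_monomial (e : ℕ × ℕ) (u : ℕ × ℕ →₀ ℕ) :
    X e * mono u = mono (Finsupp.single e 1 + u) := by
  have := MvPolynomial.monomial_mul (R := ℕ) (s := Finsupp.single e 1) (s' := u) (a := 1) (b := 1)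
  rw [mul_one] at this
  exact this

theorem pr_X_mul (R : Finset (ℕ × ℕ)) (e : ℕ × ℕ) (p : Words) :
    pr R (X e * p) = if e ∈ R then (R.card : ℝ)⁻¹ * pr (R.erase e) p else 0 := by
  induction p using induct with
  | mon u => rw [X_mul_monomial, pr_monomial, pr_monomial, weight_single_add]
  | add p q hp hq => rw [mul_add, map_add, map_add, hp, hq]; split_ifs <;> ring
  | zero => simp

/-- Comparison of expected numbers of words, for all sets of edges. -/
noncomputable instance : Preorder Words where
  le p q := ∀ R, pr R p ≤ pr R q
  le_refl _ _ := le_rfl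
  le_trans _ _ _ h h' R := (h R).trans (h' R)

theorem zero_le (p : Words) : 0 ≤ p := fun R => by rw [map_zero]; exact pr_nonneg R p

instance : AddLeftMono Words := ⟨fun p q r h R => by
  simp only [map_add]; exact add_le_add_right (h R) _⟩

theorem induct_X {P : Words → Prop} (nat : ∀ k : ℕ, P k)
    (add : ∀ p q, P p → P q → P (p + q)) (mul : ∀ p e, P p → P (X e * p)) (p : Words) : P p := by
  refine MvPolynomial.induction_on (motive := fun p : MvPolynomial (ℕ × ℕ) ℕ => P p) p
    (fun a => ?_) add fun q e hq => ?_
  · have : (MvPolynomial.C a : MvPolynomial (ℕ × ℕ) ℕ) = (a : MvPolynomial (ℕ × ℕ) ℕ) := by simp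
    rw [this]
    exact nat a
  · exact Eq.mp (congrArg P (@mul_comm Words _ (X e) q)) (mul q e hq)

theorem natCast_mul_le {q r : Words} (k : ℕ) : q ≤ r → (k : Words) * q ≤ k * r := fun h R => by
  rw [← nsmul_eq_mul, ← nsmul_eq_mul, map_nsmul, map_nsmul]
  exact nsmul_le_nsmul_right (h R) k

/-- Commutativity moves a letter of `p` to the front, where it only replaces `R` by `R.erase e`.
This is why the preorder quantifies over all `R`. -/
instance : MulLeftMono Words := ⟨fun p q r h => by
  show p * q ≤ p * r
  induction p using induct_X generalizing q r with
  | nat k => exact natCast_mul_le k h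
  | add p p' hp hp' => rw [add_mul, add_mul]; exact add_le_add (hp q r h) (hp' q r h)
  | mul p e hp =>
    intro R
    rw [mul_assoc, mul_assoc, pr_X_mul, pr_X_mul]
    split_ifs
    · exact mul_le_mul_of_nonneg_left (hp q r h _) (by positivity)
    · exact le_rfl⟩

theorem le_of_natCast_mul_le {q r : Words} {k : ℕ} (hk : 0 < k) (h : (k : Words) * q ≤ k * r) :
    q ≤ r := fun R => by
  have := h R
  rw [← nsmul_eq_mul, ← nsmul_eq_mul, map_nsmul, map_nsmul, nsmul_eq_mul, nsmul_eq_mul] at this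
  exact le_of_mul_le_mul_left this (by exact_mod_cast hk)

theorem pr_natCast (R : Finset (ℕ × ℕ)) (k : ℕ) : pr R (k : Words) = k := by
  rw [← nsmul_one, map_nsmul, pr_one, nsmul_one]

theorem pr_natCast_mul (R : Finset (ℕ × ℕ)) (k : ℕ) (p : Words) : pr R (k * p) = k * pr R p := by
  rw [← nsmul_eq_mul, map_nsmul, nsmul_eq_mul]

theorem natCast_le {k l : ℕ} (h : k ≤ l) : (k : Words) ≤ l := fun R => by
  rw [pr_natCast, pr_natCast]; exact_mod_cast h

theorem mul_le_of_le_one {p q : Words} (h : q ≤ 1) : p * q ≤ p :=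
  (mul_le_mul_right h p).trans_eq (mul_one p)

theorem prod_le_one {ι : Type*} (s : Finset ι) (f : ι → Words) (h : ∀ i ∈ s, f i ≤ 1) :
    ∏ i ∈ s, f i ≤ 1 := Finset.prod_le_one' h

/-- Inequality is the best possible here: the sum is lost when `R` is empty, that is, when the
stream is exhausted. -/
theorem sum_X_le_one (E : Finset (ℕ × ℕ)) : ∑ e ∈ E, X e ≤ 1 := fun R => by
  have : ∀ e, pr R (X e) = if e ∈ R then (R.card : ℝ)⁻¹ else 0 := fun e => by
    have := pr_X_mul R e 1
    rwa [mul_one, pr_one, mul_one] at this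
  rw [map_sum, pr_one, Finset.sum_congr rfl fun e _ => this e, ← Finset.sum_filter,
    Finset.sum_const, nsmul_eq_mul]
  have : (E.filter (· ∈ R)).card ≤ R.card := Finset.card_le_card fun x hx => by simp_all
  have h' : ((E.filter (· ∈ R)).card : ℝ) ≤ R.card := by exact_mod_cast this
  exact (mul_le_mul_of_nonneg_right h' (by positivity)).trans (mul_inv_le_one)

/-! ### Words of bounded length -/

/-- All words of the sum have length at most `d`. -/
inductive Short : ℕ → Words → Prop
  | nat (d k : ℕ) : Short d k
  | add {d : ℕ} {p q : Words} : Short d p → Short d q → Short d (p + q)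
  | X_mul {d : ℕ} {p : Words} (e : ℕ × ℕ) : Short d p → Short (d + 1) (X e * p)

namespace Short

theorem mono {d d' : ℕ} {p : Words} (h : Short d p) (hd : d ≤ d') : Short d' p := by
  induction h generalizing d' with
  | nat => exact nat _ _
  | add _ _ hp hq => exact add (hp hd) (hq hd)
  | X_mul e _ hp =>
    obtain ⟨k, rfl⟩ := Nat.exists_eq_add_of_le' hd
    exact X_mul (d := k + _) e (hp (by omega))

theorem sum {d : ℕ} {ι : Type*} (s : Finset ι) (f : ι → Words) (h : ∀ i ∈ s, Short d (f i)) :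
    Short d (∑ i ∈ s, f i) := by
  classical
  induction s using Finset.induction_on with
  | empty => rw [Finset.sum_empty]; exact_mod_cast nat d 0
  | insert a s ha ih =>
    rw [Finset.sum_insert ha]
    exact add (h a (by simp)) (ih fun i hi => h i (by simp [hi]))

theorem natCast_mul {d : ℕ} {p : Words} (k : ℕ) (h : Short d p) : Short d (k * p) := by
  induction k with
  | zero => rw [Nat.cast_zero, zero_mul]; exact_mod_cast nat d 0
  | succ k ih => rw [Nat.cast_succ, add_mul, one_mul]; exact add ih h

theorem mul {d d' : ℕ} {p q : Words} (h : Short d p) (h' : Short d' q) :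
    Short (d + d') (p * q) := by
  induction h with
  | nat => exact (h'.natCast_mul _).mono (by omega)
  | add _ _ hp hq => rw [add_mul]; exact add hp hq
  | X_mul e _ hp => rw [mul_assoc]; exact (X_mul e hp).mono (by omega)

/-- After at most `d < R.card` reads a next edge still exists, so summing over its possible values
loses nothing. -/
theorem pr_mul_sum_X {d : ℕ} {p : Words} (h : Short d p) {R E : Finset (ℕ × ℕ)} (hR : R ⊆ E)
    (hd : d < R.card) : pr R (p * ∑ e ∈ E, X e) = pr R p := by
  induction h generalizing R with
  | nat d k =>
    rw [pr_natCast_mul, pr_natCast, map_sum]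
    have : ∀ e, pr R (X e) = if e ∈ R then (R.card : ℝ)⁻¹ else 0 := fun e => by
      have := pr_X_mul R e 1
      rwa [mul_one, pr_one, mul_one] at this
    have h0 : (R.card : ℝ) ≠ 0 := by norm_cast; omega
    rw [Finset.sum_congr rfl fun e _ => this e, ← Finset.sum_filter, Finset.sum_const,
      Finset.filter_mem_eq_inter, Finset.inter_eq_right.2 hR, nsmul_eq_mul, mul_inv_cancel₀ h0,
      mul_one]
  | add _ _ hp hq => rw [add_mul, map_add, map_add, hp hR hd, hq hR hd]
  | X_mul f _ hp =>
    rw [mul_assoc, pr_X_mul, pr_X_mul]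
    split_ifs with hf
    · rw [hp ((Finset.erase_subset _ _).trans hR) (by rw [Finset.card_erase_of_mem hf]; omega)]
    · rfl

/-- After at most `d` reads, at least `R.card - d` edges remain, all equally likely to come next. -/
theorem pr_mul_X_le {d : ℕ} {p : Words} (h : Short d p) {R : Finset (ℕ × ℕ)} (e : ℕ × ℕ)
    (hd : d < R.card) : pr R (p * X e) ≤ ((R.card : ℝ) - d)⁻¹ * pr R p := by
  induction h generalizing R with
  | nat d k =>
    rw [mul_comm, pr_X_mul, pr_natCast, pr_natCast]
    have h1 : (0 : ℝ) < (R.card : ℝ) - d := by rw [sub_pos]; exact_mod_cast hd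
    split_ifs
    · gcongr
      simp
    · positivity
  | add _ _ hp hq => rw [add_mul, map_add, map_add, mul_add]; exact add_le_add (hp hd) (hq hd)
  | @X_mul d p f _ hp =>
    rw [mul_assoc, pr_X_mul, pr_X_mul]
    split_ifs with hf
    · have h1 := Finset.card_erase_of_mem hf
      have := hp (R := R.erase f) (by omega)
      have h2 : ((R.erase f).card : ℝ) = R.card - 1 := by
        rw [h1, Nat.cast_sub (by omega)]; simp
      rw [h2] at this
      calc _ ≤ (R.card : ℝ)⁻¹ * (((R.card : ℝ) - 1 - d)⁻¹ * pr (R.erase f) p) := by gcongr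
        _ = _ := by push_cast; ring
    · simp

end Short

end Words

/-! ### Procedures that read edges, and their words. -/

/-- Procedures that read edges one after the other and return an element of `α`. -/
inductive EdgeReader (α : Type) : Type
  | ret (x : α) : EdgeReader α
  | read (k : ℕ × ℕ → EdgeReader α) : EdgeReader α

namespace EdgeReader

open Words

variable {α β : Type}

/-- Sequential composition. -/
def bind : EdgeReader α → (α → EdgeReader β) → EdgeReader β
  | ret x, f => f x
  | read k, f => read fun e => (k e).bind f

/-- Run a procedure on a stream; `none` if the stream is exhausted too early. -/
def run : EdgeReader α → List (ℕ × ℕ) → Option (α × List (ℕ × ℕ))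
  | ret x, s => some (x, s)
  | read _, [] => none
  | read k, e :: s => (k e).run s

/-- The words of edges of `E` that a procedure can read until it returns, weighted by a function of
the returned value. -/
noncomputable def words (E : Finset (ℕ × ℕ)) : EdgeReader α → (α → Words) → Words
  | ret x, g => g x
  | read k, g => ∑ e ∈ E, X e * (k e).words E g

/-- `P (c + d) x` holds whenever the procedure returns `x` after reading `d` edges. -/
def Leaves (P : ℕ → α → Prop) : ℕ → EdgeReader α → Prop
  | c, ret x => P c x
  | c, read k => ∀ e, (k e).Leaves P (c + 1)

variable {E : Finset (ℕ × ℕ)}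

theorem words_add (T : EdgeReader α) (g h : α → Words) :
    T.words E (fun x => g x + h x) = T.words E g + T.words E h := by
  induction T with
  | ret x => rfl
  | read k ih => simp only [words, ih, mul_add, Finset.sum_add_distrib]

theorem words_mul (T : EdgeReader α) (p : Words) (g : α → Words) :
    T.words E (fun x => p * g x) = p * T.words E g := by
  induction T with
  | ret x => rfl
  | read k ih =>
    simp only [words, ih, Finset.mul_sum]
    exact Finset.sum_congr rfl fun e _ => mul_left_comm _ _ _

theorem words_zero (T : EdgeReader α) : T.words E (fun _ => 0) = 0 := by
  have := words_mul (E := E) T 0 fun _ => 0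
  simpa using this

/-- When the words of the second procedure do not depend on the result of the first, `words_mul`
turns this into a plain product, which plays the role of independence. -/
theorem words_bind (T : EdgeReader α) (f : α → EdgeReader β) (g : β → Words) :
    (T.bind f).words E g = T.words E fun x => (f x).words E g := by
  induction T with
  | ret x => rfl
  | read k ih => simp only [words, bind, ih]

theorem words_mono_of_leaves {c : ℕ} {T : EdgeReader α} {g h : α → Words}
    (hT : T.Leaves (fun _ x => g x ≤ h x) c) : T.words E g ≤ T.words E h := by
  induction T generalizing c with
  | ret x => exact hT
  | read k ih => exact Finset.sum_le_sum fun e _ => mul_le_mul_right (ih e (hT e)) _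

theorem leaves_of_forall {P : ℕ → α → Prop} (h : ∀ c x, P c x) (c : ℕ) (T : EdgeReader α) :
    T.Leaves P c := by
  induction T generalizing c with
  | ret x => exact h c x
  | read k ih => exact fun e => ih e _

theorem words_mono (T : EdgeReader α) {g h : α → Words} (H : ∀ x, g x ≤ h x) :
    T.words E g ≤ T.words E h :=
  words_mono_of_leaves (leaves_of_forall (fun _ => H) 0 T)

theorem words_one_le (T : EdgeReader α) : T.words E (fun _ => 1) ≤ 1 := by
  induction T with
  | ret x => exact le_rfl
  | read k ih =>
    refine le_trans (Finset.sum_le_sum fun e _ => ?_) (sum_X_le_one E)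
    exact mul_le_of_le_one (ih e)

theorem words_const_le (T : EdgeReader α) (p : Words) : T.words E (fun _ => p) ≤ p := by
  have := words_mul (E := E) T p fun _ => 1
  simp only [mul_one] at this
  rw [this]
  exact mul_le_of_le_one T.words_one_le

theorem words_le_of_leaves {c : ℕ} {T : EdgeReader α} {g : α → Words} {p : Words}
    (hT : T.Leaves (fun _ x => g x ≤ p) c) : T.words E g ≤ p :=
  (words_mono_of_leaves hT).trans (T.words_const_le p)

theorem words_le (T : EdgeReader α) {g : α → Words} {p : Words} (h : ∀ x, g x ≤ p) :
    T.words E g ≤ p := (T.words_mono h).trans (T.words_const_le p)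

theorem Leaves.imp {P Q : ℕ → α → Prop} (h : ∀ c x, P c x → Q c x) {c : ℕ} {T : EdgeReader α}
    (hT : T.Leaves P c) : T.Leaves Q c := by
  induction T generalizing c with
  | ret x => exact h c x hT
  | read k ih => exact fun e => ih e (hT e)

theorem Leaves.bind {P : ℕ → α → Prop} {Q : ℕ → β → Prop} {c : ℕ} {T : EdgeReader α}
    {f : α → EdgeReader β}
    (hT : T.Leaves P c) (h : ∀ c x, P c x → (f x).Leaves Q c) : (T.bind f).Leaves Q c := by
  induction T generalizing c with
  | ret x => exact h c x hT
  | read k ih => exact fun e => ih e (hT e)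

theorem Leaves.le {c d : ℕ} {T : EdgeReader α} (hT : T.Leaves (fun c' _ => c' ≤ d) c) : c ≤ d := by
  induction T generalizing c with
  | ret x => exact hT
  | read k ih => exact (Nat.le_succ c).trans (ih (0, 0) (hT _))

theorem Leaves.short {c d : ℕ} {T : EdgeReader α} (hT : T.Leaves (fun c' _ => c' ≤ d) c)
    (g : α → ℕ) :
    Short (d - c) (T.words E fun x => (g x : Words)) := by
  induction T generalizing c with
  | ret x => exact Short.nat _ _
  | read k ih =>
    refine Short.sum _ _ fun e _ => ?_
    have h1 := (hT e).le
    have h2 := Short.X_mul e (ih e (hT e))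
    rwa [show d - (c + 1) + 1 = d - c by omega] at h2

theorem Leaves.run_isSome {c d : ℕ} {T : EdgeReader α} (hT : T.Leaves (fun c' _ => c' ≤ d) c)
    (s : List (ℕ × ℕ)) (hs : d - c ≤ s.length) : ∃ x s', T.run s = some (x, s') := by
  induction T generalizing c s with
  | ret x => exact ⟨x, s, rfl⟩
  | read k ih =>
    have h1 := (hT (0, 0)).le
    cases s with
    | nil => simp at hs; omega
    | cons e s => exact ih e (hT e) s (by simp at hs; omega)

/-- Exhaustion of the edges is the only way in which a procedure can fail to return. -/
theorem Leaves.pr_mul_words_one {c d d' : ℕ} {T : EdgeReader α} {p : Words}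
    (hT : T.Leaves (fun c' _ => c' ≤ d) c) (hp : Short d' p) (hd : d' + (d - c) ≤ E.card) :
    pr E (p * T.words E fun _ => 1) = pr E p := by
  induction T generalizing c p d' with
  | ret x => rw [words, mul_one]
  | read k ih =>
    have h1 := (hT (0, 0)).le
    rw [words, Finset.mul_sum, map_sum, ← hp.pr_mul_sum_X subset_rfl (by omega), Finset.mul_sum,
      map_sum]
    refine Finset.sum_congr rfl fun e _ => ?_
    rw [← mul_assoc]
    refine ih e (hT e) (d' := d' + 1) ?_ (by omega)
    rw [mul_comm]
    exact hp.X_mul e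

/-- Removing `e` from the edge set matters only if `e` is among the at most `d - c` edges read,
which has probability at most `(d - c) / R.card`. In the induction, reading `e` first costs `1 /
R.card`; the other at most `R.card - 1` first edges each contribute an error `(d - c - 1) / (R.card
- 1)` with weight `1 / R.card`. -/
theorem Leaves.pr_words_le_erase {c d : ℕ} {T : EdgeReader α} {g : α → ℕ}
    (hT : T.Leaves (fun c' _ => c' ≤ d) c) (hg : ∀ x, g x ≤ 1) (R : Finset (ℕ × ℕ)) {e : ℕ × ℕ}
    (he : e ∈ R) :
    pr R (T.words E fun x => (g x : Words)) ≤
      pr (R.erase e) (T.words E fun x => (g x : Words)) + (d - c : ℕ) / (R.card : ℝ) := by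
  classical
  induction T generalizing c R with
  | ret x =>
    rw [words, pr_natCast, pr_natCast]
    exact le_add_of_nonneg_right (by positivity)
  | read k ih =>
    have hc := (hT (0, 0)).le
    set w : ℕ × ℕ → Words := fun f => (k f).words E fun x => (g x : Words) with hw
    have hw1 : ∀ f, w f ≤ 1 := fun f => words_le _ fun x => by exact_mod_cast natCast_le (hg x)
    have hr : 0 < R.card := Finset.card_pos.2 ⟨e, he⟩
    have hsum : ∀ R' : Finset (ℕ × ℕ), pr R' ((read k).words E fun x => (g x : Words)) =
        ∑ f ∈ E.filter (· ∈ R'), (R'.card : ℝ)⁻¹ * pr (R'.erase f) (w f) := fun R' => by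
      rw [words, map_sum, Finset.sum_filter]
      exact Finset.sum_congr rfl fun f _ => pr_X_mul _ _ _
    have hfil : E.filter (· ∈ R.erase e) = (E.filter (· ∈ R)).erase e := by
      ext f; simp; tauto
    have hle : ∀ f, pr (R.erase f) (w f) ≤ 1 := fun f => (hw1 f _).trans_eq (pr_one _)
    set S := (E.filter (· ∈ R)).erase e with hS
    have hSc : S.card + 1 ≤ R.card := by
      have : S ⊆ R.erase e := fun x hx => by simp [hS] at hx; simp; tauto
      have := Finset.card_le_card this
      rw [Finset.card_erase_of_mem he] at this
      omega
    have h1 : ∑ f ∈ E.filter (· ∈ R), (R.card : ℝ)⁻¹ * pr (R.erase f) (w f) ≤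
        (R.card : ℝ)⁻¹ + ∑ f ∈ S, (R.card : ℝ)⁻¹ * pr (R.erase f) (w f) := by
      by_cases heE : e ∈ E.filter (· ∈ R)
      · rw [← Finset.add_sum_erase _ _ heE]
        gcongr
        exact mul_le_of_le_one_right (by positivity) (hle e)
      · rw [hS, Finset.erase_eq_of_notMem heE]
        exact le_add_of_nonneg_left (by positivity)
    rw [hsum R, hsum (R.erase e), hfil]
    refine h1.trans ?_
    rcases S.eq_empty_or_nonempty with h0 | ⟨f0, hf0⟩
    · rw [h0, Finset.sum_empty, Finset.sum_empty, add_zero, zero_add, ← one_div]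
      gcongr
      exact_mod_cast (by omega : 1 ≤ d - c)
    · have hr2 : 2 ≤ R.card := by
        have := Finset.card_pos.2 ⟨f0, hf0⟩
        omega
      have hce : ((R.erase e).card : ℝ) = R.card - 1 := by
        rw [Finset.card_erase_of_mem he, Nat.cast_sub hr]; simp
      have hr3 : (0 : ℝ) < (R.card : ℝ) - 1 := by
        rw [sub_pos]; exact_mod_cast (by omega : 1 < R.card)
      have h2 : ∀ f ∈ S, pr (R.erase f) (w f) ≤ pr ((R.erase e).erase f) (w f) +
          (d - (c + 1) : ℕ) / ((R.card : ℝ) - 1) := fun f hf => by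
        have hf' : f ∈ R ∧ f ≠ e := by simp [hS] at hf; tauto
        have := ih f (hT f) (R.erase f) (Finset.mem_erase.2 ⟨hf'.2.symm, he⟩)
        rw [Finset.erase_right_comm, Finset.card_erase_of_mem hf'.1, Nat.cast_sub hr,
          Nat.cast_one] at this
        exact this
      have hdc : ((d - c : ℕ) : ℝ) = (d - (c + 1) : ℕ) + 1 := by
        exact_mod_cast (by omega : d - c = d - (c + 1) + 1)
      have hSc' : (S.card : ℝ) ≤ (R.card : ℝ) - 1 := by
        rw [le_sub_iff_add_le]; exact_mod_cast hSc
      have hD : (0 : ℝ) ≤ (d - (c + 1) : ℕ) := by positivity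
      set D : ℝ := ((d - (c + 1) : ℕ) : ℝ)
      calc (R.card : ℝ)⁻¹ + ∑ f ∈ S, (R.card : ℝ)⁻¹ * pr (R.erase f) (w f)
          ≤ (R.card : ℝ)⁻¹ + ∑ f ∈ S, (R.card : ℝ)⁻¹ * (pr ((R.erase e).erase f) (w f) +
            D / ((R.card : ℝ) - 1)) := by
            gcongr with f hf
            exact h2 f hf
        _ = (R.card : ℝ)⁻¹ + (∑ f ∈ S, (R.card : ℝ)⁻¹ * pr ((R.erase e).erase f) (w f)) +
            S.card * ((R.card : ℝ)⁻¹ * (D / ((R.card : ℝ) - 1))) := by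
            simp only [mul_add, Finset.sum_add_distrib, Finset.sum_const, nsmul_eq_mul]
            ring
        _ ≤ (R.card : ℝ)⁻¹ + (∑ f ∈ S, ((R.erase e).card : ℝ)⁻¹ *
              pr ((R.erase e).erase f) (w f)) +
            ((R.card : ℝ) - 1) * ((R.card : ℝ)⁻¹ * (D / ((R.card : ℝ) - 1))) := by
            rw [hce]
            gcongr with f hf
            · exact pr_nonneg _ _
            · linarith
        _ = _ := by
            rw [hdc]
            field_simp
            ring

/-! ### Averaging over the orders of the edges. -/

/-- The orders of a set of edges. -/
noncomputable def _root_.edgeOrders (R : Finset (ℕ × ℕ)) : Finset (List (ℕ × ℕ)) :=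
  ⟨Multiset.lists R.val, Multiset.lists_nodup_finset R⟩

theorem _root_.mem_edgeOrders {R : Finset (ℕ × ℕ)} {l : List (ℕ × ℕ)} :
    l ∈ edgeOrders R ↔ R.val = l := Multiset.mem_lists_iff _ _

theorem _root_.edgeOrders_empty : edgeOrders ∅ = {[]} := by
  ext l
  rw [mem_edgeOrders]
  simp [eq_comm]

theorem _root_.sum_edgeOrders {R : Finset (ℕ × ℕ)} (hR : R.Nonempty) (F : List (ℕ × ℕ) → ℝ) :
    ∑ l ∈ edgeOrders R, F l = ∑ e ∈ R, ∑ l ∈ edgeOrders (R.erase e), F (e :: l) := by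
  classical
  have : edgeOrders R = R.biUnion fun e => (edgeOrders (R.erase e)).image (e :: ·) := by
    ext l
    simp only [Finset.mem_biUnion, Finset.mem_image, mem_edgeOrders, Finset.erase_val]
    constructor
    · intro h
      cases l with
      | nil => exact absurd h (by simpa using hR.ne_empty)
      | cons e l =>
        have he : e ∈ R := by rw [← Finset.mem_val, h]; simp
        exact ⟨e, he, l, by rw [h]; simp, rfl⟩
    · rintro ⟨e, he, l, h, rfl⟩
      rw [← Multiset.cons_coe, ← h, Multiset.cons_erase he]
  rw [this, Finset.sum_biUnion]
  · refine Finset.sum_congr rfl fun e _ => ?_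
    rw [Finset.sum_image]
    intro a _ b _ h
    exact (List.cons.inj h).2
  · intro e _ f _ hef
    refine Finset.disjoint_left.2 fun l h h' => ?_
    obtain ⟨a, _, rfl⟩ := Finset.mem_image.1 h
    obtain ⟨b, _, h2⟩ := Finset.mem_image.1 h'
    exact hef (List.cons.inj h2).1.symm

theorem _root_.card_edgeOrders (R : Finset (ℕ × ℕ)) : (edgeOrders R).card = R.card.factorial := by
  obtain ⟨s, hs⟩ := R
  induction s using Quot.inductionOn with
  | h l => exact (List.length_permutations l)

/-- The value of a procedure, averaged over the orders of the edges. -/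
theorem sum_edgeOrders_run (T : EdgeReader α) (g : α → ℕ) {R : Finset (ℕ × ℕ)} (hR : R ⊆ E) :
    ∑ l ∈ edgeOrders R, ((T.run l).elim 0 fun x => g x.1 : ℝ) =
      R.card.factorial * pr R (T.words E fun x => (g x : Words)) := by
  induction T generalizing R with
  | ret x => simp [run, words, pr_natCast, card_edgeOrders]
  | read k ih =>
    rcases R.eq_empty_or_nonempty with rfl | hne
    · rw [edgeOrders_empty, words, map_sum]
      simp [run, pr_X_mul]
    · have hr : 0 < R.card := hne.card_pos
      rw [sum_edgeOrders hne, words, map_sum]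
      simp only [pr_X_mul]
      rw [← Finset.sum_filter, Finset.filter_mem_eq_inter, Finset.inter_eq_right.2 hR,
        Finset.mul_sum]
      refine Finset.sum_congr rfl fun e he => ?_
      have := ih e ((Finset.erase_subset e R).trans hR)
      simp only [run]
      rw [this, Finset.card_erase_of_mem he, ← Nat.mul_factorial_pred hr.ne']
      push_cast
      field_simp

end EdgeReader

open Words EdgeReader

/-! ### The recursive test of a vertex and its words. -/

/-- The endpoint of `e` that is not `v`. -/
def otherEnd (e : ℕ × ℕ) (v : ℕ) : ℕ := e.1 + e.2 - v

/-- `k` trials for the vertex `v` at stage `j`. A trial reads an edge. If the edge leads from `v` to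
some `w`, then `w` is tested by `sub`; the stage is failed if `w` survives `j` stages, or if the
tests of other vertices, where a failure at stage `i` is charged `4 ^ (i + 1)`, exceed the
budget `b`. -/
def trials (v j : ℕ) (sub : ℕ → EdgeReader ℕ) : ℕ → ℕ → EdgeReader Bool
  | 0, _ => .ret true
  | k + 1, b => .read fun e =>
    if v = e.1 ∨ v = e.2 then
      (sub (otherEnd e v)).bind fun i =>
        if i < j then
          if b < 4 ^ (i + 1) then .ret false else trials v j sub k (b - 4 ^ (i + 1))
        else .ret false
    else trials v j sub k b

/-- The test of a vertex through `j` stages; the result is the number of stages that it survives. -/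
def visit : ℕ → ℕ → EdgeReader ℕ
  | 0, _ => .ret 0
  | j + 1, v => (visit j v).bind fun i =>
    if i < j then .ret i else
      (trials v j (visit j) (4 ^ j) (4 ^ j)).bind fun b => .ret (if b then j + 1 else j)

/-- Stage `j` for the vertex `v`. -/
abbrev stage (v j : ℕ) : EdgeReader Bool := trials v j (visit j) (4 ^ j) (4 ^ j)

section Words

variable (E : Finset (ℕ × ℕ))

/-- The words with which `v` survives stage `j`. -/
noncomputable def stagePass (j v : ℕ) : Words := (stage v j).words E fun b => if b then 1 else 0

/-- The words with which `v` fails stage `j`. -/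
noncomputable def stageFail (j v : ℕ) : Words := (stage v j).words E fun b => if b then 0 else 1

/-- The words with which `v` survives the first `j` stages. -/
noncomputable def survive (j v : ℕ) : Words := ∏ i ∈ Finset.range j, stagePass E i v

/-- The words with which `v` fails one of the first `J` stages. -/
noncomputable def failBefore (J v : ℕ) : Words :=
  ∑ j ∈ Finset.range J, survive E j v * stageFail E j v

/-- The words of an edge at `v` followed by a word that depends on the other endpoint. -/
noncomputable def hits (v : ℕ) (h : ℕ → Words) : Words :=
  ∑ e ∈ E, if v = e.1 ∨ v = e.2 then X e * h (otherEnd e v) else 0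

/-- The words of an edge both of whose endpoints survive `j` stages. -/
noncomputable def edgeSurvive (j : ℕ) (e : ℕ × ℕ) : Words :=
  X e * (survive E j e.1 * survive E j e.2)

/-- The expected credit of the test of the endpoints of a random edge. -/
noncomputable def credit (J : ℕ) : Words :=
  ∑ e ∈ E, ∑ j ∈ Finset.range (J + 1), (4 ^ j : ℕ) * edgeSurvive E j e

variable {E}

theorem words_bool (T : EdgeReader Bool) (h : Bool → Words) : T.words E h =
    T.words E (fun b => if b then 1 else 0) * h true +
      T.words E (fun b => if b then 0 else 1) * h false := by
  rw [mul_comm, mul_comm _ (h false), ← words_mul, ← words_mul, ← words_add]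
  congr 1
  funext b
  cases b <;> simp

theorem survive_zero (v : ℕ) : survive E 0 v = 1 := Finset.prod_range_zero _

theorem survive_succ (j v : ℕ) : survive E (j + 1) v = survive E j v * stagePass E j v :=
  Finset.prod_range_succ _ _

theorem stagePass_le_one (j v : ℕ) : stagePass E j v ≤ 1 := words_le _ fun b => by
  split_ifs
  · exact le_rfl
  · exact Words.zero_le _

theorem stageFail_le_one (j v : ℕ) : stageFail E j v ≤ 1 := words_le _ fun b => by
  split_ifs
  · exact Words.zero_le _
  · exact le_rfl

theorem stagePass_add_stageFail_le (j v : ℕ) : stagePass E j v + stageFail E j v ≤ 1 := by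
  rw [stagePass, stageFail, ← words_add]
  exact words_le _ fun b => by cases b <;> simp

theorem survive_le_one (j v : ℕ) : survive E j v ≤ 1 :=
  prod_le_one _ _ fun _ _ => stagePass_le_one _ _

theorem survive_anti {i j : ℕ} (h : i ≤ j) (v : ℕ) : survive E j v ≤ survive E i v := by
  induction h with
  | refl => exact le_rfl
  | step _ ih => rw [survive_succ]; exact (mul_le_of_le_one (stagePass_le_one _ _)).trans ih

/-- Stages use disjoint portions of the stream, so their words multiply: the test returns `j` after
surviving all stages, and `i < j` after surviving `i` stages and failing stage `i`. -/
theorem visit_words (j v : ℕ) (g : ℕ → Words) : (visit j v).words E g =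
    survive E j v * g j + ∑ i ∈ Finset.range j, survive E i v * stageFail E i v * g i := by
  induction j generalizing g with
  | zero => simp [visit, words, survive_zero]
  | succ j ih =>
    have h : ∀ i, words E (if i < j then EdgeReader.ret i else
        (trials v j (visit j) (4 ^ j) (4 ^ j)).bind fun b => .ret (if b then j + 1 else j)) g =
        if i < j then g i else stagePass E j v * g (j + 1) + stageFail E j v * g j := fun i => by
      split_ifs
      · rfl
      · rw [words_bind, words_bool]
        rfl
    rw [visit, words_bind]
    simp only [h]
    rw [ih, if_neg (lt_irrefl j), Finset.sum_range_succ, survive_succ,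
      Finset.sum_congr rfl fun i hi => by rw [if_pos (Finset.mem_range.1 hi)]]
    ring

theorem survive_eq_words (j v : ℕ) :
    survive E j v = (visit j v).words E fun i => if i < j then 0 else 1 := by
  rw [visit_words, if_neg (lt_irrefl j), mul_one, Finset.sum_eq_zero, add_zero]
  exact fun i hi => by rw [if_pos (Finset.mem_range.1 hi), mul_zero]

theorem survive_add_failBefore (j v : ℕ) :
    survive E j v + failBefore E j v = (visit j v).words E fun _ => 1 := by
  simp [visit_words, failBefore]

theorem failBefore_eq_words (j v : ℕ) :
    failBefore E j v = (visit j v).words E fun i => if i < j then 1 else 0 := by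
  rw [visit_words, if_neg (lt_irrefl j), mul_zero, zero_add]
  exact Finset.sum_congr rfl fun i hi => by rw [if_pos (Finset.mem_range.1 hi), mul_one]

theorem hits_add (v : ℕ) (h h' : ℕ → Words) :
    hits E v (fun w => h w + h' w) = hits E v h + hits E v h' := by
  rw [hits, hits, hits, ← Finset.sum_add_distrib]
  exact Finset.sum_congr rfl fun e _ => by split_ifs <;> simp [mul_add]

theorem hits_mul (v : ℕ) (p : Words) (h : ℕ → Words) :
    hits E v (fun w => p * h w) = p * hits E v h := by
  rw [hits, hits, Finset.mul_sum]
  exact Finset.sum_congr rfl fun e _ => by split_ifs <;> simp [mul_left_comm]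

/-! ### Upper bound for the credit by a vertex cover. -/

/-- The events "the first success occurs at trial `i`", with weights `F ^ i * S`, are disjoint and
so have total weight at most `1`. For `i < K` each of these weights is at least `F ^ K * S`. -/
theorem natCast_mul_pow_mul_le_one {F S : Words} (h : F + S ≤ 1) (K : ℕ) :
    (K : Words) * (F ^ K * S) ≤ 1 := by
  have hF : F ≤ 1 := le_trans (by simpa using add_le_add_right (Words.zero_le S) F) h
  have h1 : ∀ k : ℕ, ∑ i ∈ Finset.range k, F ^ i * S + F ^ k ≤ 1 := fun k => by
    induction k with
    | zero => simp
    | succ k ih =>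
      calc ∑ i ∈ Finset.range (k + 1), F ^ i * S + F ^ (k + 1)
          = ∑ i ∈ Finset.range k, F ^ i * S + F ^ k * (F + S) := by
            rw [Finset.sum_range_succ]; ring
        _ ≤ ∑ i ∈ Finset.range k, F ^ i * S + F ^ k :=
            add_le_add_right (mul_le_of_le_one h) _
        _ ≤ 1 := ih
  have h2 : ∑ i ∈ Finset.range K, F ^ K * S ≤ ∑ i ∈ Finset.range K, F ^ i * S := by
    refine Finset.sum_le_sum fun i hi => ?_
    obtain ⟨d, hd⟩ := Nat.exists_eq_add_of_le (Finset.mem_range.1 hi).le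
    calc F ^ K * S = (F ^ i * S) * F ^ d := by rw [hd]; ring
      _ ≤ F ^ i * S := mul_le_of_le_one (by
        have := prod_le_one (Finset.range d) (fun _ => F) fun _ _ => hF
        simpa using this)
  rw [Finset.sum_const, Finset.card_range, nsmul_eq_mul] at h2
  refine h2.trans (le_trans ?_ (h1 K))
  simpa using add_le_add_right (Words.zero_le (F ^ K)) _

/-- A vertex that survives `4 ^ j` trials is unlikely to see a further trial that is fatal. -/
theorem survive_succ_mul_hits_le (j v : ℕ) :
    (4 ^ j : ℕ) * (survive E (j + 1) v * hits E v (survive E j)) ≤ 1 := by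
  -- `F` collects the trials that are not fatal: the edge misses `v`, or its other endpoint fails
  -- one of the `j` stages. Dropping the budget condition only enlarges the passing words, hence the
  -- bound `F ^ k` for every budget.
  set F : Words := ∑ e ∈ E, X e * if v = e.1 ∨ v = e.2 then
    (visit j (otherEnd e v)).words E (fun i => if i < j then 1 else 0) else 1 with hF
  have h1 : ∀ k b, (trials v j (visit j) k b).words E (fun b => if b then 1 else 0) ≤ F ^ k := by
    intro k
    induction k with
    | zero => intro b; simp [trials, words]
    | succ k ih =>
      intro b
      rw [pow_succ', hF, Finset.sum_mul, ← hF]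
      refine Finset.sum_le_sum fun e _ => ?_
      rw [mul_assoc]
      refine mul_le_mul_right ?_ _
      beta_reduce
      split_ifs
      · rw [words_bind, mul_comm, ← words_mul]
        refine words_mono _ fun i => ?_
        split_ifs
        · exact Words.zero_le _
        · rw [mul_one]; exact ih _
        · exact Words.zero_le _
      · rw [one_mul]; exact ih b
  have h2 : F + hits E v (survive E j) ≤ 1 := by
    rw [hF, hits, ← Finset.sum_add_distrib]
    refine le_trans (Finset.sum_le_sum fun e _ => ?_) (sum_X_le_one E)
    split_ifs
    · rw [← mul_add, survive_eq_words, ← words_add]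
      exact mul_le_of_le_one (words_le _ fun i => by split_ifs <;> simp)
    · simp
  refine le_trans ?_ (natCast_mul_pow_mul_le_one h2 (4 ^ j))
  refine mul_le_mul_right (mul_le_mul_left ?_ _) _
  rw [survive_succ, mul_comm]
  exact (mul_le_of_le_one (survive_le_one _ _)).trans (h1 _ _)

theorem survive_mul_survive_otherEnd {e : ℕ × ℕ} {v : ℕ} (h : v = e.1 ∨ v = e.2) (j : ℕ) :
    survive E j v * survive E j (otherEnd e v) = survive E j e.1 * survive E j e.2 := by
  rcases h with rfl | rfl
  · rw [otherEnd, Nat.add_sub_cancel_left]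
  · rw [otherEnd, Nat.add_sub_cancel, mul_comm]

/-- Upper bound in terms of a vertex cover. -/
theorem sum_edgeSurvive_succ_le (V : Finset ℕ) (hV : ∀ e ∈ E, e.1 ∈ V ∨ e.2 ∈ V) (j : ℕ) :
    (4 ^ j : ℕ) * ∑ e ∈ E, edgeSurvive E (j + 1) e ≤ (V.card : Words) := by
  -- Assign each edge to an endpoint `v` in the cover. Level `j + 1` is kept at `v` and weakened to
  -- `j` at the other end, which gives the form required by `survive_succ_mul_hits_le`.
  have h1 : ∑ e ∈ E, edgeSurvive E (j + 1) e ≤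
      ∑ v ∈ V, survive E (j + 1) v * hits E v (survive E j) := by
    have : ∀ v ∈ V, (∑ e ∈ E, if v = e.1 ∨ v = e.2 then edgeSurvive E (j + 1) e else 0) ≤
        survive E (j + 1) v * hits E v (survive E j) := fun v _ => by
      rw [← hits_mul]
      refine Finset.sum_le_sum fun e _ => ?_
      split_ifs with h
      · rw [edgeSurvive, ← survive_mul_survive_otherEnd h]
        exact mul_le_mul_right (mul_le_mul_right (survive_anti (Nat.le_succ j) _) _) _
      · exact le_rfl
    refine le_trans ?_ (Finset.sum_le_sum this)
    rw [Finset.sum_comm]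
    refine Finset.sum_le_sum fun e he => ?_
    have key : ∀ v ∈ V, v = e.1 ∨ v = e.2 → edgeSurvive E (j + 1) e ≤
        ∑ v ∈ V, if v = e.1 ∨ v = e.2 then edgeSurvive E (j + 1) e else 0 := fun v hv h => by
      rw [← Finset.add_sum_erase _ _ hv, if_pos h]
      simpa using add_le_add_right (Words.zero_le (∑ v ∈ V.erase v,
        if v = e.1 ∨ v = e.2 then edgeSurvive E (j + 1) e else 0)) (edgeSurvive E (j + 1) e)
    rcases hV e he with h | h
    · exact key _ h (Or.inl rfl)
    · exact key _ h (Or.inr rfl)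
  refine (mul_le_mul_right h1 _).trans ?_
  rw [Finset.mul_sum]
  refine (Finset.sum_le_sum fun v _ => survive_succ_mul_hits_le j v).trans_eq ?_
  simp

/-- Level `0` contributes at most `1`; each of the `J` further levels contributes at most `4 *
V.card`, the factor `4` coming from the shift between `4 ^ (j + 1)` and `4 ^ j`. -/
theorem credit_le (V : Finset ℕ) (hV : ∀ e ∈ E, e.1 ∈ V ∨ e.2 ∈ V) (J : ℕ) :
    credit E J ≤ ((1 + 4 * J * V.card : ℕ) : Words) := by
  rw [credit, Finset.sum_comm, Finset.sum_range_succ', Nat.cast_add, add_comm]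
  refine add_le_add ?_ ?_
  · refine le_trans (Finset.sum_le_sum fun e _ => ?_) ((sum_X_le_one E).trans_eq (by simp))
    simp [edgeSurvive, survive_zero]
  · refine le_trans (Finset.sum_le_sum (g := fun _ => ((4 * V.card : ℕ) : Words)) fun j _ => ?_) ?_
    · rw [← Finset.mul_sum, pow_succ', Nat.cast_mul, mul_assoc, Nat.cast_mul]
      exact natCast_mul_le _ (sum_edgeSurvive_succ_le V hV j)
    · rw [Finset.sum_const, Finset.card_range, nsmul_eq_mul, ← Nat.cast_mul]
      exact natCast_le (by ring_nf; exact le_rfl)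

/-! ### Charging failures to the credit. -/

/-- Markov's inequality with the spent budget `B - b` as potential. Each trial adds in expectation
at most `B` times the chance of a fatal neighbour plus the charge for a failed one. When the stage
fails, the potential including these additions is at least `B`. -/
theorem trials_fail_le (v j B k b : ℕ) (hb : b ≤ B) :
    (B : Words) * (trials v j (visit j) k b).words E (fun b => if b then 0 else 1) ≤
      ((B - b : ℕ) : Words) + k * (B * hits E v (survive E j) +
        hits E v fun w => (visit j w).words E fun i => ((if i < j then 4 ^ (i + 1) else 0 : ℕ) :
          Words)) := by
  set C := B * hits E v (survive E j) +
        hits E v fun w => (visit j w).words E fun i => ((if i < j then 4 ^ (i + 1) else 0 : ℕ) :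
          Words) with hC
  induction k generalizing b with
  | zero => simp [trials, words, Words.zero_le]
  | succ k ih =>
    set A : Words := ((B - b : ℕ) : Words) + k * C with hA
    have h1 : ((B - b : ℕ) : Words) + (k + 1 : ℕ) * C = A + C := by
      rw [hA]; push_cast; ring
    have h2 : A * ∑ e ∈ E, X e + C ≤ A + C := add_le_add_left (mul_le_of_le_one (sum_X_le_one E)) _
    rw [h1]
    refine le_trans ?_ h2
    rw [trials, words, Finset.mul_sum, Finset.mul_sum, hC, ← hits_mul, ← hits_add, hits,
      ← Finset.sum_add_distrib]
    refine Finset.sum_le_sum fun e _ => ?_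
    rw [mul_left_comm, mul_comm A]
    split_ifs
    · rw [← mul_add]
      refine mul_le_mul_right ?_ _
      rw [words_bind, ← words_mul, survive_eq_words, ← words_mul, ← words_add]
      refine le_trans (words_mono _ (h := fun i => A + (B * (if i < j then 0 else 1) +
        ((if i < j then 4 ^ (i + 1) else 0 : ℕ) : Words))) fun i => ?_) ?_
      · split_ifs with hi hb'
        · simp only [words, if_false, Bool.false_eq_true]
          rw [hA, add_right_comm]
          refine le_trans ?_ (add_le_add_right (Words.zero_le _) _)
          rw [mul_zero, zero_add, add_zero, mul_one, ← Nat.cast_add]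
          generalize 4 ^ (i + 1) = q at *
          exact natCast_le (by omega)
        · generalize 4 ^ (i + 1) = q at *
          refine (ih _ (by omega)).trans ?_
          rw [hA, add_right_comm, mul_zero, zero_add, ← Nat.cast_add]
          exact add_le_add_left (natCast_le (by omega)) _
        · simp only [words, if_false, Bool.false_eq_true]
          simpa using add_le_add_left (Words.zero_le A) (B : Words)
      · rw [words_add]
        exact add_le_add_left (words_const_le _ _) _
    · rw [add_zero]
      exact mul_le_mul_right (ih b hb) _

/-- Since the budget and the number of trials are both `4 ^ j`, the factor `B` of `trials_fail_le`
cancels. The product with `survive E j v` then turns the survival of a neighbour into survival at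
both ends of an edge, which is what `credit` measures. -/
theorem survive_mul_stageFail_le (j v : ℕ) :
    survive E j v * stageFail E j v ≤ ∑ e ∈ E, if v = e.1 ∨ v = e.2 then
      (4 ^ j : ℕ) * edgeSurvive E j e +
        ∑ i ∈ Finset.range j, (4 ^ (i + 1) : ℕ) * edgeSurvive E i e else 0 := by
  have h1 := trials_fail_le (E := E) v j (4 ^ j) (4 ^ j) (4 ^ j) le_rfl
  rw [Nat.sub_self, Nat.cast_zero, zero_add] at h1
  have h2 := le_of_natCast_mul_le (by positivity) h1
  refine (mul_le_mul_right h2 _).trans ?_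
  rw [← hits_mul, ← hits_add, ← hits_mul]
  refine Finset.sum_le_sum fun e _ => ?_
  beta_reduce
  split_ifs with h
  · rw [visit_words, if_neg (lt_irrefl j), Nat.cast_zero, mul_zero, zero_add, mul_add, mul_add]
    refine add_le_add (le_of_eq ?_) ?_
    · rw [edgeSurvive, ← survive_mul_survive_otherEnd h]; ring
    · rw [Finset.mul_sum, Finset.mul_sum]
      refine Finset.sum_le_sum fun i hi => ?_
      have hi := Finset.mem_range.1 hi
      rw [if_pos hi, edgeSurvive, ← survive_mul_survive_otherEnd h]
      calc _ = (4 ^ (i + 1) : ℕ) * X e * survive E i (otherEnd e v) * (survive E j v) *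
            stageFail E i (otherEnd e v) := by ring
        _ ≤ (4 ^ (i + 1) : ℕ) * X e * survive E i (otherEnd e v) * (survive E j v) :=
            mul_le_of_le_one (stageFail_le_one _ _)
        _ ≤ (4 ^ (i + 1) : ℕ) * X e * survive E i (otherEnd e v) * (survive E i v) :=
            mul_le_mul_right (survive_anti hi.le _) _
        _ = _ := by ring
  · exact le_rfl

/-- Failures are paid for by the expected credit. -/
theorem sum_failBefore_le (V : Finset ℕ) (J : ℕ) :
    ∑ v ∈ V, failBefore E J v ≤ ((2 * (4 * J + 1) : ℕ) : Words) * credit E J := by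
  set D : ℕ × ℕ → Words := fun e => ∑ j ∈ Finset.range J, ((4 ^ j : ℕ) * edgeSurvive E j e +
        ∑ i ∈ Finset.range j, (4 ^ (i + 1) : ℕ) * edgeSurvive E i e) with hD
  have h1 : ∀ v, failBefore E J v ≤ ∑ e ∈ E, if v = e.1 ∨ v = e.2 then D e else 0 := fun v => by
    refine (Finset.sum_le_sum fun j _ => survive_mul_stageFail_le j v).trans_eq ?_
    rw [Finset.sum_comm]
    refine Finset.sum_congr rfl fun e _ => ?_
    split_ifs
    · rfl
    · simp
  refine (Finset.sum_le_sum fun v _ => h1 v).trans ?_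
  rw [Finset.sum_comm, credit, Finset.mul_sum]
  refine Finset.sum_le_sum fun e _ => ?_
  -- An edge is charged by at most its two endpoints: the factor `2` of the bound. The factor `4 * J
  -- + 1` combines the direct charges with the nested sums of `4 ^ (i + 1)` over at most `J` stages.
  have h2 : (∑ v ∈ V, if v = e.1 ∨ v = e.2 then D e else 0) ≤ (2 : ℕ) * D e := by
    rw [← Finset.sum_filter, Finset.sum_const, nsmul_eq_mul, mul_comm, mul_comm _ (D e)]
    refine mul_le_mul_right (natCast_le ?_) _
    refine (Finset.card_le_card (t := {e.1, e.2}) fun x hx => ?_).trans Finset.card_le_two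
    simpa using (Finset.mem_filter.1 hx).2
  refine h2.trans ?_
  rw [Nat.cast_mul, mul_assoc]
  refine natCast_mul_le _ ?_
  have hmono : ∀ j ≤ J, ∑ i ∈ Finset.range j, (4 ^ i : ℕ) * edgeSurvive E i e ≤
      ∑ i ∈ Finset.range (J + 1), (4 ^ i : ℕ) * edgeSurvive E i e := fun j hj => by
    obtain ⟨d, hd⟩ := Nat.exists_eq_add_of_le (Nat.le_succ_of_le hj)
    rw [show J + 1 = j + d from hd, Finset.sum_range_add]
    have : (0 : Words) ≤ ∑ x ∈ Finset.range d, (4 ^ (j + x) : ℕ) * edgeSurvive E (j + x) e :=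
      Words.zero_le _
    simpa using add_le_add_right this (∑ i ∈ Finset.range j, (4 ^ i : ℕ) * edgeSurvive E i e)
  rw [hD]
  simp only [Finset.sum_add_distrib]
  rw [Nat.cast_add, add_mul, add_comm, Nat.cast_one, one_mul]
  refine add_le_add ?_ (hmono J le_rfl)
  calc ∑ j ∈ Finset.range J, ∑ i ∈ Finset.range j, ((4 ^ (i + 1) : ℕ) : Words) * edgeSurvive E i e
      = ∑ j ∈ Finset.range J, (4 : ℕ) *
          ∑ i ∈ Finset.range j, ((4 ^ i : ℕ) : Words) * edgeSurvive E i e := by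
        refine Finset.sum_congr rfl fun j _ => ?_
        rw [Finset.mul_sum]
        refine Finset.sum_congr rfl fun i _ => ?_
        rw [pow_succ', Nat.cast_mul, mul_assoc]
    _ ≤ ∑ j ∈ Finset.range J, (4 : ℕ) *
          ∑ i ∈ Finset.range (J + 1), ((4 ^ i : ℕ) : Words) * edgeSurvive E i e :=
        Finset.sum_le_sum fun j hj => natCast_mul_le _ (hmono j (Finset.mem_range.1 hj).le)
    _ = _ := by
        rw [Finset.sum_const, Finset.card_range, nsmul_eq_mul]
        push_cast
        ring

end Words

/-! ### Tests of edges, repeated until enough credit is collected. -/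

/-- The test of both endpoints of an edge through at most `r` stages, starting with stage `j`. The
result is the credit: `4 ^ i` for each level `i` that is reached, in addition to `z`. -/
def levels (u v : ℕ) : ℕ → ℕ → ℕ → EdgeReader ℕ
  | 0, j, z => .ret (z + 4 ^ j)
  | r + 1, j, z => (stage u j).bind fun a =>
    if a then (stage v j).bind fun b =>
      if b then levels u v r (j + 1) (z + 4 ^ j) else .ret (z + 4 ^ j)
    else .ret (z + 4 ^ j)

/-- The test of the next edge of the stream. -/
def edgeTest (J : ℕ) : EdgeReader ℕ := .read fun e => levels e.1 e.2 J 0 0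

/-- Test edges until the total credit is at least `H`; the result is the number of tests. -/
def countTests (J H : ℕ) : ℕ → ℕ → ℕ → EdgeReader ℕ
  | 0, _, N => .ret N
  | f + 1, s, N => if H ≤ s then .ret N else
    (edgeTest J).bind fun z => countTests J H f (s + z) (N + 1)

/-- Test at most `i` edges, and stop when the total credit is at least `H`; the result is the total
credit. -/
def creditAfter (J H : ℕ) : ℕ → ℕ → EdgeReader ℕ
  | 0, s => .ret s
  | i + 1, s => if H ≤ s then .ret s else
    (edgeTest J).bind fun z => creditAfter J H i (s + z)

/-! ### The number of edges that are read -/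

/-- Each trial reads one edge itself, and the reads of an affordable failed test are paid from the
budget. Only the test that ends the stage may be unpaid; it costs at most `4 ^ j`. -/
theorem trials_leaves {v j : ℕ} {sub : ℕ → EdgeReader ℕ}
    (hsub : ∀ w c, (sub w).Leaves (fun c' i => c' ≤ c + 4 ^ (min (i + 1) j)) c) (k b c : ℕ) :
    (trials v j sub k b).Leaves (fun c' _ => c' ≤ c + (k + b + 4 ^ j)) c := by
  induction k generalizing b c with
  | zero => exact Nat.le_add_right _ _
  | succ k ih =>
    intro e
    beta_reduce
    split_ifs
    · refine (hsub _ (c + 1)).bind fun c' i hc => ?_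
      split_ifs with hi hb
      · rw [min_eq_left hi] at hc
        have := Nat.pow_le_pow_right (n := 4) (by norm_num) hi
        show c' ≤ _
        rw [Nat.succ_eq_add_one] at this
        omega
      · rw [min_eq_left hi] at hc
        exact (ih (b - 4 ^ (i + 1)) c').imp fun c'' _ h => by
          generalize 4 ^ (i + 1) = q at *
          omega
      · rw [min_eq_right (by omega)] at hc
        show c' ≤ _
        omega
    · exact (ih b (c + 1)).imp fun c' _ h => by omega

/-- A test that fails stage `i` reads at most `4 ^ (i + 1)` edges, exactly the charge in `trials`.
The recursion closes because `4 ^ j` reads for the earlier stages and `3 * 4 ^ j` for stage `j` add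
up to `4 ^ (j + 1)`. -/
theorem visit_leaves (j v c : ℕ) :
    (visit j v).Leaves (fun c' i => c' ≤ c + 4 ^ (min (i + 1) j)) c := by
  induction j generalizing v c with
  | zero => show c ≤ _; simp
  | succ j ih =>
    refine (ih v c).bind fun c' i hc => ?_
    split_ifs with hi
    · show c' ≤ _
      rwa [min_eq_left (by omega), ← min_eq_left (show i + 1 ≤ j by omega)]
    · rw [min_eq_right (by omega)] at hc
      refine (trials_leaves (fun w c => ih w c) _ _ c').bind fun c'' b h => ?_
      show c'' ≤ _
      have : min ((if b then j + 1 else j) + 1) (j + 1) = j + 1 := by split_ifs <;> omega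
      rw [this, pow_succ]
      omega

theorem visit_leaves_le (j v c : ℕ) : (visit j v).Leaves (fun c' _ => c' ≤ c + 4 ^ j) c :=
  (visit_leaves j v c).imp fun _ _ h => h.trans (Nat.add_le_add_left
    (Nat.pow_le_pow_right (by norm_num) (min_le_right _ _)) _)

theorem stage_leaves (j v c : ℕ) : (stage v j).Leaves (fun c' _ => c' ≤ c + 3 * 4 ^ j) c :=
  (trials_leaves (fun w c => visit_leaves j w c) _ _ c).imp fun _ _ h => by omega

/-- The credit `4 ^ j` is granted before the two stages of level `j`, which read at most `6 * 4 ^ j`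
edges. Together with the tested edge itself this makes the reads at most seven times the credit. The
geometric sum of the levels bounds the credit. -/
theorem levels_leaves (u v r j z c c₀ : ℕ) (hc : c ≤ c₀ + 6 * z + 1) :
    (levels u v r j z).Leaves
      (fun c' z' => c' ≤ c₀ + 7 * z' ∧ z < z' ∧ z' + 4 ^ j ≤ z + 2 * 4 ^ (j + r)) c := by
  induction r generalizing j z c with
  | zero =>
    have : 0 < 4 ^ j := by positivity
    exact ⟨by omega, by omega, by rw [add_zero]; omega⟩
  | succ r ih =>
    have h0 : 0 < 4 ^ j := by positivity
    have h1 : 4 ^ j ≤ 4 ^ (j + (r + 1)) := Nat.pow_le_pow_right (by norm_num) (by omega)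
    refine (stage_leaves j u c).bind fun c' a h => ?_
    split_ifs
    · refine (stage_leaves j v c').bind fun c'' b h' => ?_
      split_ifs
      · refine (ih (j + 1) (z + 4 ^ j) c'' (by omega)).imp fun c3 z' h3 => ?_
        rw [pow_succ, show j + 1 + r = j + (r + 1) by omega] at h3
        exact ⟨h3.1, by omega, by omega⟩
      · exact ⟨by omega, by omega, by omega⟩
    · exact ⟨by omega, by omega, by omega⟩

theorem edgeTest_leaves (J c : ℕ) : (edgeTest J).Leaves
    (fun c' z => c' ≤ c + 7 * z ∧ 0 < z ∧ z < 2 * 4 ^ J) c := fun e =>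
  (levels_leaves e.1 e.2 J 0 0 (c + 1) c (by omega)).imp fun c' z h => by
    rw [zero_add, zero_add, pow_zero] at h
    omega

/-- The last test starts with total credit below `H` and adds less than `2 * 4 ^ J`; each unit of
credit accounts for at most seven reads. -/
theorem creditAfter_leaves (J H i s c : ℕ) (hc : c ≤ 7 * s) (hs : s ≤ H + 2 * 4 ^ J) :
    (creditAfter J H i s).Leaves (fun c' _ => c' ≤ 7 * (H + 2 * 4 ^ J)) c := by
  induction i generalizing s c with
  | zero => show c ≤ _; omega
  | succ i ih =>
    rw [creditAfter]
    split_ifs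
    · show c ≤ _; omega
    · exact (edgeTest_leaves J c).bind fun c' z h => ih _ _ (by omega) (by omega)

theorem countTests_leaves (J H f s N c : ℕ) (hc : c ≤ 7 * s) (hs : s ≤ H + 2 * 4 ^ J) :
    (countTests J H f s N).Leaves (fun c' _ => c' ≤ 7 * (H + 2 * 4 ^ J)) c := by
  induction f generalizing s c N with
  | zero => show c ≤ _; omega
  | succ i ih =>
    rw [countTests]
    split_ifs
    · show c ≤ _; omega
    · exact (edgeTest_leaves J c).bind fun c' z h => ih _ _ _ (by omega) (by omega)

theorem countTests_ge (J H f s N c : ℕ) :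
    (countTests J H f s N).Leaves (fun _ N' => N ≤ N') c := by
  induction f generalizing s N c with
  | zero => exact le_refl N
  | succ f ih =>
    rw [countTests]
    split_ifs
    · exact le_refl N
    · exact (leaves_of_forall (P := fun _ _ => True) (fun _ _ => trivial) c _).bind
        fun c' z _ => (ih (s + z) (N + 1) c').imp fun _ _ h => by omega

/-! ### The expected credit -/

section Words

variable {E : Finset (ℕ × ℕ)}

theorem natCast_ite (p : Prop) [Decidable p] : (((if p then 1 else 0 : ℕ)) : Words) =
    if p then 1 else 0 := by split_ifs <;> simp

theorem levels_words_succ (u v r j z : ℕ) (g : ℕ → Words) :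
    (levels u v (r + 1) j z).words E g = stagePass E j u * stagePass E j v *
        (levels u v r (j + 1) (z + 4 ^ j)).words E g +
      (stagePass E j u * stageFail E j v + stageFail E j u) * g (z + 4 ^ j) := by
  rw [levels, words_bind, words_bool]
  simp only [if_true, Bool.false_eq_true, if_false]
  rw [words_bind, words_bool (stage v j)]
  simp only [if_true, Bool.false_eq_true, if_false, words, stagePass, stageFail]
  ring

theorem stage_cases_le (j u v : ℕ) : stagePass E j u * stagePass E j v +
    (stagePass E j u * stageFail E j v + stageFail E j u) ≤ 1 := by
  calc _ = stagePass E j u * (stagePass E j v + stageFail E j v) + stageFail E j u := by ring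
    _ ≤ stagePass E j u + stageFail E j u :=
        add_le_add_left (mul_le_of_le_one (stagePass_add_stageFail_le j v)) _
    _ ≤ 1 := stagePass_add_stageFail_le j u

theorem levels_words_id_le (u v r j z : ℕ) :
    survive E j u * survive E j v * (levels u v r j z).words E (fun z => (z : Words)) ≤
      survive E j u * survive E j v * z + ∑ t ∈ Finset.range (r + 1),
        (4 ^ (j + t) : ℕ) * (survive E (j + t) u * survive E (j + t) v) := by
  induction r generalizing j z with
  | zero =>
    rw [levels, words, zero_add, Finset.sum_range_one, add_zero, Nat.cast_add, mul_add,
      mul_comm ((4 ^ j : ℕ) : Words)]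
  | succ r ih =>
    have h1 := ih (j + 1) (z + 4 ^ j)
    rw [levels_words_succ, Finset.sum_range_succ']
    rw [survive_succ, survive_succ] at h1
    simp only [← add_assoc j _ 1, add_right_comm j _ 1, add_zero]
    set p := survive E j u * survive E j v
    set S := ∑ t ∈ Finset.range (r + 1), ((4 ^ (j + 1 + t) : ℕ) : Words) *
      (survive E (j + 1 + t) u * survive E (j + 1 + t) v)
    set L := (levels u v r (j + 1) (z + 4 ^ j)).words E (fun z => (z : Words))
    set a := stagePass E j u
    set b := stagePass E j v
    set d := (a * stageFail E j v + stageFail E j u)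
    have h3 : a * b + d ≤ 1 := stage_cases_le j u v
    calc p * (a * b * L + d * ((z + 4 ^ j : ℕ) : Words))
        = survive E j u * a * (survive E j v * b) * L + p * d * ((z + 4 ^ j : ℕ) : Words) := by
          ring
      _ ≤ (survive E j u * a * (survive E j v * b) * ((z + 4 ^ j : ℕ) : Words) + S) +
          p * d * ((z + 4 ^ j : ℕ) : Words) := add_le_add_left h1 _
      _ = p * ((z + 4 ^ j : ℕ) : Words) * (a * b + d) + S := by ring
      _ ≤ p * ((z + 4 ^ j : ℕ) : Words) + S := add_le_add_left (mul_le_of_le_one h3) _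
      _ = p * z + (S + ((4 ^ j : ℕ) : Words) * p) := by push_cast; ring

theorem edgeTest_words_id_le (J : ℕ) :
    (edgeTest J).words E (fun z => (z : Words)) ≤ credit E J := by
  rw [edgeTest, words, credit]
  refine Finset.sum_le_sum fun e _ => ?_
  have := levels_words_id_le (E := E) e.1 e.2 J 0 0
  simp only [survive_zero, Nat.cast_zero, zero_add, mul_zero, one_mul] at this
  refine (mul_le_mul_right this _).trans_eq ?_
  rw [Finset.mul_sum]
  exact Finset.sum_congr rfl fun j _ => mul_left_comm _ _ _

/-- A lower bound for the expected credit that avoids subtraction and allows words to be lost to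
exhaustion. With `h z' = B + z - z'` it says that the expected additional credit is at least the sum
on the left; a smaller `h` only weakens this. -/
theorem levels_words_add_le (u v r j z B : ℕ) (h : ℕ → ℕ)
    (hh : ∀ z', z ≤ z' → z' + 4 ^ j ≤ z + 2 * 4 ^ (j + r) → h z' + z' ≤ B + z) :
    survive E j u * survive E j v * (levels u v r j z).words E (fun z => (h z : Words)) +
      ∑ t ∈ Finset.range (r + 1),
        (4 ^ (j + t) : ℕ) * (survive E (j + t) u * survive E (j + t) v) ≤
      survive E j u * survive E j v * B := by
  have hj : 4 ^ j ≤ 4 ^ (j + r) := Nat.pow_le_pow_right (by norm_num) (by omega)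
  have hpos : 0 < 4 ^ j := by positivity
  have h0 := hh (z + 4 ^ j) (by omega) (by omega)
  induction r generalizing j z B with
  | zero =>
    rw [levels, words, zero_add, Finset.sum_range_one, add_zero,
      mul_comm ((4 ^ j : ℕ) : Words), ← mul_add, ← Nat.cast_add]
    exact mul_le_mul_right (natCast_le (by omega)) _
  | succ r ih =>
    obtain ⟨B', rfl⟩ : ∃ B', B = B' + 4 ^ j := ⟨B - 4 ^ j, by omega⟩
    have hj' : 4 ^ (j + 1) ≤ 4 ^ (j + 1 + r) := Nat.pow_le_pow_right (by norm_num) (by omega)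
    have hh' : ∀ z', z + 4 ^ j ≤ z' → z' + 4 ^ (j + 1) ≤ z + 4 ^ j + 2 * 4 ^ (j + 1 + r) →
        h z' + z' ≤ B' + (z + 4 ^ j) := fun z' h1 h2 => by
      rw [pow_succ, show j + 1 + r = j + (r + 1) by omega] at h2
      have := hh z' (by omega) (by omega)
      omega
    have h1 := ih (j + 1) (z + 4 ^ j) B' hh' hj' (by positivity) (hh' _ (by omega) (by omega))
    rw [levels_words_succ, Finset.sum_range_succ']
    rw [survive_succ, survive_succ] at h1
    simp only [← add_assoc j _ 1, add_right_comm j _ 1, add_zero]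
    set p := survive E j u * survive E j v
    set S := ∑ t ∈ Finset.range (r + 1), ((4 ^ (j + 1 + t) : ℕ) : Words) *
      (survive E (j + 1 + t) u * survive E (j + 1 + t) v)
    set L := (levels u v r (j + 1) (z + 4 ^ j)).words E (fun z => (h z : Words))
    set a := stagePass E j u
    set b := stagePass E j v
    set d := (a * stageFail E j v + stageFail E j u)
    have h3 : a * b + d ≤ 1 := stage_cases_le j u v
    have h4 : ((h (z + 4 ^ j) : ℕ) : Words) ≤ B' := natCast_le (by omega)
    calc p * (a * b * L + d * (h (z + 4 ^ j) : ℕ)) + (S + ((4 ^ j : ℕ) : Words) * p)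
        = (survive E j u * a * (survive E j v * b) * L + S) +
          (p * d * (h (z + 4 ^ j) : ℕ) + ((4 ^ j : ℕ) : Words) * p) := by ring
      _ ≤ survive E j u * a * (survive E j v * b) * B' +
          (p * d * B' + ((4 ^ j : ℕ) : Words) * p) :=
          add_le_add h1 (add_le_add_left (mul_le_mul_right h4 _) _)
      _ = p * B' * (a * b + d) + ((4 ^ j : ℕ) : Words) * p := by ring
      _ ≤ p * B' + ((4 ^ j : ℕ) : Words) * p := add_le_add_left (mul_le_of_le_one h3) _
      _ = p * ((B' + 4 ^ j : ℕ) : Words) := by push_cast; ring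

theorem edgeTest_words_add_credit_le (J B : ℕ) (h : ℕ → ℕ)
    (hh : ∀ z ≤ 2 * 4 ^ J, h z + z ≤ B) :
    (edgeTest J).words E (fun z => (h z : Words)) + credit E J ≤ (B : Words) := by
  rw [edgeTest, words, credit, ← Finset.sum_add_distrib]
  refine le_trans (Finset.sum_le_sum (g := fun e => (B : Words) * X e) fun e _ => ?_) ?_
  · have := levels_words_add_le (E := E) e.1 e.2 J 0 0 B h fun z _ hz => by
      rw [zero_add, zero_add] at hz
      exact hh z (by omega)
    simp only [survive_zero, zero_add, one_mul] at this
    rw [mul_comm (B : Words)]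
    refine le_trans (le_of_eq ?_) (mul_le_mul_right this _)
    rw [mul_add, Finset.mul_sum]
    congr 1
    exact Finset.sum_congr rfl fun j _ => mul_left_comm _ _ _
  · rw [← Finset.mul_sum]
    exact mul_le_of_le_one (sum_X_le_one E)

/-! ### The number of tests -/

/-- Markov's inequality: stopping after at most `N₀` tests means that `N₀ - N` further tests brought
the credit from `s` to `H`. The fuel `f` never runs out too early since every test earns at least
`1`. -/
theorem countTests_words_le (J H f s N N₀ : ℕ) (hf : H ≤ s + f) (hN : N ≤ N₀) :
    (H : Words) * (countTests J H f s N).words E (fun N' => if N' ≤ N₀ then 1 else 0) ≤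
      s + (N₀ - N : ℕ) * credit E J := by
  have hbase : ∀ s : ℕ, H ≤ s → (H : Words) * (EdgeReader.ret N).words E
      (fun N' => if N' ≤ N₀ then 1 else 0) ≤ s + (N₀ - N : ℕ) * credit E J := fun s h => by
    rw [words, if_pos hN, mul_one]
    exact (natCast_le h).trans (by simpa using add_le_add_right (Words.zero_le _) (s : Words))
  induction f generalizing s N with
  | zero => exact hbase s (by omega)
  | succ f ih =>
    rw [countTests]
    split_ifs with h
    · exact hbase s h
    · rw [words_bind, ← words_mul]
      rcases Nat.lt_or_ge N N₀ with h1 | h1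
      · have h2 : ∀ c, (edgeTest J).Leaves (fun _ z => (H : Words) *
            (countTests J H f (s + z) (N + 1)).words E (fun N' => if N' ≤ N₀ then 1 else 0) ≤
            ((s : Words) + (N₀ - (N + 1) : ℕ) * credit E J) + (z : Words)) c := fun c =>
          (edgeTest_leaves J c).imp fun c' z hz => by
            refine (ih (s + z) (N + 1) (by omega) h1 fun s' hs' => ?_).trans_eq ?_
            · rw [words, if_pos (by omega), mul_one]
              exact (natCast_le hs').trans
                (by simpa using add_le_add_right (Words.zero_le _) (s' : Words))
            · push_cast; ring
        refine (words_mono_of_leaves (h2 0)).trans ?_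
        rw [words_add]
        refine (add_le_add (words_const_le _ _) (edgeTest_words_id_le J)).trans_eq ?_
        rw [show N₀ - N = N₀ - (N + 1) + 1 by omega]
        push_cast
        ring
      · refine le_trans (words_le _ (p := 0) fun z => ?_) (Words.zero_le _)
        have := words_le_of_leaves (E := E) (p := 0) (g := fun N' => if N' ≤ N₀ then 1 else 0)
          ((countTests_ge J H f (s + z) (N + 1) 0).imp fun _ N' hN' => by
            rw [if_neg (by omega)])
        simpa using mul_le_mul_right this (H : Words)

/-- More than `i` further tests are made only if the credit is still below `H` after `i` of them. -/
theorem countTests_words_gt_le (J H f s N i : ℕ) :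
    (countTests J H f s N).words E (fun N' => if N + i < N' then 1 else 0) ≤
      (creditAfter J H i s).words E fun s' => if s' < H then 1 else 0 := by
  have hle : ∀ f s N, (countTests J H f s N).words E (fun N' => if N < N' then 1 else 0) ≤
      if s < H then 1 else 0 := fun f s N => by
    split_ifs with hs
    · exact words_le _ fun N' => by split_ifs <;> simp [Words.zero_le]
    · cases f with
      | zero => simp [countTests, words]
      | succ f => rw [countTests, if_pos (by omega)]; simp [words]
  induction i generalizing f s N with
  | zero => exact hle f s N
  | succ i ih =>
    cases f with
    | zero => simp [countTests, words, Words.zero_le]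
    | succ f =>
      rw [countTests, creditAfter]
      split_ifs
      · simp [words, Words.zero_le]
      · rw [words_bind, words_bind]
        refine words_mono _ fun z => ?_
        rw [show N + (i + 1) = N + 1 + i by omega]
        exact ih _ _ _

theorem creditAfter_words_anti (J H s : ℕ) {i k : ℕ} (h : i ≤ k) :
    ((creditAfter J H k s).words E fun s' => if s' < H then 1 else 0) ≤
      (creditAfter J H i s).words E fun s' => if s' < H then 1 else 0 := by
  induction i generalizing k s with
  | zero =>
    rw [creditAfter, words]
    split_ifs with hs
    · exact words_le _ fun s' => by split_ifs <;> simp [Words.zero_le]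
    · cases k with
      | zero => simp [creditAfter, words, hs]
      | succ k => rw [creditAfter, if_pos (by omega), words, if_neg hs]
  | succ i ih =>
    obtain ⟨k, rfl⟩ : ∃ k', k = k' + 1 := ⟨k - 1, by omega⟩
    rw [creditAfter, creditAfter]
    split_ifs
    · exact le_rfl
    · rw [words_bind, words_bind]
      exact words_mono _ fun z => ih _ (by omega)

/-- Wald's identity, as an inequality: the total credit cannot exceed `H` by much. -/
theorem sum_creditAfter_mul_credit_le (J H k s : ℕ) :
    ∑ i ∈ Finset.range k,
      ((creditAfter J H i s).words E fun s' => if s' < H then 1 else 0) * credit E J ≤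
      ((if s < H then H - s + 2 * 4 ^ J else 0 : ℕ) : Words) := by
  induction k generalizing s with
  | zero => simp [Words.zero_le]
  | succ k ih =>
    split_ifs with hs
    · rw [Finset.sum_range_succ', creditAfter, words, if_pos hs, one_mul]
      have h1 : ∀ i, ((creditAfter J H (i + 1) s).words E fun s' => if s' < H then 1 else 0) *
          credit E J = (edgeTest J).words E fun z =>
            ((creditAfter J H i (s + z)).words E fun s' => if s' < H then 1 else 0) *
              credit E J := fun i => by
        rw [creditAfter, if_neg (by omega), words_bind, mul_comm, ← words_mul]
        simp only [mul_comm]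
      have h2 : ∀ k, (∑ i ∈ Finset.range k, (edgeTest J).words E fun z =>
            ((creditAfter J H i (s + z)).words E fun s' => if s' < H then 1 else 0) *
              credit E J) = (edgeTest J).words E fun z => ∑ i ∈ Finset.range k,
            ((creditAfter J H i (s + z)).words E fun s' => if s' < H then 1 else 0) *
              credit E J := fun k => by
        induction k with
        | zero => simp [words_zero]
        | succ k ih' => simp only [Finset.sum_range_succ, words_add, ih']
      simp only [h1]
      rw [h2]
      -- The induction hypothesis for the credit `s + z` after the first test is taken as `h z`. The
      -- summand `2 * 4 ^ J` covers the overshoot of the last test.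
      refine (add_le_add_left (words_mono _ fun z => ih (s + z)) _).trans ?_
      refine edgeTest_words_add_credit_le J _ _ fun z hz => ?_
      split_ifs <;> omega
    · rw [Finset.sum_eq_zero fun i _ => ?_]
      · simp
      · cases i with
        | zero => rw [creditAfter, words, if_neg hs, zero_mul]
        | succ i => rw [creditAfter, if_pos (by omega), words, if_neg hs, zero_mul]

end Words

/-! ### Credit versus matching size, and tail bounds for the number of tests. -/

/-- The endpoints of the edges of `M`. -/
def endpoints (M : Finset (ℕ × ℕ)) : Finset ℕ := M.biUnion fun e => {e.1, e.2}

theorem card_endpoints_le (M : Finset (ℕ × ℕ)) : (endpoints M).card ≤ 2 * M.card := by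
  refine Finset.card_biUnion_le.trans ?_
  rw [mul_comm]
  exact Finset.sum_le_card_nsmul _ _ _ fun e _ => Finset.card_le_two

section

variable {E M : Finset (ℕ × ℕ)}

/-- Edges of a matching lead to expected credit. -/
theorem card_matching_mul_le {α : Type} (hME : M ⊆ E) (hne : ∀ e ∈ M, e.1 ≠ e.2)
    (hM : (M : Set (ℕ × ℕ)).PairwiseDisjoint fun e => ({e.1, e.2} : Finset ℕ))
    (J h : ℕ) (T : EdgeReader α) (g : α → ℕ) (hT : T.Leaves (fun c _ => c ≤ h) 0)
    (hg : ∀ x, g x ≤ 1) (hh : 2 * (h + 2 * 4 ^ J + 1) ≤ E.card) :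
    (M.card / E.card : ℝ) * (pr E (T.words E fun x => (g x : Words)) - h / E.card) ≤
      pr E ((T.words E fun x => (g x : Words)) * credit E J) *
        ((4 ^ J)⁻¹ + 4 * (4 * J + 1) / E.card) := by
  set Q := T.words E fun x => (g x : Words) with hQ
  set m : ℝ := (E.card : ℝ) with hm
  have hm0 : 0 < m := by rw [hm]; exact_mod_cast (by omega : 0 < E.card)
  have hQs : Short h Q := hT.short g
  have hvis : ∀ v, (visit J v).Leaves (fun c' _ => c' ≤ 4 ^ J) 0 := fun v =>
    (visit_leaves_le J v 0).imp fun _ _ h => by omega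
  have hsurv : ∀ v, Short (4 ^ J) (survive E J v) := fun v => by
    rw [survive_eq_words]
    have := (hvis v).short (E := E) fun i => if i < J then 0 else 1
    simpa using this
  have hfail : ∀ v, Short (4 ^ J) (failBefore E J v) := fun v => by
    rw [failBefore_eq_words]
    have := (hvis v).short (E := E) fun i => if i < J then 1 else 0
    simpa using this
  -- By commutativity `e` may be read before `T`; this removes `e` from the edges available to `T`,
  -- which changes the value by at most `h / m`.
  have h1 : ∀ e ∈ E, 1 / m * (pr E Q - h / m) ≤ pr E (Q * X e) := fun e he => by
    have := hT.pr_words_le_erase (E := E) hg E he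
    rw [mul_comm Q, pr_X_mul, if_pos he, ← one_div]
    gcongr
    rw [Nat.sub_zero] at this
    linarith
  -- Conversely `e` may be read last. At least half of the edges are then left, so its probability
  -- is at most `2 / m`.
  have hfe : ∀ e v, pr E (Q * X e * failBefore E J v) ≤ 2 / m * pr E (Q * failBefore E J v) :=
    fun e v => by
      rw [mul_right_comm]
      refine ((hQs.mul (hfail v)).pr_mul_X_le e (by omega)).trans ?_
      refine mul_le_mul_of_nonneg_right ?_ (pr_nonneg _ _)
      have h3 : ((2 * (h + 4 ^ J) : ℕ) : ℝ) ≤ E.card := by exact_mod_cast (by omega)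
      rw [inv_le_comm₀ (by push_cast at h3 ⊢; linarith) (by positivity), inv_div]
      push_cast at h3 ⊢
      linarith
  -- Enough edges remain for both visits to return, so each endpoint either survives all `J` stages
  -- or fails one of them.
  have h2 : ∀ e ∈ E, pr E (Q * X e) ≤ pr E (Q * edgeSurvive E J e) +
      2 / m * (pr E (Q * failBefore E J e.1) + pr E (Q * failBefore E J e.2)) := fun e _ => by
    have hX : Short (h + 1) (Q * X e) := by rw [mul_comm]; exact hQs.X_mul e
    have e1 := (hvis e.1).pr_mul_words_one hX (E := E) (by omega)
    have e2 := (hvis e.2).pr_mul_words_one (hX.mul (hsurv e.1)) (E := E) (by omega)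
    rw [← survive_add_failBefore, mul_add, map_add] at e1 e2
    have e3 : pr E (Q * X e * survive E J e.1 * failBefore E J e.2) ≤
        pr E (Q * X e * failBefore E J e.2) := by
      rw [mul_right_comm]
      exact mul_le_of_le_one (survive_le_one _ _) E
    have e4 : Q * X e * survive E J e.1 * survive E J e.2 = Q * edgeSurvive E J e := by
      rw [edgeSurvive]; ring
    rw [e4] at e2
    have e5 := hfe e e.1
    have e6 := hfe e e.2
    linarith
  have h3 : ∑ e ∈ M, pr E (Q * edgeSurvive E J e) ≤ (4 ^ J)⁻¹ * pr E (Q * credit E J) := by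
    have h4 : ((4 ^ J : ℕ) : Words) * ∑ e ∈ M, Q * edgeSurvive E J e ≤ Q * credit E J := by
      rw [← Finset.mul_sum, mul_left_comm, Finset.mul_sum]
      refine mul_le_mul_right ?_ _
      rw [credit, ← Finset.sum_sdiff hME, add_comm]
      refine le_trans (Finset.sum_le_sum fun e _ => ?_)
        (by simpa using add_le_add_right (Words.zero_le _) _)
      rw [Finset.sum_range_succ]
      simpa using add_le_add_left (Words.zero_le (∑ j ∈ Finset.range J,
        ((4 ^ j : ℕ) : Words) * edgeSurvive E j e)) (((4 ^ J : ℕ) : Words) * edgeSurvive E J e)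
    have h5 := h4 E
    rw [pr_natCast_mul, map_sum] at h5
    rw [inv_mul_eq_div, le_div_iff₀ (by positivity), mul_comm]
    exact_mod_cast h5
  -- The edges of `M` are disjoint, so no failing vertex is counted twice.
  have h4 : ∑ e ∈ M, (pr E (Q * failBefore E J e.1) + pr E (Q * failBefore E J e.2)) ≤
      2 * (4 * J + 1) * pr E (Q * credit E J) := by
    have h5 := mul_le_mul_right (sum_failBefore_le (E := E) (endpoints M) J) Q E
    rw [mul_left_comm, pr_natCast_mul, endpoints, Finset.sum_biUnion hM, Finset.mul_sum,
      map_sum] at h5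
    push_cast at h5
    refine le_trans (le_of_eq (Finset.sum_congr rfl fun e he => ?_)) h5
    rw [Finset.sum_pair (hne e he), mul_add, map_add]
  calc M.card / m * (pr E Q - h / m) = ∑ e ∈ M, 1 / m * (pr E Q - h / m) := by
        rw [Finset.sum_const, nsmul_eq_mul]; ring
    _ ≤ ∑ e ∈ M, (pr E (Q * edgeSurvive E J e) +
          2 / m * (pr E (Q * failBefore E J e.1) + pr E (Q * failBefore E J e.2))) :=
        Finset.sum_le_sum fun e he => (h1 e (hME he)).trans (h2 e (hME he))
    _ = ∑ e ∈ M, pr E (Q * edgeSurvive E J e) +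
          2 / m * ∑ e ∈ M, (pr E (Q * failBefore E J e.1) + pr E (Q * failBefore E J e.2)) := by
        rw [Finset.sum_add_distrib, Finset.mul_sum]
    _ ≤ (4 ^ J)⁻¹ * pr E (Q * credit E J) +
          2 / m * (2 * (4 * J + 1) * pr E (Q * credit E J)) := by gcongr
    _ = _ := by ring

/-- It is unlikely that few tests are carried out. -/
theorem pr_countTests_le (hV : ∀ e ∈ E, e.1 ∈ endpoints M ∨ e.2 ∈ endpoints M) (J H N₀ : ℕ)
    (hN : 8 * (N₀ * (1 + 8 * J * M.card)) ≤ H) (hH : 0 < H) :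
    pr E ((countTests J H H 0 0).words E fun N => ((if N ≤ N₀ then 1 else 0 : ℕ) : Words)) ≤
      1 / 8 := by
  simp only [natCast_ite]
  have h1 := countTests_words_le (E := E) J H H 0 0 N₀ (by omega) (by omega)
  have h2 : credit E J ≤ ((1 + 8 * J * M.card : ℕ) : Words) :=
    (credit_le _ hV J).trans (natCast_le (by
      have := Nat.mul_le_mul_left (4 * J) (card_endpoints_le M)
      linarith))
  have h3 := h1.trans (add_le_add_right (mul_le_mul_right h2 _) _) E
  rw [Nat.cast_zero, zero_add, Nat.sub_zero, ← Nat.cast_mul, pr_natCast, pr_natCast_mul] at h3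
  have h4 : ((8 * (N₀ * (1 + 8 * J * M.card)) : ℕ) : ℝ) ≤ H := by exact_mod_cast hN
  have h5 : (0 : ℝ) < H := by exact_mod_cast hH
  rw [Nat.cast_mul] at h4
  rw [le_div_iff₀ (by norm_num)]
  refine le_of_mul_le_mul_left ?_ h5
  push_cast at h3 h4 ⊢
  linarith

/-- It is unlikely that many tests are carried out. -/
theorem pr_lt_countTests_le (hME : M ⊆ E) (hne : ∀ e ∈ M, e.1 ≠ e.2)
    (hM : (M : Set (ℕ × ℕ)).PairwiseDisjoint fun e => ({e.1, e.2} : Finset ℕ)) (J N₁ : ℕ)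
    (hJ : 336 * 4 ^ J ≤ E.card) (hJ' : E.card ≤ 1344 * 4 ^ J)
    (hN : 48 * 4 ^ J * (1348 + 16 * J) < N₁ * M.card) :
    pr E ((countTests J (4 ^ J) (4 ^ J) 0 0).words E
      fun N => ((if N₁ < N then 1 else 0 : ℕ) : Words)) ≤ 1 / 8 := by
  set H := 4 ^ J with hH
  set Q : ℕ → Words := fun i => (creditAfter J H i 0).words E
    fun s => if s < H then 1 else 0 with hQ
  simp only [natCast_ite]
  have h1 := countTests_words_gt_le (E := E) J H H 0 0 N₁ E
  simp only [zero_add] at h1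
  refine h1.trans ?_
  -- Otherwise each of the first `N₁` tests is made with probability above `1 / 8`, and by
  -- `card_matching_mul_le` each contributes expected credit of at least `M.card / (16 * (1348 + 16
  -- * J))`. In total this exceeds the limit `3 * 4 ^ J` from Wald's identity.
  by_contra! hlt
  have hHpos : 0 < H := by positivity
  have hH0 : (0 : ℝ) < H := by exact_mod_cast hHpos
  have hm0 : (0 : ℝ) < E.card := by exact_mod_cast (by omega : 0 < E.card)
  have hmH : (336 * H : ℝ) ≤ E.card := by exact_mod_cast hJ
  have hmH' : (E.card : ℝ) ≤ 1344 * H := by exact_mod_cast hJ'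
  have h2 : ∀ i ∈ Finset.range N₁, (M.card : ℝ) / (16 * (1348 + 16 * J)) ≤
      pr E (Q i * credit E J) := fun i hi => by
    have h3 : 1 / 8 < pr E (Q i) := hlt.trans_le
      (creditAfter_words_anti J H 0 (Finset.mem_range.1 hi).le E)
    have h4 := card_matching_mul_le hME hne hM J (7 * (H + 2 * 4 ^ J)) (creditAfter J H i 0)
      (fun s => if s < H then 1 else 0) (creditAfter_leaves J H i 0 0 (by omega) (by omega))
      (fun s => by split_ifs <;> omega) (by rw [← hH]; omega)
    simp only [natCast_ite] at h4
    -- At most `21 * 4 ^ J` edges are read, and `336 = 16 * 21`; half of the probability `1 / 8` is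
    -- left.
    have h5 : ((7 * (H + 2 * 4 ^ J) : ℕ) : ℝ) / E.card ≤ 1 / 16 := by
      rw [div_le_iff₀ hm0, ← hH]
      push_cast
      linarith
    have h6 : (M.card / E.card : ℝ) * (1 / 16) ≤
        (M.card / E.card : ℝ) * (pr E (Q i) - ((7 * (H + 2 * 4 ^ J) : ℕ) : ℝ) / E.card) := by
      gcongr
      linarith
    have h7 : ((4 ^ J : ℝ))⁻¹ + 4 * (4 * J + 1) / E.card ≤ (1348 + 16 * J) / E.card := by
      have : ((4 : ℝ) ^ J) = H := by rw [hH]; push_cast; rfl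
      rw [this, inv_eq_one_div, div_add_div _ _ hH0.ne' hm0.ne',
        div_le_div_iff₀ (by positivity) hm0]
      have := mul_le_mul_of_nonneg_right hmH' hm0.le
      nlinarith
    have h8 := h6.trans (h4.trans (mul_le_mul_of_nonneg_left h7 (pr_nonneg _ _)))
    rw [div_le_iff₀ (by positivity)]
    have h9 := mul_le_mul_of_nonneg_right h8 hm0.le
    have e1 : (M.card / E.card : ℝ) * (1 / 16) * E.card = M.card / 16 := by field_simp
    have e2 : pr E (Q i * credit E J) * ((1348 + 16 * J) / E.card) * E.card =
        pr E (Q i * credit E J) * (1348 + 16 * J) := by field_simp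
    have h10 : (M.card : ℝ) / 16 ≤ pr E (Q i * credit E J) * (1348 + 16 * J) := by
      rw [← e1, ← e2]; exact h9
    linarith
  have h3 := sum_creditAfter_mul_credit_le (E := E) J H N₁ 0 E
  rw [if_pos hHpos, pr_natCast, map_sum, ← hH] at h3
  have h4 := (Finset.sum_le_sum h2).trans h3
  rw [Finset.sum_const, Finset.card_range, nsmul_eq_mul, ← mul_div_assoc,
    div_le_iff₀ (by positivity)] at h4
  have h5 : ((48 * H * (1348 + 16 * J) : ℕ) : ℝ) < (N₁ * M.card : ℕ) := by exact_mod_cast hN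
  push_cast at h5 h4
  simp only [Nat.sub_zero] at h4
  linarith

/-! ### The estimate and its accuracy. -/

/-- The estimate of the size of a maximum matching. -/
def estimate (J N : ℕ) : ℕ := max 1 (4 ^ J / (8 * (8 * J + 1) * N))

theorem le_mul_estimate {J N m μ : ℕ} (hJ' : m ≤ 1344 * 4 ^ J) (hμ : μ ≤ m) (hN : 0 < N)
    (h : N * μ ≤ 48 * 4 ^ J * (1348 + 16 * J) + μ) :
    μ ≤ 10 ^ 7 * (J + 1) ^ 2 * estimate J N := by
  set D := 8 * (8 * J + 1) * N with hD
  have hD0 : 0 < D := by positivity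
  have h1 : 4 ^ J < (4 ^ J / D + 1) * D := by
    rw [add_mul, one_mul, mul_comm]
    exact Nat.lt_mul_div_succ _ hD0 |>.trans_eq (by ring)
  have h2 : 4 ^ J / D + 1 ≤ 2 * estimate J N := by
    rw [estimate, ← hD]
    omega
  have h3 : 4 ^ J ≤ 2 * estimate J N * D := h1.le.trans (Nat.mul_le_mul_right _ h2)
  set q := 4 ^ J
  have h4 : N * μ ≤ q * (70000 * (J + 1)) := by nlinarith
  have h5 : N * μ ≤ N * (10 ^ 7 * (J + 1) ^ 2 * estimate J N) := by
    refine h4.trans ((Nat.mul_le_mul_right _ h3).trans ?_)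
    rw [hD]
    set x := estimate J N
    have : 2 * x * (8 * (8 * J + 1) * N) * (70000 * (J + 1)) =
      N * x * (1120000 * ((8 * J + 1) * (J + 1))) := by ring
    rw [this]
    have h6 : 1120000 * ((8 * J + 1) * (J + 1)) ≤ 10 ^ 7 * (J + 1) ^ 2 := by nlinarith
    calc _ ≤ N * x * (10 ^ 7 * (J + 1) ^ 2) := Nat.mul_le_mul_left _ h6
      _ = _ := by ring
  exact Nat.le_of_mul_le_mul_left h5 hN

end

namespace StreamRAM

/-! ### Big-step semantics -/

/-- Executing `p` with memory `M` and stream `s` terminates with memory `M'` and stream `s'`; the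
memory satisfies `I` after every step, and no coins are flipped. -/
inductive Exec (I : Mem → Prop) : Prog → Mem → List (ℕ × ℕ) → Mem → List (ℕ × ℕ) → Prop
  | skip {M s} : Exec I .skip M s M s
  | set {a e M s} : I (Function.update M (a.eval M) (e.eval M)) →
      Exec I (.set a e) M s (Function.update M (a.eval M) (e.eval M)) s
  | next {u v f M x y s} :
      I (Function.update (Function.update (Function.update M u x) v y) f 1) →
      Exec I (.next u v f) M ((x, y) :: s)
        (Function.update (Function.update (Function.update M u x) v y) f 1) s
  | seq {p q M s M₁ s₁ M₂ s₂} : Exec I p M s M₁ s₁ → Exec I q M₁ s₁ M₂ s₂ →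
      Exec I (.seq p q) M s M₂ s₂
  | ite_true {e p q M s M' s'} : e.eval M ≠ 0 → Exec I p M s M' s' → Exec I (.ite e p q) M s M' s'
  | ite_false {e p q M s M' s'} : e.eval M = 0 → Exec I q M s M' s' → Exec I (.ite e p q) M s M' s'
  | loop_true {e p M s M₁ s₁ M₂ s₂} : e.eval M ≠ 0 → Exec I p M s M₁ s₁ →
      Exec I (.loop e p) M₁ s₁ M₂ s₂ → Exec I (.loop e p) M s M₂ s₂
  | loop_false {e p M s} : e.eval M = 0 → Exec I (.loop e p) M s M s

/-- Whatever the coins, `c'` is reached from `c` in `t` steps, and the memory satisfies `I` on the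
way. -/
def Reaches (I : Mem → Prop) (t : ℕ) (c c' : Config) : Prop :=
  ∀ coins : List Bool, (coins.length ≤ t → I (coins.foldl step c).mem) ∧
    (coins.length = t → coins.foldl step c = c')

theorem Reaches.refl {I : Mem → Prop} {c : Config} (h : I c.mem) : Reaches I 0 c c :=
  fun coins => by
  cases coins with
  | nil => exact ⟨fun _ => h, fun _ => rfl⟩
  | cons b l => simp

theorem Reaches.head {I : Mem → Prop} {t : ℕ} {c c₁ c₂ : Config} (h : I c.mem)
    (h₁ : ∀ b, step c b = c₁) (h₂ : Reaches I t c₁ c₂) : Reaches I (t + 1) c c₂ := fun coins => by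
  cases coins with
  | nil => exact ⟨fun _ => h, fun h' => by simp at h'⟩
  | cons b l =>
    simp only [List.length_cons, List.foldl_cons, h₁, add_le_add_iff_right, add_left_inj]
    exact h₂ l

theorem Reaches.trans {I : Mem → Prop} {t t' : ℕ} {c c₁ c₂ : Config} (h₁ : Reaches I t c c₁)
    (h₂ : Reaches I t' c₁ c₂) : Reaches I (t + t') c c₂ := fun coins => by
  rcases Nat.lt_or_ge t coins.length with h | h
  · rw [← List.take_append_drop t coins, List.foldl_append,
      (h₁ (coins.take t)).2 (by simp; omega)]
    have := h₂ (coins.drop t)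
    simp only [List.length_drop] at this
    simp only [List.take_append_drop]
    exact ⟨fun h' => this.1 (by omega), fun h' => this.2 (by omega)⟩
  · refine ⟨fun _ => (h₁ coins).1 h, fun h' => ?_⟩
    have h0 : t' = 0 := by omega
    subst h0
    have := (h₂ []).2 rfl
    rw [(h₁ coins).2 (by omega)]
    exact this

theorem Exec.invariant {I : Mem → Prop} {p : Prog} {M M' : Mem} {s s' : List (ℕ × ℕ)}
    (h : Exec I p M s M' s') (hM : I M) : I M' := by
  induction h with
  | skip => exact hM
  | set h => exact h
  | next h => exact h
  | seq _ _ h₁ h₂ => exact h₂ (h₁ hM)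
  | ite_true _ _ h => exact h hM
  | ite_false _ _ h => exact h hM
  | loop_true _ _ _ h₁ h₂ => exact h₂ (h₁ hM)
  | loop_false _ => exact hM

theorem Exec.reaches {I : Mem → Prop} {p : Prog} {M M' : Mem} {s s' : List (ℕ × ℕ)}
    (h : Exec I p M s M' s') (hM : I M) (k : List Prog) :
    ∃ t, Reaches I t ⟨p :: k, M, s⟩ ⟨k, M', s'⟩ := by
  induction h generalizing k with
  | skip => exact ⟨1, .head hM (fun _ => rfl) (.refl hM)⟩
  | set h => exact ⟨1, .head hM (fun _ => rfl) (.refl h)⟩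
  | next h => exact ⟨1, .head hM (fun _ => rfl) (.refl h)⟩
  | @seq p q _ _ _ _ _ _ e₁ _ h₁ h₂ =>
    obtain ⟨t₁, r₁⟩ := h₁ hM (q :: k)
    obtain ⟨t₂, r₂⟩ := h₂ (e₁.invariant hM) k
    exact ⟨_, .head hM (fun _ => rfl) (r₁.trans r₂)⟩
  | ite_true he _ h =>
    obtain ⟨t, r⟩ := h hM k
    exact ⟨_, .head hM (fun _ => by simp only [step, if_neg he]) r⟩
  | ite_false he _ h =>
    obtain ⟨t, r⟩ := h hM k
    exact ⟨_, .head hM (fun _ => by simp only [step, if_pos he]) r⟩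
  | @loop_true e p _ _ _ _ _ _ he e₁ _ h₁ h₂ =>
    obtain ⟨t₁, r₁⟩ := h₁ hM (.loop e p :: k)
    obtain ⟨t₂, r₂⟩ := h₂ (e₁.invariant hM) k
    exact ⟨_, .head hM (fun _ => by simp only [step, if_neg he]) (r₁.trans r₂)⟩
  | loop_false he => exact ⟨1, .head hM (fun _ => by simp only [step, if_pos he]) (.refl hM)⟩

/-- Executing `p` terminates, and `Q` holds afterwards. -/
def Ends (I : Mem → Prop) (p : Prog) (M : Mem) (s : List (ℕ × ℕ))
    (Q : Mem → List (ℕ × ℕ) → Prop) : Prop := ∃ M' s', Exec I p M s M' s' ∧ Q M' s'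

/-- Some iterations of a loop lead from the first to the second state. -/
inductive Iter (I : Mem → Prop) (e : Expr) (p : Prog) :
    Mem → List (ℕ × ℕ) → Mem → List (ℕ × ℕ) → Prop
  | refl {M s} : Iter I e p M s M s
  | head {M s M₁ s₁ M₂ s₂} : e.eval M ≠ 0 → Exec I p M s M₁ s₁ → Iter I e p M₁ s₁ M₂ s₂ →
      Iter I e p M s M₂ s₂

theorem Iter.trans {I : Mem → Prop} {e : Expr} {p : Prog} {M M₁ M₂ : Mem}
    {s s₁ s₂ : List (ℕ × ℕ)} (h : Iter I e p M s M₁ s₁) (h' : Iter I e p M₁ s₁ M₂ s₂) :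
    Iter I e p M s M₂ s₂ := by
  induction h with
  | refl => exact h'
  | head he hp _ ih => exact .head he hp (ih h')

theorem Iter.exec {I : Mem → Prop} {e : Expr} {p : Prog} {M M₁ : Mem} {s s₁ : List (ℕ × ℕ)}
    (h : Iter I e p M s M₁ s₁) (he : e.eval M₁ = 0) : Exec I (.loop e p) M s M₁ s₁ := by
  induction h with
  | refl => exact .loop_false he
  | head he' hp _ ih => exact .loop_true he' hp (ih he)

/-! ### Bounded memory and rules for reasoning about programs. -/

/-- The memory invariant: only the cells below `A` are in use, and they hold at most `V`. -/
def InBounds (A V : ℕ) (M : Mem) : Prop := (∀ a, A ≤ a → M a = 0) ∧ ∀ a, M a ≤ V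

theorem InBounds.update {A V : ℕ} {M : Mem} (h : InBounds A V M) {a x : ℕ} (ha : a < A)
    (hx : x ≤ V) : InBounds A V (Function.update M a x) := by
  refine ⟨fun b hb => ?_, fun b => ?_⟩
  · rw [Function.update_of_ne (by omega)]; exact h.1 b hb
  · rcases eq_or_ne b a with rfl | hne
    · rwa [Function.update_self]
    · rw [Function.update_of_ne hne]; exact h.2 b

section Ends

variable {A V : ℕ} {M : Mem} {s : List (ℕ × ℕ)} {Q : Mem → List (ℕ × ℕ) → Prop}

theorem Ends.skip {I : Mem → Prop} (h : Q M s) : Ends I .skip M s Q := ⟨M, s, .skip, h⟩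

theorem Ends.set {a e : Expr} (hM : InBounds A V M) (x y : ℕ) (hx : a.eval M = x)
    (hy : e.eval M = y) (hxA : x < A) (hyV : y ≤ V)
    (h : ∀ M', InBounds A V M' → (∀ b, M' b = if b = x then y else M b) → Q M' s) :
    Ends (InBounds A V) (.set a e) M s Q := by
  have hI := hM.update hxA hyV
  subst hx hy
  exact ⟨_, _, .set hI, h _ hI fun b => Function.update_apply _ _ _ _⟩

theorem Ends.next {u v f x y : ℕ} (hM : InBounds A V M) (hu : u < A) (hv : v < A) (hf : f < A)
    (hx : x ≤ V) (hy : y ≤ V) (hV : 1 ≤ V)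
    (h : ∀ M', InBounds A V M' →
      (∀ b, M' b = if b = f then 1 else if b = v then y else if b = u then x else M b) → Q M' s) :
    Ends (InBounds A V) (.next u v f) M ((x, y) :: s) Q := by
  have hI := ((hM.update hu hx).update hv hy).update hf hV
  exact ⟨_, _, .next hI, h _ hI fun b => by simp [Function.update_apply]⟩

theorem Ends.seq {I : Mem → Prop} {p q : Prog} (h : Ends I p M s fun M₁ s₁ => Ends I q M₁ s₁ Q) :
    Ends I (.seq p q) M s Q := by
  obtain ⟨M₁, s₁, h₁, M₂, s₂, h₂, hQ⟩ := h
  exact ⟨M₂, s₂, .seq h₁ h₂, hQ⟩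

theorem Ends.ite_true {I : Mem → Prop} {e : Expr} {p q : Prog} (he : e.eval M ≠ 0)
    (h : Ends I p M s Q) : Ends I (.ite e p q) M s Q := by
  obtain ⟨M₁, s₁, h₁, hQ⟩ := h
  exact ⟨M₁, s₁, .ite_true he h₁, hQ⟩

theorem Ends.ite_false {I : Mem → Prop} {e : Expr} {p q : Prog} (he : e.eval M = 0)
    (h : Ends I q M s Q) : Ends I (.ite e p q) M s Q := by
  obtain ⟨M₁, s₁, h₁, hQ⟩ := h
  exact ⟨M₁, s₁, .ite_false he h₁, hQ⟩

theorem Ends.loop_true {I : Mem → Prop} {e : Expr} {p : Prog} (he : e.eval M ≠ 0)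
    (h : Ends I p M s fun M₁ s₁ => Ends I (.loop e p) M₁ s₁ Q) : Ends I (.loop e p) M s Q := by
  obtain ⟨M₁, s₁, h₁, M₂, s₂, h₂, hQ⟩ := h
  exact ⟨M₂, s₂, .loop_true he h₁ h₂, hQ⟩

theorem Ends.loop_false {I : Mem → Prop} {e : Expr} {p : Prog} (he : e.eval M = 0)
    (h : Q M s) : Ends I (.loop e p) M s Q := ⟨M, s, .loop_false he, h⟩

theorem Ends.imp {I : Mem → Prop} {p : Prog} {Q' : Mem → List (ℕ × ℕ) → Prop}
    (h : Ends I p M s Q) (hQ : ∀ M' s', Q M' s' → Q' M' s') : Ends I p M s Q' := by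
  obtain ⟨M₁, s₁, h₁, h₂⟩ := h
  exact ⟨M₁, s₁, h₁, hQ _ _ h₂⟩

end Ends

/-! ### The program for a stage

A stack of frames starts at address `15`, and cell `2` points to its top. A frame consists of a
vertex, `4 ^ i` for the current stage `i`, the number of trials left and the budget left. Cell `6`
is the flag that the top frame has failed its stage. -/

/-- The content of a cell with a fixed address. -/
def cell (k : ℕ) : Expr := .get (.lit k)

/-- The address of an entry of the top frame. -/
def topAddr (o : ℕ) : Expr := .add (cell 2) (.lit o)

/-- An entry of the top frame. -/
def top (o : ℕ) : Expr := .get (topAddr o)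

/-- The distance of two numbers. -/
def dist (a b : Expr) : Expr := .add (.sub a b) (.sub b a)

/-- Remove the top frame, whose vertex has failed a stage. -/
def popFailed : Prog :=
  .seq (.set (.lit 2) (.sub (cell 2) (.lit 4)))
    (.ite (.sub (.mul (.lit 4) (top 5)) (top 3)) .skip
      (.seq (.set (topAddr 3) (.sub (top 3) (.mul (.lit 4) (top 5)))) (.set (.lit 6) (.lit 0))))

/-- The next trial of the vertex of the top frame. -/
def trial : Prog :=
  .seq (.next 3 4 5) (.seq (.set (topAddr 2) (.sub (top 2) (.lit 1)))
    (.ite (.mul (dist (top 0) (cell 3)) (dist (top 0) (cell 4))) .skip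
      (.ite (.sub (top 1) (.lit 1))
        (.seq (.set (topAddr 4) (.sub (.add (cell 3) (cell 4)) (top 0)))
          (.seq (.set (topAddr 5) (.lit 1)) (.seq (.set (topAddr 6) (.lit 1))
            (.seq (.set (topAddr 7) (.lit 1)) (.set (.lit 2) (topAddr 4))))))
        (.set (.lit 6) (.lit 1)))))

/-- The vertex of the top frame has survived a stage. -/
def nextStage : Prog :=
  .seq (.set (topAddr 1) (.mul (.lit 4) (top 1)))
    (.ite (dist (top 1) (.get (.sub (cell 2) (.lit 3))))
      (.seq (.set (topAddr 2) (top 1)) (.set (topAddr 3) (top 1)))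
      (.seq (.set (.lit 2) (.sub (cell 2) (.lit 4))) (.set (.lit 6) (.lit 1))))

/-- One iteration of the main loop of a stage. -/
def stageBody : Prog := .ite (cell 6) popFailed (.ite (top 2) trial nextStage)

/-- The stage of the bottom frame is not over. -/
def stageCond : Expr := .add (.sub (cell 2) (.lit 15)) (.mul (top 2) (.sub (.lit 1) (cell 6)))

/-- Run the stage given by cell `9` on the vertex in cell `r`. -/
def stageProg (r : ℕ) : Prog :=
  .seq (.set (.lit 2) (.lit 15)) (.seq (.set (.lit 15) (cell r)) (.seq (.set (.lit 16) (cell 9))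
    (.seq (.set (.lit 17) (cell 9)) (.seq (.set (.lit 18) (cell 9)) (.seq (.set (.lit 6) (.lit 0))
      (.loop stageCond stageBody))))))

/-- The four entries of the frame at address `D`. -/
structure Frame (M : Mem) (D v p k b : ℕ) : Prop where
  vertex : M D = v
  power : M (D + 1) = p
  trials : M (D + 2) = k
  budget : M (D + 3) = b

/-- The memory below `D`, apart from scratch cells, is the same. -/
def SameBelow (D : ℕ) (M M' : Mem) : Prop := ∀ a < D, a < 2 ∨ 6 < a → M' a = M a

theorem SameBelow.refl (D : ℕ) (M : Mem) : SameBelow D M M := fun _ _ _ => rfl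

theorem SameBelow.trans {D D' : ℕ} {M M₁ M₂ : Mem} (h : SameBelow D M M₁)
    (h' : SameBelow D' M₁ M₂) (hD : D ≤ D') : SameBelow D M M₂ := fun a ha ha' =>
  (h' a (by omega) ha').trans (h a ha ha')

theorem Frame.of_same {M M' : Mem} {D D' v p k b : ℕ} (h : Frame M D v p k b)
    (h' : SameBelow D' M M') (hD : D + 4 ≤ D') (h6 : 6 < D) : Frame M' D v p k b :=
  ⟨(h' _ (by omega) (by omega)).trans h.1, (h' _ (by omega) (by omega)).trans h.2,
    (h' _ (by omega) (by omega)).trans h.3, (h' _ (by omega) (by omega)).trans h.4⟩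

/-! ### The cases of one iteration of the main loop of a stage. -/

section Body

variable {A V d v p k b : ℕ} {M : Mem} {s : List (ℕ × ℕ)} {e : ℕ × ℕ}

theorem trial_miss (hM : InBounds A V M) (hA : d + 19 ≤ A) (hV : 1 ≤ V) (h2 : M 2 = d + 15)
    (h6 : M 6 = 0) (hF : Frame M (d + 15) v p (k + 1) b) (hx : e.1 ≤ V) (hy : e.2 ≤ V)
    (he : ¬ (v = e.1 ∨ v = e.2)) :
    Ends (InBounds A V) stageBody M (e :: s) fun M' s' => s' = s ∧ InBounds A V M' ∧
      M' 2 = d + 15 ∧ M' 6 = 0 ∧ Frame M' (d + 15) v p k b ∧ SameBelow (d + 15) M M' := by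
  obtain ⟨f1, f2, f3, f4⟩ := hF
  have hk := hM.2 (d + 15 + 2)
  refine Ends.ite_false (by simp [cell, Expr.eval, h6]) (Ends.ite_true
    (by simp [cell, top, topAddr, Expr.eval, h2, f3]) (Ends.seq (Ends.next hM (by omega) (by omega)
      (by omega) hx hy hV fun M₁ hM₁ u₁ => Ends.seq (Ends.set hM₁ (d + 17) k
      (by simp [cell, topAddr, Expr.eval, u₁, h2])
      (by simp [cell, top, topAddr, Expr.eval, u₁, h2, f3])
      (by omega) (by omega) fun M₂ hM₂ u₂ => Ends.ite_true ?_ (Ends.skip ⟨rfl, hM₂, ?_⟩)))))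
  · simp [cell, top, topAddr, dist, Expr.eval, u₁, u₂, h2, f1]
    omega
  · refine ⟨by simp [u₁, u₂, h2], by simp [u₁, u₂, h6], ⟨?_, ?_, ?_, ?_⟩, fun a ha ha' => ?_⟩
    · simp [u₁, u₂, f1]
    · simp [u₁, u₂, f2]
    · simp [u₂]
    · simp [u₁, u₂, f4]
    · rw [u₂, u₁, if_neg (by omega), if_neg (by omega), if_neg (by omega), if_neg (by omega)]

end Body

end StreamRAM

namespace StreamRAM

section Body

variable {A V d v p k b : ℕ} {M : Mem} {s : List (ℕ × ℕ)} {e : ℕ × ℕ}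

theorem otherEnd_le (he : v = e.1 ∨ v = e.2) (hx : e.1 ≤ V) (hy : e.2 ≤ V) :
    otherEnd e v ≤ V := by
  rw [otherEnd]; omega

theorem trial_hit_zero (hM : InBounds A V M) (hA : d + 19 ≤ A) (hV : 1 ≤ V) (h2 : M 2 = d + 15)
    (h6 : M 6 = 0) (hF : Frame M (d + 15) v 1 (k + 1) b) (hx : e.1 ≤ V) (hy : e.2 ≤ V)
    (he : v = e.1 ∨ v = e.2) :
    Ends (InBounds A V) stageBody M (e :: s) fun M' s' => s' = s ∧ InBounds A V M' ∧
      M' 2 = d + 15 ∧ M' 6 = 1 ∧ Frame M' (d + 15) v 1 k b ∧ SameBelow (d + 15) M M' := by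
  obtain ⟨f1, f2, f3, f4⟩ := hF
  have hk := hM.2 (d + 15 + 2)
  refine Ends.ite_false (by simp [cell, Expr.eval, h6]) (Ends.ite_true
    (by simp [cell, top, topAddr, Expr.eval, h2, f3]) (Ends.seq (Ends.next hM (by omega) (by omega)
      (by omega) hx hy hV fun M₁ hM₁ u₁ => Ends.seq (Ends.set hM₁ (d + 17) k
      (by simp [cell, topAddr, Expr.eval, u₁, h2])
      (by simp [cell, top, topAddr, Expr.eval, u₁, h2, f3])
      (by omega) (by omega) fun M₂ hM₂ u₂ => Ends.ite_false ?_ (Ends.ite_false ?_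
      (Ends.set hM₂ 6 1 rfl rfl (by omega) hV fun M₃ hM₃ u₃ => ⟨rfl, hM₃, ?_⟩))))))
  · simp [cell, top, topAddr, dist, Expr.eval, u₁, u₂, h2, f1]
    omega
  · simp [cell, top, topAddr, Expr.eval, u₁, u₂, h2, f2]
  · refine ⟨by simp [u₁, u₂, u₃, h2], by simp [u₃], ⟨?_, ?_, ?_, ?_⟩, fun a ha ha' => ?_⟩
    · simp [u₁, u₂, u₃, f1]
    · simp [u₁, u₂, u₃, f2]
    · simp [u₂, u₃]
    · simp [u₁, u₂, u₃, f4]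
    · rw [u₃, u₂, u₁, if_neg (by omega), if_neg (by omega), if_neg (by omega), if_neg (by omega),
        if_neg (by omega)]

theorem trial_hit (hM : InBounds A V M) (hA : d + 23 ≤ A) (hV : d + 19 ≤ V) (h2 : M 2 = d + 15)
    (h6 : M 6 = 0) (hF : Frame M (d + 15) v p (k + 1) b) (hp : 1 < p) (hx : e.1 ≤ V) (hy : e.2 ≤ V)
    (he : v = e.1 ∨ v = e.2) :
    Ends (InBounds A V) stageBody M (e :: s) fun M' s' => s' = s ∧ InBounds A V M' ∧
      M' 2 = d + 19 ∧ M' 6 = 0 ∧ Frame M' (d + 15) v p k b ∧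
      Frame M' (d + 19) (otherEnd e v) 1 1 1 ∧ SameBelow (d + 15) M M' := by
  obtain ⟨f1, f2, f3, f4⟩ := hF
  have hk := hM.2 (d + 15 + 2)
  have hw := otherEnd_le he hx hy
  refine Ends.ite_false (by simp [cell, Expr.eval, h6]) (Ends.ite_true
    (by simp [cell, top, topAddr, Expr.eval, h2, f3]) (Ends.seq (Ends.next hM (by omega) (by omega)
      (by omega) hx hy (by omega) fun M₁ hM₁ u₁ => Ends.seq (Ends.set hM₁ (d + 17) k
      (by simp [cell, topAddr, Expr.eval, u₁, h2])
      (by simp [cell, top, topAddr, Expr.eval, u₁, h2, f3])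
      (by omega) (by omega) fun M₂ hM₂ u₂ => Ends.ite_false ?_ (Ends.ite_true ?_
      (Ends.seq (Ends.set hM₂ (d + 19) (otherEnd e v) ?_ ?_ (by omega) hw fun M₃ hM₃ u₃ =>
       Ends.seq (Ends.set hM₃ (d + 20) 1 ?_ rfl (by omega) (by omega) fun M₄ hM₄ u₄ =>
       Ends.seq (Ends.set hM₄ (d + 21) 1 ?_ rfl (by omega) (by omega) fun M₅ hM₅ u₅ =>
       Ends.seq (Ends.set hM₅ (d + 22) 1 ?_ rfl (by omega) (by omega) fun M₆ hM₆ u₆ =>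
       Ends.set hM₆ 2 (d + 19) rfl ?_ (by omega) (by omega) fun M₇ hM₇ u₇ =>
        ⟨rfl, hM₇, ?_⟩))))))))))
  · simp [cell, top, topAddr, dist, Expr.eval, u₁, u₂, h2, f1]
    omega
  · simp [cell, top, topAddr, Expr.eval, u₁, u₂, h2, f2]
    omega
  · simp [cell, topAddr, Expr.eval, u₁, u₂, h2]
  · simp [cell, top, topAddr, Expr.eval, u₁, u₂, h2, f1, otherEnd]
  · simp [cell, topAddr, Expr.eval, u₁, u₂, u₃, h2]
  · simp [cell, topAddr, Expr.eval, u₁, u₂, u₃, u₄, h2]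
  · simp [cell, topAddr, Expr.eval, u₁, u₂, u₃, u₄, u₅, h2]
  · simp [cell, topAddr, Expr.eval, u₁, u₂, u₃, u₄, u₅, u₆, h2]
  · refine ⟨by simp [u₇], by simp [u₁, u₂, u₃, u₄, u₅, u₆, u₇, h6], ⟨?_, ?_, ?_, ?_⟩,
      ⟨?_, ?_, ?_, ?_⟩, fun a ha ha' => ?_⟩
    · simp [u₁, u₂, u₃, u₄, u₅, u₆, u₇, f1]
    · simp [u₁, u₂, u₃, u₄, u₅, u₆, u₇, f2]
    · simp [u₂, u₃, u₄, u₅, u₆, u₇]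
    · simp [u₁, u₂, u₃, u₄, u₅, u₆, u₇, f4]
    · simp [u₃, u₄, u₅, u₆, u₇]
    · simp [u₄, u₅, u₆, u₇]
    · simp [u₅, u₆, u₇]
    · simp [u₆, u₇]
    · rw [u₇, u₆, u₅, u₄, u₃, u₂, u₁, if_neg (by omega), if_neg (by omega), if_neg (by omega),
        if_neg (by omega), if_neg (by omega), if_neg (by omega), if_neg (by omega),
        if_neg (by omega), if_neg (by omega)]

theorem popFailed_over (hM : InBounds A V M) (hA : d + 19 ≤ A) (hV : d + 15 ≤ V)
    (h2 : M 2 = d + 19) (h6 : M 6 = 1) (hF : Frame M (d + 15) v p k b) {q : ℕ}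
    (hq : M (d + 20) = q) (hb : b < 4 * q) :
    Ends (InBounds A V) stageBody M s fun M' s' => s' = s ∧ InBounds A V M' ∧
      M' 2 = d + 15 ∧ M' 6 = 1 ∧ Frame M' (d + 15) v p k b ∧ SameBelow (d + 15) M M' := by
  obtain ⟨f1, f2, f3, f4⟩ := hF
  refine Ends.ite_true (by simp [cell, Expr.eval, h6]) (Ends.seq (Ends.set hM 2 (d + 15) rfl
    (by simp [cell, Expr.eval, h2]) (by omega) hV fun M₁ hM₁ u₁ => Ends.ite_true ?_
    (Ends.skip ⟨rfl, hM₁, ?_⟩)))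
  · simp [cell, top, topAddr, Expr.eval, u₁, hq, f4]
    omega
  · refine ⟨by simp [u₁], by simp [u₁, h6], ⟨?_, ?_, ?_, ?_⟩, fun a ha ha' => ?_⟩
    · simp [u₁, f1]
    · simp [u₁, f2]
    · simp [u₁, f3]
    · simp [u₁, f4]
    · rw [u₁, if_neg (by omega)]

/-- The popped frame is not erased: its second entry, now at offset `5` from the new top, still
holds `4 ^ i` for the failed stage `i`, so four times this entry is the charge. -/
theorem popFailed_charge (hM : InBounds A V M) (hA : d + 19 ≤ A) (hV : d + 15 ≤ V)
    (h2 : M 2 = d + 19) (h6 : M 6 = 1) (hF : Frame M (d + 15) v p k b) {q : ℕ}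
    (hq : M (d + 20) = q) (hb : ¬ b < 4 * q) :
    Ends (InBounds A V) stageBody M s fun M' s' => s' = s ∧ InBounds A V M' ∧
      M' 2 = d + 15 ∧ M' 6 = 0 ∧ Frame M' (d + 15) v p k (b - 4 * q) ∧
      SameBelow (d + 15) M M' := by
  obtain ⟨f1, f2, f3, f4⟩ := hF
  have hbV := hM.2 (d + 15 + 3)
  refine Ends.ite_true (by simp [cell, Expr.eval, h6]) (Ends.seq (Ends.set hM 2 (d + 15) rfl
    (by simp [cell, Expr.eval, h2]) (by omega) hV fun M₁ hM₁ u₁ => Ends.ite_false ?_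
    (Ends.seq (Ends.set hM₁ (d + 18) (b - 4 * q) ?_ ?_ (by omega) (by omega) fun M₂ hM₂ u₂ =>
    Ends.set hM₂ 6 0 rfl rfl (by omega) (by omega) fun M₃ hM₃ u₃ => ⟨rfl, hM₃, ?_⟩))))
  · simp [cell, top, topAddr, Expr.eval, u₁, hq, f4]
    omega
  · simp [cell, topAddr, Expr.eval, u₁]
  · simp [cell, top, topAddr, Expr.eval, u₁, hq, f4]
  · refine ⟨by simp [u₁, u₂, u₃], by simp [u₃], ⟨?_, ?_, ?_, ?_⟩, fun a ha ha' => ?_⟩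
    · simp [u₁, u₂, u₃, f1]
    · simp [u₁, u₂, u₃, f2]
    · simp [u₁, u₂, u₃, f3]
    · simp [u₂, u₃]
    · rw [u₃, u₂, u₁, if_neg (by omega), if_neg (by omega), if_neg (by omega)]

theorem nextStage_continue {w q : ℕ} (hM : InBounds A V M) (hA : d + 23 ≤ A)
    (h2 : M 2 = d + 19) (h6 : M 6 = 0) (hp : M (d + 16) = p) (hF : Frame M (d + 19) w q 0 b)
    (hq : 4 * q ≠ p) (hqV : 4 * q ≤ V) :
    Ends (InBounds A V) stageBody M s fun M' s' => s' = s ∧ InBounds A V M' ∧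
      M' 2 = d + 19 ∧ M' 6 = 0 ∧ Frame M' (d + 19) w (4 * q) (4 * q) (4 * q) ∧
      SameBelow (d + 19) M M' := by
  obtain ⟨f1, f2, f3, f4⟩ := hF
  refine Ends.ite_false (by simp [cell, Expr.eval, h6]) (Ends.ite_false
    (by simp [cell, top, topAddr, Expr.eval, h2, f3]) (Ends.seq (Ends.set hM (d + 20) (4 * q)
    (by simp [cell, topAddr, Expr.eval, h2]) (by simp [cell, top, topAddr, Expr.eval, h2, f2])
    (by omega) hqV fun M₁ hM₁ u₁ => Ends.ite_true ?_ (Ends.seq (Ends.set hM₁ (d + 21) (4 * q)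
    ?_ ?_ (by omega) hqV fun M₂ hM₂ u₂ => Ends.set hM₂ (d + 22) (4 * q) ?_ ?_ (by omega) hqV
    fun M₃ hM₃ u₃ => ⟨rfl, hM₃, ?_⟩)))))
  · simp [cell, top, topAddr, dist, Expr.eval, u₁, h2, hp]
    omega
  · simp [cell, topAddr, Expr.eval, u₁, h2]
  · simp [cell, top, topAddr, Expr.eval, u₁, h2]
  · simp [cell, topAddr, Expr.eval, u₁, u₂, h2]
  · simp [cell, top, topAddr, Expr.eval, u₁, u₂, h2]
  · refine ⟨by simp [u₁, u₂, u₃, h2], by simp [u₁, u₂, u₃, h6], ⟨?_, ?_, ?_, ?_⟩,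
      fun a ha ha' => ?_⟩
    · simp [u₁, u₂, u₃, f1]
    · simp [u₁, u₂, u₃]
    · simp [u₂, u₃]
    · simp [u₃]
    · rw [u₃, u₂, u₁, if_neg (by omega), if_neg (by omega), if_neg (by omega)]

/-- Once the power of the top frame equals that of its caller, the vertex has survived all stages
that the caller asked for. This is fatal to the caller, hence the flag. -/
theorem nextStage_survived {w q : ℕ} (hM : InBounds A V M) (hA : d + 23 ≤ A) (hV : d + 15 ≤ V)
    (h2 : M 2 = d + 19) (h6 : M 6 = 0) (hp : M (d + 16) = 4 * q) (hF : Frame M (d + 19) w q 0 b) :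
    Ends (InBounds A V) stageBody M s fun M' s' => s' = s ∧ InBounds A V M' ∧
      M' 2 = d + 15 ∧ M' 6 = 1 ∧ SameBelow (d + 19) M M' := by
  obtain ⟨f1, f2, f3, f4⟩ := hF
  have hqV := hM.2 (d + 16)
  refine Ends.ite_false (by simp [cell, Expr.eval, h6]) (Ends.ite_false
    (by simp [cell, top, topAddr, Expr.eval, h2, f3]) (Ends.seq (Ends.set hM (d + 20) (4 * q)
    (by simp [cell, topAddr, Expr.eval, h2]) (by simp [cell, top, topAddr, Expr.eval, h2, f2])
    (by omega) (by omega) fun M₁ hM₁ u₁ => Ends.ite_false ?_ (Ends.seq (Ends.set hM₁ 2 (d + 15)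
    rfl ?_ (by omega) hV fun M₂ hM₂ u₂ => Ends.set hM₂ 6 1 rfl rfl (by omega) (by omega)
    fun M₃ hM₃ u₃ => ⟨rfl, hM₃, ?_⟩)))))
  · simp [cell, top, topAddr, dist, Expr.eval, u₁, h2, hp]
  · simp [cell, Expr.eval, u₁, h2]
  · refine ⟨by simp [u₂, u₃], by simp [u₃], fun a ha ha' => ?_⟩
    rw [u₃, u₂, u₁, if_neg (by omega), if_neg (by omega), if_neg (by omega)]

end Body

/-! ### The program for a stage is correct -/

/-- All entries of the stream are at most `V`. -/
def StreamLe (V : ℕ) (s : List (ℕ × ℕ)) : Prop := ∀ e ∈ s, e.1 ≤ V ∧ e.2 ≤ V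

theorem run_bind {α β : Type} (T : EdgeReader α) (f : α → EdgeReader β) (s : List (ℕ × ℕ)) :
    (T.bind f).run s = (T.run s).bind fun x => (f x.1).run x.2 := by
  induction T generalizing s with
  | ret x => rfl
  | read k ih =>
    cases s with
    | nil => rfl
    | cons e s => exact ih e s

theorem StreamLe.run {α : Type} {V : ℕ} {T : EdgeReader α} {s s' : List (ℕ × ℕ)} {x : α}
    (hs : StreamLe V s) (h : T.run s = some (x, s')) : StreamLe V s' := by
  induction T generalizing s with
  | ret y => cases h; exact hs
  | read k ih =>
    cases s with
    | nil => cases h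
    | cons e s => exact ih e (fun e' he' => hs e' (List.mem_cons_of_mem _ he')) h

theorem Leaves.of_run {α : Type} {P : ℕ → α → Prop} {c : ℕ} {T : EdgeReader α}
    (hT : T.Leaves P c) {s s' : List (ℕ × ℕ)} {x : α} (h : T.run s = some (x, s')) :
    ∃ c', P c' x := by
  induction T generalizing c s with
  | ret y => cases h; exact ⟨c, hT⟩
  | read k ih =>
    cases s with
    | nil => cases h
    | cons e s => exact ih e (hT e) h

theorem stageCond_of_frame {M : Mem} {D v p k b : ℕ} (h2 : M 2 = D) (h6 : M 6 = 0)
    (hF : Frame M D v p (k + 1) b) : stageCond.eval M ≠ 0 := by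
  simp [stageCond, cell, top, topAddr, Expr.eval, h2, h6, hF.trials]

theorem stageCond_of_lt {M : Mem} {d : ℕ} (h2 : M 2 = d + 19) : stageCond.eval M ≠ 0 := by
  simp [stageCond, cell, Expr.eval, h2]

variable {A V : ℕ}

/-- The loop simulates the trials of the top frame. -/
def SimulatesTrials (A V j : ℕ) : Prop :=
  ∀ (k d v b : ℕ) (M : Mem) (s s' : List (ℕ × ℕ)) (r : Bool), d + 4 * j + 19 ≤ A →
    InBounds A V M → StreamLe V s → M 2 = d + 15 → M 6 = 0 → Frame M (d + 15) v (4 ^ j) k b →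
    (trials v j (visit j) k b).run s = some (r, s') →
    ∃ M' k' b', Iter (InBounds A V) stageCond stageBody M s M' s' ∧ InBounds A V M' ∧
      M' 2 = d + 15 ∧ SameBelow (d + 15) M M' ∧ Frame M' (d + 15) v (4 ^ j) k' b' ∧
      (if r then M' 6 = 0 ∧ k' = 0 else M' 6 = 1)

/-- A visit that has survived `i < j` stages leaves its frame ready for stage `i`. The last stage is
left to `visit_finish`, because surviving it removes the frame instead. On failure the frame stays,
so that the charge can be read off. -/
theorem visit_start {j : ℕ} (hjV : 4 ^ j ≤ V) (IH : ∀ i < j, SimulatesTrials A V i)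
    {d w : ℕ} (hA : d + 4 * j + 19 ≤ A) {M : Mem} {s : List (ℕ × ℕ)} (hM : InBounds A V M)
    (hs : StreamLe V s) (h2 : M 2 = d + 19) (h6 : M 6 = 0) (hp : M (d + 16) = 4 ^ j)
    (hF : Frame M (d + 19) w 1 1 1) (i : ℕ) (hi : i < j) (r : ℕ) (s' : List (ℕ × ℕ))
    (hr : (visit i w).run s = some (r, s')) :
    ∃ M', Iter (InBounds A V) stageCond stageBody M s M' s' ∧ InBounds A V M' ∧
      M' 2 = d + 19 ∧ SameBelow (d + 19) M M' ∧
      (r = i ∧ M' 6 = 0 ∧ Frame M' (d + 19) w (4 ^ i) (4 ^ i) (4 ^ i) ∨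
        r < i ∧ M' 6 = 1 ∧ M' (d + 20) = 4 ^ r) := by
  induction i generalizing r s' with
  | zero =>
    cases hr
    exact ⟨M, .refl, hM, h2, .refl _ _, Or.inl ⟨rfl, h6, by simpa using hF⟩⟩
  | succ i ih =>
    rw [visit, run_bind] at hr
    obtain ⟨⟨r₁, s₁⟩, hr₁, hr⟩ := Option.bind_eq_some_iff.1 hr
    obtain ⟨M₁, it₁, hM₁, h₁2, same₁, h | h⟩ := ih (by omega) r₁ s₁ hr₁
    · obtain ⟨rfl, h₁6, hF₁⟩ := h
      simp only [lt_self_iff_false, if_false] at hr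
      rw [run_bind] at hr
      obtain ⟨⟨a, s₂⟩, ha, hr⟩ := Option.bind_eq_some_iff.1 hr
      obtain ⟨M₂, k', b', it₂, hM₂, h₂2, same₂, hF₂, h₂⟩ := IH r₁ (by omega) (4 ^ r₁) (d + 4) w
        (4 ^ r₁) M₁ s₁ s₂ a (by omega) hM₁ (hs.run hr₁) h₁2 h₁6 hF₁ ha
      have same := same₁.trans same₂ le_rfl
      have hp₂ : M₂ (d + 16) = 4 ^ j := (same _ (by omega) (by omega)).trans hp
      cases a with
      | true =>
        cases hr
        obtain ⟨h₂6, rfl⟩ := h₂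
        have hlt : 4 ^ (r₁ + 1) < 4 ^ j := Nat.pow_lt_pow_right (by norm_num) hi
        rw [pow_succ'] at hlt
        obtain ⟨M₃, s₃, ex, rfl, hM₃, h₃2, h₃6, hF₃, same₃⟩ := nextStage_continue (s := s₂) hM₂
          (by omega) h₂2 h₂6 hp₂ hF₂ hlt.ne (by omega)
        refine ⟨M₃, it₁.trans (it₂.trans (.head (stageCond_of_lt h₂2) ex .refl)), hM₃, h₃2,
          same.trans same₃ le_rfl, Or.inl ⟨rfl, h₃6, ?_⟩⟩
        rw [pow_succ']
        exact hF₃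
      | false =>
        cases hr
        exact ⟨M₂, it₁.trans it₂, hM₂, h₂2, same, Or.inr ⟨by simp, h₂, hF₂.power⟩⟩
    · obtain ⟨h, h₁6, hq⟩ := h
      rw [if_pos h] at hr
      cases hr
      exact ⟨M₁, it₁, hM₁, h₁2, same₁, Or.inr ⟨by omega, h₁6, hq⟩⟩

theorem visit_finish (hVA : A ≤ V) {j : ℕ} (hjV : 4 ^ j ≤ V) (IH : ∀ i < j, SimulatesTrials A V i)
    {d w v k b : ℕ} (hA : d + 4 * j + 19 ≤ A) {M : Mem} {s : List (ℕ × ℕ)} (hM : InBounds A V M)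
    (hs : StreamLe V s) (h2 : M 2 = d + 19) (h6 : M 6 = 0) (hp : Frame M (d + 15) v (4 ^ j) k b)
    (hF : Frame M (d + 19) w 1 1 1) (hj : 0 < j) (r : ℕ) (s' : List (ℕ × ℕ))
    (hr : (visit j w).run s = some (r, s')) :
    ∃ M', Iter (InBounds A V) stageCond stageBody M s M' s' ∧ InBounds A V M' ∧
      SameBelow (d + 15) M M' ∧ M' 6 = 1 ∧ Frame M' (d + 15) v (4 ^ j) k b ∧
      (r = j ∧ M' 2 = d + 15 ∨ r < j ∧ M' 2 = d + 19 ∧ M' (d + 20) = 4 ^ r) := by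
  obtain ⟨i, rfl⟩ : ∃ i, j = i + 1 := ⟨j - 1, by omega⟩
  rw [visit, run_bind] at hr
  obtain ⟨⟨r₁, s₁⟩, hr₁, hr⟩ := Option.bind_eq_some_iff.1 hr
  obtain ⟨M₁, it₁, hM₁, h₁2, same₁, h | h⟩ := visit_start hjV IH hA hM hs h2 h6 hp.power hF i
    (by omega) r₁ s₁ hr₁
  · obtain ⟨rfl, h₁6, hF₁⟩ := h
    simp only [lt_self_iff_false, if_false] at hr
    rw [run_bind] at hr
    obtain ⟨⟨a, s₂⟩, ha, hr⟩ := Option.bind_eq_some_iff.1 hr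
    obtain ⟨M₂, k', b', it₂, hM₂, h₂2, same₂, hF₂, h₂⟩ := IH r₁ (by omega) (4 ^ r₁) (d + 4) w
      (4 ^ r₁) M₁ s₁ s₂ a (by omega) hM₁ (hs.run hr₁) h₁2 h₁6 hF₁ ha
    have same := same₁.trans same₂ le_rfl
    have hp₂ := hp.of_same same (by omega) (by omega)
    cases a with
    | true =>
      cases hr
      obtain ⟨h₂6, rfl⟩ := h₂
      obtain ⟨M₃, s₃, ex, rfl, hM₃, h₃2, h₃6, same₃⟩ := nextStage_survived (s := s₂) hM₂
        (by omega) (by omega) h₂2 h₂6 (hp₂.power.trans (pow_succ' _ _)) hF₂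
      exact ⟨M₃, it₁.trans (it₂.trans (.head (stageCond_of_lt h₂2) ex .refl)), hM₃,
        fun a ha ha' => (same.trans same₃ le_rfl) a (by omega) ha', h₃6,
        hp₂.of_same same₃ (by omega) (by omega), Or.inl ⟨rfl, h₃2⟩⟩
    | false =>
      cases hr
      exact ⟨M₂, it₁.trans it₂, hM₂, fun a ha ha' => same a (by omega) ha', h₂, hp₂,
        Or.inr ⟨by simp, h₂2, hF₂.power⟩⟩
  · obtain ⟨h, h₁6, hq⟩ := h
    rw [if_pos h] at hr
    cases hr
    exact ⟨M₁, it₁, hM₁, fun a ha ha' => same₁ a (by omega) ha', h₁6,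
      hp.of_same same₁ (by omega) (by omega), Or.inr ⟨by omega, h₁2, hq⟩⟩

/-- Strong induction on the stage, since a trial of stage `j` calls tests that run only stages below
`j`, and inside it induction on the remaining trials. A single flat loop runs the whole recursion,
so nested calls are composed by concatenating iterations. -/
theorem simulatesTrials (hVA : A ≤ V) (j : ℕ) (hjV : 4 ^ j ≤ V) : SimulatesTrials A V j := by
  induction j using Nat.strong_induction_on with
  | _ j IH =>
  have IH' : ∀ i < j, SimulatesTrials A V i := fun i hi =>
    IH i hi ((Nat.pow_le_pow_right (by norm_num) hi.le).trans hjV)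
  intro k
  induction k with
  | zero =>
    intro d v b M s s' r hA hM hs h2 h6 hF hr
    cases hr
    exact ⟨M, 0, b, .refl, hM, h2, .refl _ _, hF, by simp [h6]⟩
  | succ k ih =>
    intro d v b M s s' r hA hM hs h2 h6 hF hr
    cases s with
    | nil => cases hr
    | cons e s =>
    have hs₁ : StreamLe V s := fun e' he' => hs e' (List.mem_cons_of_mem _ he')
    obtain ⟨hx, hy⟩ := hs e List.mem_cons_self
    have hc := stageCond_of_frame h2 h6 hF
    rw [trials, EdgeReader.run] at hr
    split_ifs at hr with he
    · rw [run_bind] at hr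
      obtain ⟨⟨i, s₂⟩, hi, hr₂⟩ := Option.bind_eq_some_iff.1 hr
      rcases Nat.eq_zero_or_pos j with rfl | hj
      · rw [pow_zero] at hF
        obtain ⟨M₁, s₁, ex, rfl, hM₁, h₁2, h₁6, hF₁, same₁⟩ := trial_hit_zero (s := s) hM (by omega)
          (by omega) h2 h6 hF hx hy he
        cases hi
        cases hr₂
        exact ⟨M₁, k, b, .head hc ex .refl, hM₁, h₁2, same₁, hF₁, by simpa using h₁6⟩
      · obtain ⟨M₁, s₁, ex, rfl, hM₁, h₁2, h₁6, hF₁, hF₁', same₁⟩ := trial_hit (s := s) hM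
          (by omega) (by omega) h2 h6 hF (Nat.one_lt_pow hj.ne' (by norm_num)) hx hy he
        obtain ⟨M₂, it₂, hM₂, same₂, h₂6, hF₂, h | h⟩ := visit_finish hVA hjV IH' hA hM₁ hs₁ h₁2
          h₁6 hF₁ hF₁' hj i s₂ hi
        · obtain ⟨rfl, h₂2⟩ := h
          simp only [lt_self_iff_false, if_false] at hr₂
          cases hr₂
          exact ⟨M₂, k, b, .head hc ex it₂, hM₂, h₂2, same₁.trans same₂ le_rfl, hF₂,
            by simpa using h₂6⟩
        · obtain ⟨hij, h₂2, hq⟩ := h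
          simp only [if_pos hij] at hr₂
          rw [pow_succ'] at hr₂
          split_ifs at hr₂ with hb
          · obtain ⟨M₃, s₃, ex₃, rfl, hM₃, h₃2, h₃6, hF₃, same₃⟩ := popFailed_over (s := s₂) hM₂
              (by omega) (by omega) h₂2 h₂6 hF₂ hq hb
            cases hr₂
            exact ⟨M₃, k, b, .head hc ex (it₂.trans (.head (stageCond_of_lt h₂2) ex₃ .refl)), hM₃,
              h₃2, (same₁.trans same₂ le_rfl).trans same₃ le_rfl, hF₃, by simpa using h₃6⟩
          · obtain ⟨M₃, s₃, ex₃, rfl, hM₃, h₃2, h₃6, hF₃, same₃⟩ := popFailed_charge (s := s₂) hM₂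
              (by omega) (by omega) h₂2 h₂6 hF₂ hq hb
            obtain ⟨M₄, k', b', it₄, hM₄, h₄2, same₄, h₄⟩ := ih d v _ M₃ s₃ s' r hA hM₃
              (hs₁.run hi) h₃2 h₃6 hF₃ hr₂
            exact ⟨M₄, k', b', .head hc ex (it₂.trans (.head (stageCond_of_lt h₂2) ex₃ it₄)), hM₄,
              h₄2, ((same₁.trans same₂ le_rfl).trans same₃ le_rfl).trans same₄ le_rfl, h₄⟩
    · obtain ⟨M₁, s₁, ex, rfl, hM₁, h₁2, h₁6, hF₁, same₁⟩ := trial_miss (s := s) hM (by omega)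
        (by omega) h2 h6 hF hx hy he
      obtain ⟨M₂, k', b', it₂, hM₂, h₂2, same₂, h₂⟩ := ih d v b M₁ s₁ s' r hA hM₁ hs₁ h₁2 h₁6 hF₁ hr
      exact ⟨M₂, k', b', .head hc ex it₂, hM₂, h₂2, same₁.trans same₂ le_rfl, h₂⟩

theorem stageProg_ends (hVA : A ≤ V) {j v x : ℕ} (hjV : 4 ^ j ≤ V) (hA : 4 * j + 19 ≤ A) {M : Mem}
    {s s' : List (ℕ × ℕ)} (hM : InBounds A V M) (hs : StreamLe V s) (h9 : M 9 = 4 ^ j)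
    (hx : M x = v) (hx' : 6 < x ∧ x < 15) {a : Bool} (ha : (stage v j).run s = some (a, s')) :
    Ends (InBounds A V) (stageProg x) M s fun M' s₁ => s₁ = s' ∧ InBounds A V M' ∧
      (M' 6 = if a then 0 else 1) ∧ ∀ c < 15, c < 2 ∨ 6 < c → M' c = M c := by
  have hv : v ≤ V := hx ▸ hM.2 x
  refine Ends.seq (Ends.set hM 2 15 rfl rfl (by omega) (by omega) fun M₁ hM₁ u₁ =>
    Ends.seq (Ends.set hM₁ 15 v rfl ?_ (by omega) hv fun M₂ hM₂ u₂ =>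
    Ends.seq (Ends.set hM₂ 16 (4 ^ j) rfl ?_ (by omega) hjV fun M₃ hM₃ u₃ =>
    Ends.seq (Ends.set hM₃ 17 (4 ^ j) rfl ?_ (by omega) hjV fun M₄ hM₄ u₄ =>
    Ends.seq (Ends.set hM₄ 18 (4 ^ j) rfl ?_ (by omega) hjV fun M₅ hM₅ u₅ =>
    Ends.seq (Ends.set hM₅ 6 0 rfl rfl (by omega) (by omega) fun M₆ hM₆ u₆ => ?_))))))
  · simp only [cell, Expr.eval, u₁]
    rw [if_neg (by omega), hx]
  · simp [cell, Expr.eval, u₁, u₂, h9]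
  · simp [cell, Expr.eval, u₁, u₂, u₃, h9]
  · simp [cell, Expr.eval, u₁, u₂, u₃, u₄, h9]
  · have hF : Frame M₆ (0 + 15) v (4 ^ j) (4 ^ j) (4 ^ j) :=
      ⟨by simp [u₂, u₃, u₄, u₅, u₆], by simp [u₃, u₄, u₅, u₆], by simp [u₄, u₅, u₆],
        by simp [u₅, u₆]⟩
    obtain ⟨M', k', b', it, hM', h2, same, hF', h⟩ := simulatesTrials hVA j hjV (4 ^ j) 0 v (4 ^ j)
      M₆ s s' a (by omega) hM₆ hs (by simp [u₁, u₂, u₃, u₄, u₅, u₆]) (by simp [u₆]) hF ha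
    refine ⟨M', s', it.exec ?_, rfl, hM', ?_, fun c hc hc' => (same c (by omega) hc').trans ?_⟩
    · have hk := hF'.trials
      cases a with
      | true =>
        obtain ⟨h6, rfl⟩ := h
        simp [stageCond, cell, top, topAddr, Expr.eval, h2, hk]
      | false =>
        have h6 : M' 6 = 1 := h
        simp [stageCond, cell, top, topAddr, Expr.eval, h2, h6]
    · cases a with
      | true => exact h.1
      | false => exact h
    · rw [u₆, u₅, u₄, u₃, u₂, u₁, if_neg (by omega), if_neg (by omega), if_neg (by omega),
        if_neg (by omega), if_neg (by omega), if_neg (by omega)]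

end StreamRAM

namespace StreamRAM

/-! ### The whole program

Cell `7` and cell `8` hold the endpoints of the tested edge, cell `9` holds `4 ^ j` for the current
level `j`, cell `10` the total credit, cell `11` the number of tests, cell `12` holds `4 ^ J`, cell
`13` holds `J`, and cell `14` is the flag that the test goes on. -/

/-- One level of the test of an edge. -/
def levelBody : Prog :=
  .seq (.set (.lit 10) (.add (cell 10) (cell 9))) (.seq (.set (.lit 14) (.lit 0))
    (.ite (.sub (cell 12) (cell 9))
      (.seq (stageProg 7) (.ite (cell 6) .skip
        (.seq (stageProg 8) (.ite (cell 6) .skip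
          (.seq (.set (.lit 9) (.mul (.lit 4) (cell 9))) (.set (.lit 14) (.lit 1)))))))
      .skip))

/-- One test of an edge. -/
def testBody : Prog :=
  .seq (.next 3 4 5) (.seq (.set (.lit 7) (cell 3)) (.seq (.set (.lit 8) (cell 4))
    (.seq (.set (.lit 9) (.lit 1)) (.seq (.set (.lit 11) (.add (cell 11) (.lit 1)))
      (.seq (.set (.lit 14) (.lit 1)) (.loop (cell 14) levelBody))))))

/-- Choose the number of levels. -/
def setup : Prog :=
  .seq (.set (.lit 12) (.lit 1))
    (.loop (.sub (.add (cell 1) (.lit 1)) (.mul (.lit 1344) (cell 12)))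
      (.seq (.set (.lit 12) (.mul (.lit 4) (cell 12)))
        (.set (.lit 13) (.add (cell 13) (.lit 1)))))

/-- Compute the estimate. -/
def finish : Prog :=
  .seq (.set (.lit 0) (.div (cell 12)
      (.mul (.mul (.lit 8) (.add (.mul (.lit 8) (cell 13)) (.lit 1))) (cell 11))))
    (.ite (cell 0) .skip (.set (.lit 0) (.lit 1)))

/-- The streaming program that estimates the size of a maximum matching. -/
def matchingProg : Prog :=
  .seq setup (.seq (.loop (.sub (cell 12) (cell 10)) testBody) finish)

variable {A V : ℕ}

/-- The cells that hold the state of the main loop are the same. -/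
def SameGlobal (M M' : Mem) : Prop := ∀ c < 14, c < 2 ∨ 10 < c → M' c = M c

/-- The hypothesis `hz` keeps the credit cell within bounds: the levels from `j` to `j + r` add at
most `2 * 4 ^ (j + r) - 4 ^ j`. -/
theorem levelLoop_ends (hVA : A ≤ V) (u v r j z s₀ : ℕ) (hV : 4 ^ (j + r) ≤ V)
    (hA : 4 * (j + r) + 19 ≤ A) (hz : s₀ + z + 2 * 4 ^ (j + r) ≤ V + 4 ^ j) {M : Mem}
    {s s' : List (ℕ × ℕ)} (hM : InBounds A V M) (hs : StreamLe V s) (h7 : M 7 = u) (h8 : M 8 = v)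
    (h9 : M 9 = 4 ^ j) (h10 : M 10 = s₀ + z) (h12 : M 12 = 4 ^ (j + r)) (h14 : M 14 = 1) {z' : ℕ}
    (h : (levels u v r j z).run s = some (z', s')) :
    Ends (InBounds A V) (.loop (cell 14) levelBody) M s fun M' s₁ => s₁ = s' ∧ InBounds A V M' ∧
      M' 10 = s₀ + z' ∧ SameGlobal M M' := by
  induction r generalizing j z M s with
  | zero =>
    cases h
    rw [add_zero] at h12 hV hz
    refine Ends.loop_true (by simp [cell, Expr.eval, h14]) (Ends.seq (Ends.set hM 10
      (s₀ + (z + 4 ^ j)) rfl ?_ (by omega) (by omega) fun M₁ hM₁ u₁ => Ends.seq (Ends.set hM₁ 14 0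
      rfl rfl (by omega) (by omega) fun M₂ hM₂ u₂ => Ends.ite_false ?_ (Ends.skip
      (Ends.loop_false ?_ ⟨rfl, hM₂, ?_, fun c hc hc' => ?_⟩)))))
    · simp [cell, Expr.eval, h10, h9, add_assoc]
    · simp [cell, Expr.eval, u₁, u₂, h9, h12]
    · simp [cell, Expr.eval, u₂]
    · simp [u₁, u₂]
    · rw [u₂, u₁, if_neg (by omega), if_neg (by omega)]
  | succ r ih =>
    have hlt : 4 ^ (j + 1) ≤ 4 ^ (j + (r + 1)) := Nat.pow_le_pow_right (by norm_num) (by omega)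
    have hpos : 0 < 4 ^ j := by positivity
    have hsucc : 4 ^ (j + 1) = 4 * 4 ^ j := pow_succ' _ _
    rw [levels, run_bind] at h
    obtain ⟨⟨a, s₁⟩, ha, h⟩ := Option.bind_eq_some_iff.1 h
    refine Ends.loop_true (by simp [cell, Expr.eval, h14]) (Ends.seq (Ends.set hM 10
      (s₀ + (z + 4 ^ j)) rfl ?_ (by omega) (by omega) fun M₁ hM₁ u₁ => Ends.seq (Ends.set hM₁ 14 0
      rfl rfl (by omega) (by omega) fun M₂ hM₂ u₂ => Ends.ite_true ?_ (Ends.seq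
      ((stageProg_ends hVA (by omega) (by omega) hM₂ hs (by simp [u₁, u₂, h9])
        (by simp [u₁, u₂, h7] : M₂ 7 = u) (by omega) ha).imp fun M₃ s₃ h₃ => ?_)))))
    · simp [cell, Expr.eval, h10, h9, add_assoc]
    · simp only [cell, Expr.eval, u₁, u₂]
      simp only [Nat.reduceEqDiff, if_false, h9, h12]
      omega
    · obtain ⟨rfl, hM₃, h₃6, same₃⟩ := h₃
      have hs₁ := hs.run ha
      cases a with
      | false =>
        cases h
        refine Ends.ite_true (by simp [cell, Expr.eval, h₃6]) (Ends.skip (Ends.loop_false ?_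
          ⟨rfl, hM₃, ?_, fun c hc hc' => ?_⟩))
        · simp [cell, Expr.eval, same₃ 14, u₂]
        · simp [same₃ 10, u₁, u₂]
        · rw [same₃ c (by omega) (by omega), u₂, u₁, if_neg (by omega), if_neg (by omega)]
      | true =>
        simp only [if_true] at h
        rw [run_bind] at h
        obtain ⟨⟨b, s₄⟩, hb, h₄⟩ := Option.bind_eq_some_iff.1 h
        refine Ends.ite_false (by simp [cell, Expr.eval, h₃6]) (Ends.seq
          ((stageProg_ends hVA (by omega) (by omega) hM₃ hs₁ (by simp [same₃ 9, u₁, u₂, h9])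
            (by simp [same₃ 8, u₁, u₂, h8] : M₃ 8 = v) (by omega) hb).imp fun M₄ s₅ h₅ => ?_))
        obtain ⟨rfl, hM₄, h₄6, same₄⟩ := h₅
        cases b with
        | false =>
          cases h₄
          refine Ends.ite_true (by simp [cell, Expr.eval, h₄6]) (Ends.skip (Ends.loop_false ?_
            ⟨rfl, hM₄, ?_, fun c hc hc' => ?_⟩))
          · simp [cell, Expr.eval, same₄ 14, same₃ 14, u₂]
          · simp [same₄ 10, same₃ 10, u₁, u₂]
          · rw [same₄ c (by omega) (by omega), same₃ c (by omega) (by omega), u₂, u₁,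
              if_neg (by omega), if_neg (by omega)]
        | true =>
          simp only [if_true] at h₄
          refine Ends.ite_false (by simp [cell, Expr.eval, h₄6]) (Ends.seq (Ends.set hM₄ 9
            (4 ^ (j + 1)) rfl ?_ (by omega) (by omega) fun M₅ hM₅ u₅ => Ends.set hM₅ 14 1 rfl rfl
            (by omega) (by omega) fun M₆ hM₆ u₆ => ?_))
          · simp [cell, Expr.eval, same₄ 9, same₃ 9, u₁, u₂, h9, hsucc]
          · have e : j + 1 + r = j + (r + 1) := by omega
            refine (ih (j + 1) (z + 4 ^ j) (by rw [e]; exact hV) (by omega) (by rw [e]; omega) hM₆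
              (hs₁.run hb) ?_ ?_ ?_ ?_ ?_ ?_ h₄).imp fun M₇ s₇ h₇ => ⟨h₇.1, h₇.2.1, h₇.2.2.1,
              fun c hc hc' => (h₇.2.2.2 c hc hc').trans ?_⟩
            · simp [u₅, u₆, same₄ 7, same₃ 7, u₁, u₂, h7]
            · simp [u₅, u₆, same₄ 8, same₃ 8, u₁, u₂, h8]
            · simp [u₅, u₆]
            · simp [u₅, u₆, same₄ 10, same₃ 10, u₁, u₂]
            · simp only [u₆, u₅, same₄ 12 (by omega) (by omega), same₃ 12 (by omega) (by omega), u₂,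
                u₁, Nat.reduceEqDiff, if_false, h12, e]
            · simp [u₆]
            · rw [u₆, u₅, same₄ c (by omega) (by omega), same₃ c (by omega) (by omega), u₂, u₁,
                if_neg (by omega), if_neg (by omega), if_neg (by omega), if_neg (by omega)]

theorem testLoop_ends (hVA : A ≤ V) (J f c N : ℕ) (hV : 3 * 4 ^ J ≤ V) (hA : 4 * J + 19 ≤ A)
    (hf : 4 ^ J ≤ c + f) (hc : c ≤ 3 * 4 ^ J) (hN : N ≤ c) {M : Mem} {s s' : List (ℕ × ℕ)}
    (hM : InBounds A V M) (hs : StreamLe V s) (h10 : M 10 = c) (h11 : M 11 = N)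
    (h12 : M 12 = 4 ^ J) {N' : ℕ} (h : (countTests J (4 ^ J) f c N).run s = some (N', s')) :
    Ends (InBounds A V) (.loop (.sub (cell 12) (cell 10)) testBody) M s fun M' s₁ => s₁ = s' ∧
      InBounds A V M' ∧ M' 11 = N' ∧ (∀ a < 14, a < 2 ∨ 11 < a → M' a = M a) := by
  have hdone : 4 ^ J ≤ c → (EdgeReader.ret N).run s = some (N', s') →
      Ends (InBounds A V) (.loop (.sub (cell 12) (cell 10)) testBody) M s fun M' s₁ => s₁ = s' ∧
      InBounds A V M' ∧ M' 11 = N' ∧ (∀ a < 14, a < 2 ∨ 11 < a → M' a = M a) := by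
    intro hle h
    cases h
    exact Ends.loop_false (by simp [cell, Expr.eval, h10, h12, hle])
      ⟨rfl, hM, h11, fun _ _ _ => rfl⟩
  induction f generalizing c N M s with
  | zero => exact hdone (by omega) h
  | succ f ih =>
    rw [countTests] at h
    split_ifs at h with hle
    · exact hdone hle h
    · rw [run_bind] at h
      obtain ⟨⟨z, s₂⟩, hz, h⟩ := Option.bind_eq_some_iff.1 h
      obtain ⟨_, _, hz0, hzJ⟩ := Leaves.of_run (edgeTest_leaves J 0) hz
      cases s with
      | nil => cases hz
      | cons e s =>
      obtain ⟨hx, hy⟩ := hs e List.mem_cons_self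
      have hs₁ : StreamLe V s := fun e' he' => hs e' (List.mem_cons_of_mem _ he')
      have hz' : (levels e.1 e.2 J 0 0).run s = some (z, s₂) := hz
      refine Ends.loop_true (by simp [cell, Expr.eval, h10, h12]; omega) (Ends.seq (Ends.next hM
        (by omega) (by omega) (by omega) hx hy (by omega) fun M₁ hM₁ u₁ =>
        Ends.seq (Ends.set hM₁ 7 e.1 rfl ?_ (by omega) hx fun M₂ hM₂ u₂ =>
        Ends.seq (Ends.set hM₂ 8 e.2 rfl ?_ (by omega) hy fun M₃ hM₃ u₃ =>
        Ends.seq (Ends.set hM₃ 9 1 rfl rfl (by omega) (by omega) fun M₄ hM₄ u₄ =>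
        Ends.seq (Ends.set hM₄ 11 (N + 1) rfl ?_ (by omega) (by omega) fun M₅ hM₅ u₅ =>
        Ends.seq (Ends.set hM₅ 14 1 rfl rfl (by omega) (by omega) fun M₆ hM₆ u₆ =>
        (levelLoop_ends hVA e.1 e.2 J 0 0 c (by rw [zero_add]; omega) (by omega)
          (by rw [zero_add, pow_zero]; omega) hM₆ hs₁ ?_ ?_ ?_ ?_ ?_ ?_ hz').imp
          fun M₇ s₇ h₇ => ?_)))))))
      · simp [cell, Expr.eval, u₁]
      · simp [cell, Expr.eval, u₁, u₂]
      · simp [cell, Expr.eval, u₁, u₂, u₃, u₄, h11]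
      · simp [u₂, u₃, u₄, u₅, u₆]
      · simp [u₃, u₄, u₅, u₆]
      · simp [u₄, u₅, u₆]
      · simp [u₁, u₂, u₃, u₄, u₅, u₆, h10]
      · simp [u₁, u₂, u₃, u₄, u₅, u₆, h12]
      · simp [u₆]
      · obtain ⟨rfl, hM₇, h₇10, same₇⟩ := h₇
        have hsame : ∀ a < 14, a < 2 ∨ 11 < a → M₇ a = M a := fun a ha ha' => by
          rw [same₇ a ha (by omega), u₆, u₅, u₄, u₃, u₂, u₁, if_neg (by omega), if_neg (by omega),
            if_neg (by omega), if_neg (by omega), if_neg (by omega), if_neg (by omega),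
            if_neg (by omega), if_neg (by omega)]
        have h₇11 : M₇ 11 = N + 1 := by
          rw [same₇ 11 (by omega) (by omega)]
          simp [u₅, u₆]
        have h₇12 : M₇ 12 = 4 ^ J := (hsame 12 (by omega) (by omega)).trans h12
        refine (ih (c + z) (N + 1) (by omega) (by omega) (by omega) hM₇ (hs.run hz) h₇10 h₇11 h₇12 h
          fun hle h => ?_).imp
          fun M₈ s₈ h₈ => ⟨h₈.1, h₈.2.1, h₈.2.2.1,
          fun a ha ha' => (h₈.2.2.2 a ha ha').trans (hsame a ha ha')⟩
        cases h
        exact Ends.loop_false (by simp [cell, Expr.eval, h₇10, h₇12, hle])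
          ⟨rfl, hM₇, h₇11, fun _ _ _ => rfl⟩

theorem setup_ends (J m : ℕ) (hJ : ∀ i < J, 1344 * 4 ^ i ≤ m) (hJ' : m < 1344 * 4 ^ J)
    (hA : 19 ≤ A) (hV : 4 ^ J ≤ V) (hJV : J ≤ V) {M : Mem} {s : List (ℕ × ℕ)}
    (hM : InBounds A V M) (h1 : M 1 = m) (h13 : M 13 = 0) :
    Ends (InBounds A V) setup M s fun M' s₁ => s₁ = s ∧ InBounds A V M' ∧
      M' 12 = 4 ^ J ∧ M' 13 = J ∧ (∀ a < 12, M' a = M a) := by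
  have h4 : 0 < 4 ^ J := by positivity
  refine Ends.seq (Ends.set hM 12 1 rfl rfl (by omega) (by omega) fun M₁ hM₁ u₁ => ?_)
  have key : ∀ r i (M₂ : Mem), i + r = J → InBounds A V M₂ → M₂ 12 = 4 ^ i → M₂ 13 = i →
      (∀ a < 12, M₂ a = M a) → Ends (InBounds A V) (.loop (.sub (.add (cell 1) (.lit 1))
        (.mul (.lit 1344) (cell 12))) (.seq (.set (.lit 12) (.mul (.lit 4) (cell 12)))
        (.set (.lit 13) (.add (cell 13) (.lit 1))))) M₂ s fun M' s₁ => s₁ = s ∧ InBounds A V M' ∧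
      M' 12 = 4 ^ J ∧ M' 13 = J ∧ (∀ a < 12, M' a = M a) := by
    intro r
    induction r with
    | zero =>
      intro i M₂ hi hM₂ h12 h13 same
      obtain rfl : i = J := hi
      refine Ends.loop_false ?_ ⟨rfl, hM₂, h12, h13, same⟩
      simp [cell, Expr.eval, h12, same 1, h1]
      omega
    | succ r ih =>
      intro i M₂ hi hM₂ h12 h13 same
      have h5 := hJ i (by omega)
      have h6 : 4 ^ (i + 1) ≤ 4 ^ J := Nat.pow_le_pow_right (by norm_num) (by omega)
      refine Ends.loop_true ?_ (Ends.seq (Ends.set hM₂ 12 (4 ^ (i + 1)) rfl ?_ (by omega) (by omega)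
        fun M₃ hM₃ u₃ => Ends.set hM₃ 13 (i + 1) rfl ?_ (by omega) (by omega) fun M₄ hM₄ u₄ =>
        ih (i + 1) M₄ (by omega) hM₄ ?_ ?_ fun a ha => ?_))
      · simp [cell, Expr.eval, h12, same 1, h1]
        omega
      · simp [cell, Expr.eval, h12, pow_succ']
      · simp [cell, Expr.eval, u₃, h13]
      · simp [u₃, u₄]
      · simp [u₄]
      · rw [u₄, u₃, if_neg (by omega), if_neg (by omega), same a ha]
  refine key J 0 M₁ (by omega) hM₁ (by simp [u₁]) (by simp [u₁, h13]) fun a ha => ?_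
  rw [u₁, if_neg (by omega)]

theorem finish_ends (hA : 19 ≤ A) {J N : ℕ} (hV : 4 ^ J ≤ V) {M : Mem} {s : List (ℕ × ℕ)}
    (hM : InBounds A V M) (h11 : M 11 = N) (h12 : M 12 = 4 ^ J) (h13 : M 13 = J) :
    Ends (InBounds A V) finish M s fun M' _ => M' 0 = estimate J N := by
  have h4 : 0 < 4 ^ J := by positivity
  refine Ends.seq (Ends.set hM 0 (4 ^ J / (8 * (8 * J + 1) * N)) rfl
    (by simp [cell, Expr.eval, h11, h12, h13]) (by omega) ((Nat.div_le_self _ _).trans hV)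
    fun M₁ hM₁ u₁ => ?_)
  by_cases h : M₁ 0 = 0
  · refine Ends.ite_false (by simpa [cell, Expr.eval] using h) (Ends.set hM₁ 0 1 rfl rfl (by omega)
      (by omega) fun M₂ hM₂ u₂ => ?_)
    rw [u₁, if_pos rfl] at h
    rw [u₂, if_pos rfl, estimate, h]
    rfl
  · refine Ends.ite_true (by simpa [cell, Expr.eval] using h) (Ends.skip ?_)
    rw [u₁, if_pos rfl] at h ⊢
    rw [estimate, max_eq_right (Nat.one_le_iff_ne_zero.2 h)]

/-- The program outputs the estimate that belongs to the number of tests. -/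
theorem matchingProg_ends (hVA : A ≤ V) {J n m : ℕ} (hJ : ∀ i < J, 1344 * 4 ^ i ≤ m)
    (hJ' : m < 1344 * 4 ^ J) (hV : 3 * 4 ^ J ≤ V) (hA : 4 * J + 19 ≤ A) (hn : n ≤ V) (hm : m ≤ V)
    {s s' : List (ℕ × ℕ)} (hs : StreamLe V s) {N : ℕ}
    (h : (countTests J (4 ^ J) (4 ^ J) 0 0).run s = some (N, s')) :
    InBounds A V (init matchingProg n m s).mem ∧
    Ends (InBounds A V) matchingProg (init matchingProg n m s).mem s fun M' _ =>
      M' 0 = estimate J N := by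
  have hM : InBounds A V (init matchingProg n m s).mem := by
    have h0 : InBounds A V (fun _ => 0) := ⟨fun _ _ => rfl, fun _ => Nat.zero_le _⟩
    exact (h0.update (by omega) hn).update (by omega) hm
  refine ⟨hM, Ends.seq ((setup_ends J m hJ hJ' (by omega) (by omega) (by omega) hM
    (by simp [init]) (by simp [init])).imp fun M₁ s₁ h₁ => ?_)⟩
  obtain ⟨rfl, hM₁, h12, h13, same₁⟩ := h₁
  refine Ends.seq ((testLoop_ends hVA J (4 ^ J) 0 0 hV hA (by omega) (by omega) le_rfl hM₁ hs
    (by rw [same₁ 10 (by omega)]; simp [init]) (by rw [same₁ 11 (by omega)]; simp [init]) h12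
    h).imp fun M₂ s₂ h₂ => ?_)
  obtain ⟨rfl, hM₂, h11, same₂⟩ := h₂
  exact finish_ends (by omega) (by omega) hM₂ h11 ((same₂ 12 (by omega) (by omega)).trans h12)
    ((same₂ 13 (by omega) (by omega)).trans h13)

/-- The machine halts with the result of the program, whatever the coins. -/
theorem run_of_ends {I : Mem → Prop} {P : Prog} {n m x : ℕ} {s : List (ℕ × ℕ)}
    (hI : I (init P n m s).mem) (h : Ends I P (init P n m s).mem s fun M' _ => M' 0 = x) :
    ∃ t, ∀ coins : List Bool, I (run P n m s coins).mem ∧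
      (t ≤ coins.length → (run P n m s coins).Halted ∧ (run P n m s coins).output = x) := by
  obtain ⟨M', s', ex, rfl⟩ := h
  obtain ⟨t, ht⟩ := ex.reaches hI []
  have halt : ∀ l : List Bool, l.foldl step ⟨[], M', s'⟩ = ⟨[], M', s'⟩ := fun l => by
    induction l with
    | nil => rfl
    | cons b l ih => exact ih
  have key : ∀ coins : List Bool, t ≤ coins.length → run P n m s coins = ⟨[], M', s'⟩ :=
    fun coins hc => by
      have h₁ := (ht (coins.take t)).2 (by simp [hc])
      have h₂ : (coins.take t).foldl step (init P n m s) = ⟨[], M', s'⟩ := h₁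
      rw [run, ← List.take_append_drop t coins, List.foldl_append, h₂]
      exact halt _
  refine ⟨t, fun coins => ⟨?_, fun hc => ?_⟩⟩
  · rcases Nat.lt_or_ge t coins.length with hc | hc
    · rw [key coins hc.le]
      exact ex.invariant hI
    · exact (ht coins).1 hc
  · rw [key coins hc]
    exact ⟨rfl, rfl⟩

end StreamRAM

/-! ### Memory in bits, and probabilities as counts. -/

theorem StreamRAM.InBounds.memFits {A V : ℕ} {M : StreamRAM.Mem} (h : StreamRAM.InBounds A V M)
    {b : ℝ} (hb : (A * (V.size + 1) : ℝ) ≤ b) : StreamRAM.MemFits M b := by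
  refine ⟨A, h.1, le_trans ?_ hb⟩
  have : ∑ a ∈ Finset.range A, (Nat.size (M a) + 1) ≤ A * (V.size + 1) := by
    refine (Finset.sum_le_card_nsmul _ _ (V.size + 1) fun a _ =>
      Nat.succ_le_succ (Nat.size_le_size (h.2 a))).trans_eq (by simp)
  exact_mod_cast this

theorem three_quarters_le_uniformOfFintype {α : Type*} [Fintype α] [Nonempty α] (S : Set α)
    [DecidablePred (· ∈ S)]
    (h : 4 * (Finset.univ.filter (· ∉ S)).card ≤ Fintype.card α) :
    3 / 4 ≤ (PMF.uniformOfFintype α).toOuterMeasure S := by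
  rw [PMF.toOuterMeasure_uniformOfFintype_apply]
  have h1 : (Finset.univ.filter (· ∈ S)).card + (Finset.univ.filter (· ∉ S)).card =
    Fintype.card α := Finset.card_filter_add_card_filter_not _
  have h2 : Fintype.card S = (Finset.univ.filter (· ∈ S)).card := Fintype.card_subtype _
  have h0 : 0 < Fintype.card α := Fintype.card_pos
  rw [ENNReal.le_div_iff_mul_le (by simp) (by simp), ENNReal.div_eq_inv_mul, mul_assoc,
    ENNReal.inv_mul_le_iff (by simp) (by simp)]
  have : 3 * Fintype.card α ≤ 4 * Fintype.card S := by omega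
  exact_mod_cast this

/-! ### Edge streams of graphs and maximum matchings. -/

namespace SimpleGraph

variable {n : ℕ}

/-- The pair by which an edge is presented in a stream. -/
def edgePair (e : Sym2 (Fin n)) : ℕ × ℕ := ((e.inf : ℕ), (e.sup : ℕ))

theorem edgePair_injective : Function.Injective (edgePair (n := n)) := fun s t h => by
  simp only [edgePair, Prod.mk.injEq, Fin.val_inj] at h
  exact Sym2.inf_eq_inf_and_sup_eq_sup.1 h

theorem mem_edgePair {e : Sym2 (Fin n)} {a : ℕ} :
    a ∈ ({(edgePair e).1, (edgePair e).2} : Finset ℕ) ↔ ∃ v ∈ e, (v : ℕ) = a := by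
  induction e with | _ u v
  rcases le_total u v with h | h <;> simp [edgePair, h, eq_comm, or_comm]

/-- The pairs that form the streams of a graph. -/
def edgePairs (G : SimpleGraph (Fin n)) [DecidableRel G.Adj] : Finset (ℕ × ℕ) :=
  G.edgeFinset.image edgePair

variable (G : SimpleGraph (Fin n)) [DecidableRel G.Adj]

theorem edgePair_ne {e : Sym2 (Fin n)} (he : e ∈ G.edgeFinset) :
    (edgePair e).1 ≠ (edgePair e).2 := by
  induction e with | _ u v
  have : u ≠ v := G.ne_of_adj (by simpa using he)
  rcases le_total u v with h | h <;> simp [edgePair, h, Fin.val_inj, this, this.symm]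

theorem card_edgePairs : G.edgePairs.card = G.edgeFinset.card :=
  Finset.card_image_of_injective _ edgePair_injective

theorem EdgeOrder.stream_mem {G : SimpleGraph (Fin n)} [DecidableRel G.Adj] (σ : G.EdgeOrder) :
    σ.stream ∈ edgeOrders G.edgePairs := by
  have hs : σ.stream = List.ofFn fun i => edgePair (σ i : Sym2 (Fin n)) := rfl
  rw [mem_edgeOrders]
  have hinj : Function.Injective fun i => edgePair (σ i : Sym2 (Fin n)) :=
    edgePair_injective.comp (Subtype.val_injective.comp σ.injective)
  refine (Multiset.Nodup.ext G.edgePairs.nodup ?_).2 fun x => ?_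
  · rw [hs]
    exact List.nodup_ofFn.2 hinj
  · rw [hs, Multiset.mem_coe, List.mem_ofFn', Finset.mem_val, edgePairs, Finset.mem_image]
    constructor
    · rintro ⟨e, he, rfl⟩
      exact ⟨σ.symm ⟨e, by simpa using he⟩, by simp⟩
    · rintro ⟨i, rfl⟩
      exact ⟨σ i, by simp, rfl⟩

theorem EdgeOrder.stream_injective : Function.Injective (EdgeOrder.stream (G := G)) :=
  fun σ τ h => by
  have := List.ofFn_injective h
  refine Equiv.ext fun i => Subtype.ext (edgePair_injective (congrFun this i))

theorem card_edgeOrder : Fintype.card G.EdgeOrder = G.edgeFinset.card.factorial := by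
  have e : G.EdgeOrder := Classical.arbitrary _
  rw [Fintype.card_equiv e, Fintype.card_fin]

/-- A maximum matching, as a set of pairs. -/
theorem exists_maximum_matching :
    ∃ M ⊆ G.edgePairs,
      (M : Set (ℕ × ℕ)).PairwiseDisjoint (fun e => ({e.1, e.2} : Finset ℕ)) ∧
      M.card = G.maxMatchingSize ∧
      ∀ e ∈ G.edgePairs, e.1 ∈ endpoints M ∨ e.2 ∈ endpoints M := by
  classical
  have hb : BddAbove {k : ℕ | ∃ M : G.Subgraph, M.IsMatching ∧ M.edgeSet.ncard = k} := by
    refine ⟨Nat.card (Sym2 (Fin n)), ?_⟩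
    rintro k ⟨M, -, rfl⟩
    exact Set.ncard_le_card _
  obtain ⟨M₀, hM, hk⟩ := Nat.sSup_mem
    (s := {k : ℕ | ∃ M : G.Subgraph, M.IsMatching ∧ M.edgeSet.ncard = k})
    ⟨_, ⊥, by simp [Subgraph.IsMatching], rfl⟩ hb
  have hmem : ∀ v : Fin n, v ∈ M₀.verts →
      (v : ℕ) ∈ endpoints (M₀.edgeSet.toFinset.image edgePair) := fun v hv => by
    obtain ⟨w, hw, -⟩ := hM hv
    exact Finset.mem_biUnion.2 ⟨edgePair s(v, w), Finset.mem_image_of_mem _ (by simpa using hw),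
      mem_edgePair.2 ⟨v, by simp, rfl⟩⟩
  refine ⟨M₀.edgeSet.toFinset.image edgePair, Finset.image_subset_image fun e he => ?_,
    ?_, ?_, ?_⟩
  · simpa using M₀.edgeSet_subset (by simpa using he)
  · rintro _ he _ hf hef
    simp only [Finset.coe_image, Set.coe_toFinset, Set.mem_image] at he hf
    obtain ⟨e, he, rfl⟩ := he
    obtain ⟨f, hf, rfl⟩ := hf
    refine Finset.disjoint_left.2 fun a ha ha' => hef ?_
    obtain ⟨v, hv, rfl⟩ := mem_edgePair.1 ha
    obtain ⟨w, hw, hwv⟩ := mem_edgePair.1 ha'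
    obtain rfl := Fin.ext hwv
    obtain ⟨x, rfl⟩ := hv
    obtain ⟨y, rfl⟩ := hw
    rw [hM.eq_of_adj_left (Subgraph.mem_edgeSet.1 he) (Subgraph.mem_edgeSet.1 hf)]
  · rw [Finset.card_image_of_injective _ edgePair_injective, ← Set.ncard_eq_toFinset_card']
    exact hk
  -- An edge with both ends outside the matching could be added to it, contradicting maximality; so
  -- the endpoints form a vertex cover.
  · intro p hp
    obtain ⟨e, he, rfl⟩ := Finset.mem_image.1 hp
    clear hp
    by_contra! hc
    have hv : ∀ v ∈ e, v ∉ M₀.verts := fun v hv h => by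
      have := mem_edgePair.2 ⟨v, hv, rfl⟩
      rw [Finset.mem_insert, Finset.mem_singleton] at this
      rcases this with h' | h'
      · exact hc.1 (h' ▸ hmem v h)
      · exact hc.2 (h' ▸ hmem v h)
    induction e with | _ u v
    have hadj : G.Adj u v := by simpa using he
    have hd : Disjoint M₀.support (G.subgraphOfAdj hadj).support := by
      rw [hM.support_eq_verts, (Subgraph.IsMatching.subgraphOfAdj hadj).support_eq_verts]
      refine Set.disjoint_right.2 fun w hw => hv w ?_
      simpa using hw
    have h1 : s(u, v) ∉ M₀.edgeSet := fun h => hv u (by simp) (M₀.mem_verts_of_mem_edge h (by simp))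
    have h2 := le_csSup hb ⟨_, hM.sup (Subgraph.IsMatching.subgraphOfAdj hadj) hd, rfl⟩
    rw [Subgraph.edgeSet_sup, edgeSet_subgraphOfAdj, Set.union_singleton,
      Set.ncard_insert_of_notMem h1] at h2
    omega

end SimpleGraph

/-! ### Few orders lead to a bad estimate. -/

/-- The result of a procedure on a stream has a property. -/
def ResultIs (T : EdgeReader ℕ) (P : ℕ → Prop) (l : List (ℕ × ℕ)) : Prop := ∃ x ∈ T.run l, P x.1

open Classical in
/-- The orders of the edges for which the result of a procedure has a property. -/
noncomputable def ordersWith (T : EdgeReader ℕ) (E : Finset (ℕ × ℕ)) (P : ℕ → Prop) :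
    Finset (List (ℕ × ℕ)) := (edgeOrders E).filter (ResultIs T P)

theorem mem_ordersWith {T : EdgeReader ℕ} {E : Finset (ℕ × ℕ)} {P : ℕ → Prop}
    {l : List (ℕ × ℕ)} : l ∈ ordersWith T E P ↔ l ∈ edgeOrders E ∧ ∃ x ∈ T.run l, P x.1 := by
  classical exact Finset.mem_filter

theorem card_ordersWith_le (T : EdgeReader ℕ) (E : Finset (ℕ × ℕ)) (P : ℕ → Prop)
    [DecidablePred P] {c : ℝ}
    (h : pr E (T.words E fun N => ((if P N then 1 else 0 : ℕ) : Words)) ≤ c) :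
    ((ordersWith T E P).card : ℝ) ≤ E.card.factorial * c := by
  refine le_trans (le_of_eq ?_) (mul_le_mul_of_nonneg_left h (Nat.cast_nonneg _))
  rw [← sum_edgeOrders_run T (fun N => if P N then 1 else 0) (Finset.Subset.refl E),
    ordersWith, Finset.card_filter, Nat.cast_sum]
  refine Finset.sum_congr rfl fun l _ => ?_
  rcases hl : T.run l with _ | x <;> simp [ResultIs, hl]

/-- The estimate is correct up to a factor of order `J ^ 2`. -/
def EstimateGood (μ J N : ℕ) : Prop :=
  estimate J N ≤ μ ∧ μ ≤ 10 ^ 7 * (J + 1) ^ 2 * estimate J N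

/-- With `J = 0` there are fewer than `1344` edges, and the constant estimate `1` is good enough. -/
theorem estimateGood_zero {μ m : ℕ} (hμ : 0 < μ) (hμm : μ ≤ m) (hm : m < 1344) (N : ℕ) :
    EstimateGood μ 0 N := by
  have h : estimate 0 N = 1 := by
    rw [estimate, max_eq_left]
    refine (Nat.div_le_self _ _).trans (by simp)
  rw [EstimateGood, h]
  omega

/-- The estimate is decreasing in `N`: the lower bound on `N` prevents overestimation, where `1 ≤ μ`
absorbs the summand `1` of the credit bound, and the upper bound on `N` prevents underestimation. -/
theorem estimateGood_of_lt_of_le {μ m J N : ℕ} (hμ : 0 < μ) (hμm : μ ≤ m) (hm : m ≤ 1344 * 4 ^ J)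
    (h₀ : 4 ^ J / (8 * (1 + 8 * J * μ)) < N)
    (h₁ : N ≤ 48 * 4 ^ J * (1348 + 16 * J) / μ + 1) : EstimateGood μ J N := by
  constructor
  · have hN : 0 < N := (Nat.zero_le _).trans_lt h₀
    refine max_le hμ (Nat.lt_succ_iff.1 ((Nat.div_lt_iff_lt_mul (by positivity)).2 ?_))
    refine ((Nat.div_lt_iff_lt_mul (by positivity)).1 h₀).trans_le ?_
    calc N * (8 * (1 + 8 * J * μ)) ≤ N * (8 * (μ + 8 * J * μ)) := by gcongr; exact hμ
      _ = μ * (8 * (8 * J + 1) * N) := by ring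
      _ ≤ _ := by gcongr; omega
  · refine le_mul_estimate hm hμm ((Nat.zero_le _).trans_lt h₀) ?_
    calc N * μ ≤ (48 * 4 ^ J * (1348 + 16 * J) / μ + 1) * μ := by gcongr
      _ ≤ _ := by
        rw [add_mul, one_mul]
        exact Nat.add_le_add_right (Nat.div_mul_le_self _ _) _

/-- A bad estimate is unlikely. -/
theorem four_mul_card_not_estimateGood_le {E M : Finset (ℕ × ℕ)} (hME : M ⊆ E) (hM0 : 0 < M.card)
    (hne : ∀ e ∈ E, e.1 ≠ e.2)
    (hM : (M : Set (ℕ × ℕ)).PairwiseDisjoint fun e => ({e.1, e.2} : Finset ℕ))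
    (hV : ∀ e ∈ E, e.1 ∈ endpoints M ∨ e.2 ∈ endpoints M) {J : ℕ}
    (hJ : J = 0 ∨ 336 * 4 ^ J ≤ E.card) (hJ' : E.card < 1344 * 4 ^ J) :
    4 * (ordersWith (countTests J (4 ^ J) (4 ^ J) 0 0) E (¬ EstimateGood M.card J ·)).card ≤
      E.card.factorial := by
  have hME' := Finset.card_le_card hME
  rcases hJ with rfl | hJ
  · rw [Finset.card_eq_zero.2 (Finset.eq_empty_of_forall_notMem fun l hl => ?_)]
    · simp
    · obtain ⟨-, x, -, hx⟩ := mem_ordersWith.1 hl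
      exact hx (estimateGood_zero hM0 hME' (by simpa using hJ') _)
  set μ := M.card
  set T := countTests J (4 ^ J) (4 ^ J) 0 0
  set N₀ := 4 ^ J / (8 * (1 + 8 * J * μ))
  set N₁ := 48 * 4 ^ J * (1348 + 16 * J) / μ + 1
  have h₀ := card_ordersWith_le T E (· ≤ N₀) (pr_countTests_le hV J (4 ^ J) N₀
    (by rw [mul_left_comm]; exact Nat.div_mul_le_self _ _) (by positivity))
  have h₁ := card_ordersWith_le T E (N₁ < ·) (pr_lt_countTests_le hME
    (fun e he => hne e (hME he)) hM J N₁ hJ hJ'.le (Nat.lt_div_mul_add hM0 |>.trans_eq (by ring)))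
  -- Too few and too many tests have probability at most `1 / 8` each, together `1 / 4`.
  have hsub : ordersWith T E (¬ EstimateGood μ J ·) ⊆
      ordersWith T E (· ≤ N₀) ∪ ordersWith T E (N₁ < ·) := fun l hl => by
    obtain ⟨hl, x, hx, hg⟩ := mem_ordersWith.1 hl
    rw [Finset.mem_union, mem_ordersWith, mem_ordersWith]
    by_contra! hc
    exact hg (estimateGood_of_lt_of_le hM0 hME' hJ'.le (hc.1 hl x hx) (hc.2 hl x hx))
  have h2 : ((ordersWith T E (¬ EstimateGood μ J ·)).card : ℝ) ≤ _ :=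
    Nat.cast_le.2 ((Finset.card_le_card hsub).trans (Finset.card_union_le _ _))
  rw [Nat.cast_add] at h2
  have : (4 * (ordersWith T E (¬ EstimateGood μ J ·)).card : ℝ) ≤ E.card.factorial := by linarith
  exact_mod_cast this

/-- The number of levels. -/
theorem exists_levels (m : ℕ) : ∃ J, (J = 0 ∨ 336 * 4 ^ J ≤ m) ∧ (∀ i < J, 1344 * 4 ^ i ≤ m) ∧
    m < 1344 * 4 ^ J := by
  classical
  have h : ∃ J, m < 1344 * 4 ^ J := ⟨m, by
    have : m < 4 ^ m := Nat.lt_pow_self (by omega)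
    omega⟩
  have hlt : ∀ i < Nat.find h, 1344 * 4 ^ i ≤ m := fun i hi => not_lt.1 (Nat.find_min h hi)
  refine ⟨Nat.find h, ?_, hlt, Nat.find_spec h⟩
  rcases Nat.eq_zero_or_pos (Nat.find h) with h0 | h0
  · exact .inl h0
  · refine .inr ?_
    -- Minimality of `J` gives `1344 * 4 ^ (J - 1) ≤ m`, and `1344 = 4 * 336`.
    have := hlt (Nat.find h - 1) (by omega)
    obtain ⟨k, hk⟩ := Nat.exists_eq_succ_of_ne_zero h0.ne'
    rw [hk] at this ⊢
    rw [pow_succ]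
    simpa [← mul_assoc, mul_comm, mul_left_comm] using this.trans' (by simp; omega)

namespace StreamRAM

/-- All reads together number at most `7 * (4 ^ J + 2 * 4 ^ J) = 21 * 4 ^ J ≤ m`, so the stream
suffices. Labels, credits and stack addresses are all at most `4 * m`. -/
theorem matchingProg_run {n m J : ℕ} (hn : n ≤ m) (hm : 21 ≤ m)
    (hJ₀ : J = 0 ∨ 336 * 4 ^ J ≤ m) (hJ : ∀ i < J, 1344 * 4 ^ i ≤ m) (hJ' : m < 1344 * 4 ^ J)
    {s : List (ℕ × ℕ)} (hs : StreamLe m s) (hl : s.length = m) :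
    ∃ x ∈ (countTests J (4 ^ J) (4 ^ J) 0 0).run s, ∃ t, ∀ coins : List Bool,
      InBounds (4 * J + 19) (4 * m) (run matchingProg n m s coins).mem ∧
      (t ≤ coins.length → (run matchingProg n m s coins).Halted ∧
        (run matchingProg n m s coins).output = estimate J x.1) := by
  have h4 : 21 * 4 ^ J ≤ m := by
    rcases hJ₀ with rfl | h
    · simpa using hm
    · omega
  have hJ4 : J < 4 ^ J := Nat.lt_pow_self (by omega)
  obtain ⟨N, s', h⟩ :=
    (countTests_leaves J (4 ^ J) (4 ^ J) 0 0 0 (by omega) (by omega)).run_isSome s (by omega)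
  obtain ⟨h1, h2⟩ := matchingProg_ends (n := n) (m := m) (A := 4 * J + 19) (V := 4 * m) (by omega)
    hJ hJ' (by omega) le_rfl (by omega) (by omega) (fun e he => ⟨(hs e he).1.trans (by omega),
      (hs e he).2.trans (by omega)⟩) h
  exact ⟨(N, s'), h, run_of_ends h1 h2⟩

end StreamRAM

/-! ### Logarithmic bounds and the conclusion. -/

theorem four_thirds_le_log {n : ℕ} (hn : 7 ≤ n) : 4 / 3 ≤ Real.log n := by
  have h1 : Real.log ((2 : ℝ) ^ 2) ≤ Real.log n :=
    Real.log_le_log (by norm_num) (by have : (7 : ℝ) ≤ n := by exact_mod_cast hn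
                                      linarith)
  rw [Real.log_pow] at h1
  have := Real.log_two_gt_d9
  push_cast at h1
  linarith

/-- The number of levels is logarithmic. -/
theorem levels_le_log {n m J : ℕ} (hn : 7 ≤ n) (hm : m ≤ n ^ 2) (hJ : 4 ^ J ≤ m) :
    (J : ℝ) ≤ 3 / 2 * Real.log n := by
  have h1 : Real.log ((4 : ℝ) ^ J) ≤ Real.log ((n : ℝ) ^ 2) :=
    Real.log_le_log (by positivity) (by exact_mod_cast hJ.trans hm)
  rw [Real.log_pow, Real.log_pow, show (4 : ℝ) = 2 ^ 2 by norm_num, Real.log_pow] at h1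
  push_cast at h1
  nlinarith [Real.log_two_gt_d9, four_thirds_le_log hn]

/-- The length of the binary expansion of a number that is at most cubic is logarithmic. -/
theorem size_le_log {n k : ℕ} (hn : 7 ≤ n) (hk : k ≤ n ^ 3) :
    (k.size : ℝ) ≤ 1 + 9 / 2 * Real.log n := by
  have hL := four_thirds_le_log hn
  rcases Nat.eq_zero_or_pos k.size with h0 | h0
  · rw [h0]
    push_cast
    linarith
  have h2 : 2 ^ (k.size - 1) ≤ k := Nat.lt_size.1 (by omega)
  have h1 : Real.log ((2 : ℝ) ^ (k.size - 1)) ≤ Real.log ((n : ℝ) ^ 3) :=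
    Real.log_le_log (by positivity) (by exact_mod_cast h2.trans hk)
  rw [Real.log_pow, Real.log_pow, Nat.cast_sub h0] at h1
  push_cast at h1
  have h3 : (1 : ℝ) ≤ k.size := by exact_mod_cast h0
  nlinarith [Real.log_two_gt_d9]

theorem theorem1p4 :
    ∃ (P : StreamRAM.Prog) (C : ℝ), ∀ (n : ℕ) (G : SimpleGraph (Fin n)) [DecidableRel G.Adj],
      1 ≤ n → 3 * n ≤ G.edgeFinset.card →
      -- on every order of the edges and all coin flips, `O(log² n)` bits of memory are in use
      -- at all times
      (∀ (σ : G.EdgeOrder) (coins : List Bool),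
        StreamRAM.MemFits (StreamRAM.run P n G.edgeFinset.card σ.stream coins).mem
          (C * Real.log n ^ 2)) ∧
      ∃ T : ℕ,
        -- every run terminates, within `T` steps
        (∀ (σ : G.EdgeOrder) (coins : Fin T → Bool),
          (StreamRAM.run P n G.edgeFinset.card σ.stream (List.ofFn coins)).Halted) ∧
        -- for independent uniformly random order and coins, the output is a `C log² n`-factor
        -- approximation with probability at least `3/4`
        3 / 4 ≤ (PMF.uniformOfFintype (G.EdgeOrder × (Fin T → Bool))).toOuterMeasure
          {ω | ((StreamRAM.run P n G.edgeFinset.card ω.1.stream (List.ofFn ω.2)).output : ℝ)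
                ≤ G.maxMatchingSize ∧
              (G.maxMatchingSize : ℝ) ≤ C * Real.log n ^ 2 *
                (StreamRAM.run P n G.edgeFinset.card ω.1.stream (List.ofFn ω.2)).output} := by
  classical
  refine ⟨StreamRAM.matchingProg, 10 ^ 8, fun n G _ hn0 hm => ?_⟩
  have hchoose : 2 * G.edgeFinset.card ≤ n * (n - 1) := by
    have := G.card_edgeFinset_le_card_choose_two
    rw [Fintype.card_fin, Nat.choose_two_right] at this
    have h := Nat.div_mul_le_self (n * (n - 1)) 2
    omega
  -- A simple graph with at least `3 * n` edges needs `6 * n ≤ n * (n - 1)`. This keeps `log n` away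
  -- from zero, so that additive constants can be absorbed.
  have hn : 7 ≤ n := by
    by_contra h
    have : n * (n - 1) ≤ n * 5 := Nat.mul_le_mul_left _ (by omega)
    omega
  have hE := G.card_edgePairs
  set m := G.edgeFinset.card with hmdef
  have hmn : 2 * m ≤ n ^ 2 := hchoose.trans (by rw [sq]; exact Nat.mul_le_mul_left _ (by omega))
  obtain ⟨J, hJ₀, hJ, hJ'⟩ := exists_levels m
  have hJm : 4 ^ J ≤ m := by
    rcases hJ₀ with rfl | h
    · rw [pow_zero]
      omega
    · omega
  have hL := four_thirds_le_log hn
  have hJL := levels_le_log hn (by omega) hJm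
  have hsize := size_le_log hn (k := 4 * m) (by nlinarith)
  set L := Real.log n
  have hspec : ∀ σ : G.EdgeOrder, _ := fun σ =>
    StreamRAM.matchingProg_run (n := n) (by omega) (by omega) hJ₀ hJ hJ' (s := σ.stream) (fun e he => by
      have he' : e ∈ G.edgePairs.val := by rw [mem_edgeOrders.1 σ.stream_mem]; exact he
      obtain ⟨f, -, rfl⟩ := Finset.mem_image.1 (show e ∈ G.edgePairs from he')
      exact ⟨f.inf.2.le.trans (by omega), f.sup.2.le.trans (by omega)⟩)
      (List.length_ofFn)
  choose x hx t ht using hspec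
  -- The running time may depend on the order; `T` is the maximum over the finitely many orders.
  refine ⟨fun σ coins => (ht σ coins).1.memFits ?_, Finset.univ.sup t, fun σ coins => ?_, ?_⟩
  · push_cast
    have h1 : (4 * J + 19 : ℝ) ≤ 21 * L := by linarith
    have h2 : ((4 * m).size : ℝ) + 1 ≤ 6 * L := by linarith
    calc _ ≤ 21 * L * (6 * L) := mul_le_mul h1 h2 (by positivity) (by positivity)
      _ ≤ _ := by nlinarith
  · exact ((ht σ _).2 (by simpa using Finset.le_sup (f := t) (Finset.mem_univ σ))).1
  · have hout : ∀ ω : G.EdgeOrder × (Fin (Finset.univ.sup t) → Bool),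
        (StreamRAM.run StreamRAM.matchingProg n m ω.1.stream (List.ofFn ω.2)).output = estimate J (x ω.1).1 := fun ω =>
      ((ht ω.1 _).2 (by simpa using Finset.le_sup (f := t) (Finset.mem_univ ω.1))).2
    obtain ⟨M, hME, hM, hcard, hV⟩ := G.exists_maximum_matching
    have hne : ∀ e ∈ G.edgePairs, e.1 ≠ e.2 := fun e he => by
      obtain ⟨f, hf, rfl⟩ := Finset.mem_image.1 he
      exact G.edgePair_ne hf
    have hM0 : 0 < M.card := by
      rw [Finset.card_pos, Finset.nonempty_iff_ne_empty]
      rintro rfl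
      obtain ⟨e, he⟩ := Finset.card_pos.1 (show 0 < G.edgePairs.card by omega)
      simpa [endpoints] using hV e he
    have hbad := four_mul_card_not_estimateGood_le hME hM0 hne hM hV (J := J) (by rwa [hE])
      (by rwa [hE])
    rw [hcard, hE] at hbad
    refine three_quarters_le_uniformOfFintype _ ?_
    rw [Fintype.card_prod, G.card_edgeOrder]
    set B := Finset.univ.filter fun σ : G.EdgeOrder => ¬ EstimateGood G.maxMatchingSize J (x σ).1
    have hB : B.card ≤ (ordersWith (countTests J (4 ^ J) (4 ^ J) 0 0) G.edgePairs
        (¬ EstimateGood G.maxMatchingSize J ·)).card :=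
      Finset.card_le_card_of_injOn SimpleGraph.EdgeOrder.stream (fun σ hσ => Finset.mem_coe.2
        (mem_ordersWith.2 ⟨σ.stream_mem, x σ, hx σ, (Finset.mem_filter.1 hσ).2⟩))
        (SimpleGraph.EdgeOrder.stream_injective G).injOn
    refine le_trans ?_ (Nat.mul_le_mul_right _ ((Nat.mul_le_mul_left 4 hB).trans hbad))
    -- By `hout` the output ignores the coins, so the bad outcomes lie in the product of the bad
    -- orders with all coin sequences.
    rw [mul_assoc, ← Finset.card_univ, ← Finset.card_product]
    refine Nat.mul_le_mul_left 4 (Finset.card_le_card fun ω hω => ?_)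
    refine Finset.mem_product.2 ⟨Finset.mem_filter.2 ⟨Finset.mem_univ _, fun hg => ?_⟩,
      Finset.mem_univ _⟩
    refine (Finset.mem_filter.1 hω).2 ?_
    rw [Set.mem_ofPred_eq, hout]
    refine ⟨by exact_mod_cast hg.1, le_trans (Nat.cast_le.2 hg.2) ?_⟩
    push_cast
    gcongr ?_ * _
    nlinarith
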